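/- Let $\alpha,\beta>0$ and $v(x)=\alpha x^{-1}e^{-\beta x}$, $x>0$. A gamma process $L$ on a filtered probability space $(\Omega,\mathcal F,\mathbb F,\mathbb P)$ is an $\mathbb F$-adapted process with right-continuous nondecreasing paths, $L_0=0$, whose increments $L_t-L_s$ ($s<t$) are independent of $\mathcal F_s$ and $\mathrm{Gamma}(\alpha(t-s),\beta)$-distributed (shape, rate). Let $\sigma$ be a measurable, locally bounded function on $[0,\infty)$ with $\sigma\ge\sigma_0$ for some constant $\sigma_0>0$, and assume that $$dX_t=\sigma(X_{t-})\,dL_t,\qquad X_0=0,\qquad t\ge 0,$$ where the integral is a pathwise Lebesgue–Stieltjes integral and $X$ has right-continuous nondecreasing paths, admits a weak solution $X$ that is unique in law. On the space of right-continuous nondecreasing paths $x:[0,\infty)\to\mathbb R$ with $x_0=0$, let $X$ now denote the coordinate process and $\mathcal F^X_T=\sigma(X_t,0\le t\le T)$; let $\mathbb P^\sigma$ be the law of the solution, $\mathbb P^1$ the law of the solution for $\sigma\equiv1$ (the gamma process), and $\mathbb P^\sigma_T,\mathbb P^1_T$ their restrictions to $\mathcal F^X_T$. Let $\mu^X$ be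 the jump measure of $X$ and $$Y(t,x)=\frac{1}{\sigma(X_{t-})}\,v\Bigl(\frac{x}{\sigma(X_{t-})}\Bigr)\Big/v(x).$$ Then, almost surely under $\mathbb P^1$ and under $\mathbb P^\sigma$, for every $T>0$ both double integrals in $$\mathcal Z_T:=\exp\left(\int_0^T\!\!\int_0^\infty\log Y(t,x)\,\mu^X(dx,dt)-\int_0^T\!\!\int_0^\infty (Y(t,x)-1)\,v(x)\,dx\,dt\right)$$ are absolutely convergent (finite). The process $\mathcal Z$ (with $\mathcal Z_0=1$) is adapted to $(\mathcal F^X_t)$ and is, up to $\mathbb P^1$-indistinguishability, the unique càdlàg solution $Z$, under $\mathbb P^1$, of $$dZ_t=Z_{t-}\int_{(0,\infty)}(Y(t,x)-1)\bigl(\mu^X(dx,dt)-v(x)\,dx\,dt\bigr),\qquad Z_0=1,$$ that is, of the integrated equation in which the integrals against $\mu^X(dx,dt)$ and $v(x)\,dx\,dt$ over $(0,t]\times(0,\infty)$ are absolutely convergent pathwise integrals. Moreover, for every $T>0$ the measures $\mathbb P^\sigma_T$ and $\mathbb P^1_T$ are equivalent, and $\mathcal Z_T$ is the likelihood ratio: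 $$\frac{d\mathbb P^\sigma_T}{d\mathbb P^1_T}=\mathcal Z_T\qquad \mathbb P^1_T\text{-a.s.}$$ -/

import Mathlib

open MeasureTheory ProbabilityTheory Set Filter Topology
open scoped NNReal ENNReal

universe u

noncomputable section

namespace GammaSDE

/-- The canonical path space: right-continuous nondecreasing functions `x : [0,∞) → ℝ` with
`x 0 = 0`. These are the paths of a subordinator started at `0`, and of the solutions of
`dX = σ(X₋) dL`, `X₀ = 0`, with `σ > 0` and `L` a subordinator. -/
def Path : Type := {x : StieltjesFunction ℝ≥0 // x 0 = 0}

instance : CoeFun Path (fun _ => ℝ≥0 → ℝ) := ⟨fun x => x.1⟩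

/-- The σ-algebra on the path space generated by the coordinate maps. -/
instance : MeasurableSpace Path :=
  MeasurableSpace.comap (fun (x : Path) (t : ℝ≥0) => x t) MeasurableSpace.pi

/-- The left limit `x_{t-}` (with `x_{0-} = x_0 = 0`). -/
def Path.left (x : Path) (t : ℝ≥0) : ℝ := Function.leftLim (fun s => x s) t

/-- The Lebesgue–Stieltjes measure `dx` on `[0,∞)`, with `dx((s,t]) = x t - x s`. -/
def Path.stieltjes (x : Path) : Measure ℝ≥0 := x.1.measure

theorem Path.measurable_apply (t : ℝ≥0) : Measurable (fun x : Path => x t) := by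
  have h : Measurable (fun (x : Path) (t : ℝ≥0) => x t) := comap_measurable _
  exact (measurable_pi_apply t).comp h

/-- The filtration of the coordinate process: `σ(x s : s ≤ t)`. -/
def pathFiltration : Filtration ℝ≥0 (inferInstance : MeasurableSpace Path) :=
  Filtration.natural (fun t (x : Path) => x t)
    (fun t => (Path.measurable_apply t).stronglyMeasurable)

/-- `L` is a gamma process with parameters `α, β`, relative to the filtration `𝔽`: it is adapted,
starts at `0`, has right-continuous nondecreasing paths, and for `s < t` the increment `L t - L s`
is independent of `𝔽 s` and has the Gamma distribution with shape `α (t - s)` and rate `β`. -/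
structure IsGammaProcess {Ω : Type*} {m : MeasurableSpace Ω} (α β : ℝ) (𝔽 : Filtration ℝ≥0 m)
    (P : Measure Ω) (L : Ω → Path) : Prop where
  adapted : ∀ t : ℝ≥0, Measurable[𝔽 t] (fun ω => L ω t)
  law_increment : ∀ s t : ℝ≥0, s < t →
    P.map (fun ω => L ω t - L ω s) = gammaMeasure (α * ((t : ℝ) - s)) β
  indep_increment : ∀ s t : ℝ≥0, s < t →
    Indep (𝔽 s) (MeasurableSpace.comap (fun ω => L ω t - L ω s) inferInstance) P

/-- `(X, L)` on the filtered probability space `(Ω, m, 𝔽, P)` is a weak solution of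
`dX_t = σ(X_{t-}) dL_t`, `X_0 = 0`, with `L` a gamma process. The integral is the pathwise
Lebesgue–Stieltjes integral. -/
structure IsWeakSolution {Ω : Type*} {m : MeasurableSpace Ω} (α β : ℝ) (σ : ℝ → ℝ)
    (𝔽 : Filtration ℝ≥0 m) (P : Measure Ω) (X L : Ω → Path) : Prop where
  isProbabilityMeasure : IsProbabilityMeasure P
  isGammaProcess : IsGammaProcess α β 𝔽 P L
  adapted : ∀ t : ℝ≥0, Measurable[𝔽 t] (fun ω => X ω t)
  sde : ∀ᵐ ω ∂P, ∀ t : ℝ≥0,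
    IntegrableOn (fun s => σ ((X ω).left s)) (Ioc 0 t) (L ω).stieltjes ∧
      X ω t = ∫ s in Ioc 0 t, σ ((X ω).left s) ∂(L ω).stieltjes

/-- `Q` is the law on the path space of some weak solution `X` of `dX_t = σ(X_{t-}) dL_t`,
`X_0 = 0`. -/
def IsSolutionLaw (α β : ℝ) (σ : ℝ → ℝ) (Q : Measure Path) : Prop :=
  ∃ (Ω : Type u) (m : MeasurableSpace Ω) (𝔽 : Filtration ℝ≥0 m) (P : Measure Ω) (X L : Ω → Path),
    IsWeakSolution α β σ 𝔽 P X L ∧ Q = P.map X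

/-- The Lévy density `v(z) = α z⁻¹ exp(-β z)`, `z > 0`, of the gamma process. -/
def levyDensity (α β z : ℝ) : ℝ := α * z⁻¹ * Real.exp (-β * z)

/-- The jump measure `μ^x(dt, dz) = ∑_{s : Δx_s ≠ 0} δ_{(s, Δx_s)}` of the path `x`. -/
def jumpMeasure (x : Path) : Measure (ℝ≥0 × ℝ) :=
  Measure.sum fun s : {s : ℝ≥0 // x.left s ≠ x s} => Measure.dirac (s.1, x s.1 - x.left s.1)

/-- Lebesgue measure `dt` on `[0,∞)`. -/
def lebesgueTime : Measure ℝ≥0 := ((volume : Measure ℝ).restrict (Ici 0)).map Real.toNNReal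

/-- The measure `v(z) dz dt` on `[0,∞) × (0,∞)`. -/
def compensator (α β : ℝ) : Measure (ℝ≥0 × ℝ) :=
  lebesgueTime.prod
    (((volume : Measure ℝ).restrict (Ioi 0)).withDensity fun z => ENNReal.ofReal (levyDensity α β z))

/-- `Y(t,z) = σ(x_{t-})⁻¹ v(z / σ(x_{t-})) / v(z)`. -/
def Y (α β : ℝ) (σ : ℝ → ℝ) (x : Path) (p : ℝ≥0 × ℝ) : ℝ :=
  1 / σ (x.left p.1) * levyDensity α β (p.2 / σ (x.left p.1)) / levyDensity α β p.2

/-- `(0,t] × (0,∞)`. -/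
def strip (t : ℝ≥0) : Set (ℝ≥0 × ℝ) := Ioc 0 t ×ˢ Ioi 0

/-- `z` is right-continuous with left limits. -/
def IsCadlag (z : ℝ≥0 → ℝ) : Prop :=
  ∀ t, ContinuousWithinAt z (Ici t) t ∧ ∃ l, Tendsto z (𝓝[<] t) (𝓝 l)

/-- Under `P`, the process `Z` solves
`dZ_t = Z_{t-} ∫_{(0,∞)} (Y(t,z) - 1) (μ^x(dz,dt) - v(z) dz dt)`, `Z_0 = 1`:
it is càdlàg, and almost surely for all `t` the integrand is integrable over `(0,t] × (0,∞)` with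
respect to both measures and the integrated equation holds. -/
def SolvesDensitySDE (α β : ℝ) (σ : ℝ → ℝ) (P : Measure Path) (Z : ℝ≥0 → Path → ℝ) : Prop :=
  ∀ᵐ x ∂P, IsCadlag (fun t => Z t x) ∧ ∀ t : ℝ≥0,
    IntegrableOn (fun p => Function.leftLim (fun s => Z s x) p.1 * (Y α β σ x p - 1))
      (strip t) (jumpMeasure x) ∧
    IntegrableOn (fun p => Function.leftLim (fun s => Z s x) p.1 * (Y α β σ x p - 1))
      (strip t) (compensator α β) ∧
    Z t x = 1
      + ((∫ p in strip t, Function.leftLim (fun s => Z s x) p.1 * (Y α β σ x p - 1)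
            ∂(jumpMeasure x))
        - ∫ p in strip t, Function.leftLim (fun s => Z s x) p.1 * (Y α β σ x p - 1)
            ∂(compensator α β))

/-- `exp (∫₀ᵗ∫₀^∞ log Y dμ^x - ∫₀ᵗ∫₀^∞ (Y - 1) v(z) dz ds)`. -/
def explicitDensity (α β : ℝ) (σ : ℝ → ℝ) (t : ℝ≥0) (x : Path) : ℝ :=
  Real.exp ((∫ p in strip t, Real.log (Y α β σ x p) ∂(jumpMeasure x))
    - ∫ p in strip t, (Y α β σ x p - 1) ∂(compensator α β))

end GammaSDE

end

namespace GammaSDE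

/-! ### Paths -/

namespace Path

/-! In the ratio defining $Y$ the factors $z^{-1}$ cancel, so $Y(t,z)=\exp(\beta
z(1-1/\sigma(x_{t-})))$. Thus $\log Y$ is linear in the jump size, and Frullani's integral gives
$\int (Y-1)\,v\,dz=\alpha\log\sigma(x_{t-})$. Hence, for every path, $\mathcal
Z_T=\exp\bigl(\sum_{s\le T}\beta(1-1/\sigma(x_{s-}))\Delta
x_s-\int_0^T\alpha\log\sigma(x_{s-})\,ds\bigr)$. Both terms are finite because $\sigma$ lies between
two positive constants on $[0,x_T]$ and the jumps are summable. Convergence, adaptedness and the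
equation for $\mathcal Z$ are therefore pathwise facts, with no exceptional set. The equation is the
exponential formula for finitely many jumps (`exp_finite_jumps`) followed by a limit over finite
sets of jumps (`exp_summable_jumps`). Uniqueness is a Grönwall argument that moves to the right from
the last time up to which two solutions agree (`eq_zero_of_linear_equation`).

The likelihood ratio is obtained in the inverse direction: a solution $X$ is turned back into a
gamma process. If $\xi$ is $\mathrm{Gamma}(a,\beta)$, then $g\xi$ has the same law after reweighting
by $e^{\beta(1-g)\xi}g^a$ (`lintegral_gammaMeasure_tilt`). With independent increments, $g$ may be
random but known at the start of each step. So under the density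
$D=\exp(\int\beta(1-G)\,dL+\int\alpha\log G\,dt)$ the process $\int G\,dL$ has the gamma law on
dyadic grids when $G$ is a step process. This passes to $G=g(X_-)$ with $g$ continuous by
left-endpoint sampling, to bounded measurable $g$ by $L^1$ approximation, and to $\sigma$ by
truncation on $\{X_T\le n\}$ (`withDensity_tilt_map_eq`). Dominated convergence works because
$e^{\beta(1-c)L_T}$ is integrable for every $c>0$.

It remains to recognise $D$. A gamma process has almost surely no continuous part
(`ae_stieltjes_diff_jumps`), and $dX=\sigma(X_-)\,dL$, so $D=1/\mathcal Z_T(X)$ is a function of the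
path of $X$. Hence $\mathbb P^1_T=\mathcal Z_T^{-1}\,\mathbb P^\sigma_T$ on grid cylinders, which
generate $\mathcal F^X_T$. Inverting the positive density gives equivalence and the stated ratio.
That $\mathcal Z_T$ has $\mathbb P^1$-mean one is a consequence and is never proved in advance. -/

theorem mono (x : Path) : Monotone x := x.1.mono

theorem map_zero (x : Path) : x 0 = 0 := x.2

theorem left_mono (x : Path) : Monotone x.left := x.mono.leftLim

theorem left_le (x : Path) (t : ℝ≥0) : x.left t ≤ x t := x.mono.leftLim_le le_rfl

theorem left_zero (x : Path) : x.left 0 = 0 := by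
  exact (leftLim_eq_of_isBot isBot_bot).trans x.map_zero

theorem left_nonneg (x : Path) (t : ℝ≥0) : 0 ≤ x.left t :=
  x.left_zero.symm.le.trans (x.left_mono (zero_le (a := t)))

theorem measurable_coe (x : Path) : Measurable x := x.mono.measurable

theorem measurable_left (x : Path) : Measurable x.left := x.left_mono.measurable

theorem stieltjes_Ioc (x : Path) (s t : ℝ≥0) :
    x.stieltjes (Ioc s t) = ENNReal.ofReal (x t - x s) := x.1.measure_Ioc s t

theorem stieltjes_singleton (x : Path) (s : ℝ≥0) :
    x.stieltjes {s} = ENNReal.ofReal (x s - x.left s) := x.1.measure_singleton s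

theorem stieltjes_Ioc_lt_top (x : Path) (s t : ℝ≥0) : x.stieltjes (Ioc s t) < ∞ := by
  rw [stieltjes_Ioc]; exact ENNReal.ofReal_lt_top

instance (x : Path) (s t : ℝ≥0) : IsFiniteMeasure (x.stieltjes.restrict (Ioc s t)) :=
  ⟨by simpa using x.stieltjes_Ioc_lt_top s t⟩

/-- The jump `x_t - x_{t-}`. -/
noncomputable def jump (x : Path) (t : ℝ≥0) : ℝ := x t - x.left t

theorem measurable_jump (x : Path) : Measurable x.jump := x.measurable_coe.sub x.measurable_left

theorem jump_nonneg (x : Path) (t : ℝ≥0) : 0 ≤ x.jump t := sub_nonneg.2 (x.left_le t)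

/-- The set of jump times. -/
def jumps (x : Path) : Set ℝ≥0 := {s | x.left s ≠ x s}

theorem mem_jumps_iff (x : Path) (s : ℝ≥0) : s ∈ x.jumps ↔ 0 < x.jump s := by
  have := x.left_le s
  constructor
  · intro h; exact sub_pos.2 (lt_of_le_of_ne this h)
  · intro h; exact (sub_pos.1 h).ne

theorem countable_jumps (x : Path) : x.jumps.Countable := x.1.countable_leftLim_ne

theorem measurableSet_jumps (x : Path) : MeasurableSet x.jumps := x.countable_jumps.measurableSet

/-- The counting measure of the jump times. -/
noncomputable def jumpTimes (x : Path) : Measure ℝ≥0 :=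
  Measure.sum fun s : x.jumps => Measure.dirac s.1

theorem lintegral_jumpTimes (x : Path) (f : ℝ≥0 → ℝ≥0∞) :
    ∫⁻ s, f s ∂x.jumpTimes = ∑' s : x.jumps, f s := by
  rw [jumpTimes, lintegral_sum_measure]
  simp

/-- An atom of $dx$ has the jump as its mass. Sums of the form $\sum\Delta x_s f(s)$ thereby become
Stieltjes integrals over the jump set, where bounded $f$ are integrable for free. -/
theorem jumpTimes_withDensity_jump (x : Path) :
    x.jumpTimes.withDensity (fun s => ENNReal.ofReal (x.jump s)) = x.stieltjes.restrict x.jumps := by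
  ext A hA
  rw [withDensity_apply _ hA, ← lintegral_indicator hA, lintegral_jumpTimes,
    Measure.restrict_apply hA, ← Measure.restrict_apply hA, ← lintegral_indicator_one hA,
    lintegral_countable _ x.countable_jumps]
  congr 1 with s
  rw [stieltjes_singleton, ← jump]
  by_cases h : (s : ℝ≥0) ∈ A <;> simp [h]

theorem jumpTimes_ae (x : Path) : ∀ᵐ s ∂x.jumpTimes, 0 < x.jump s := by
  have : MeasurableSet {s | 0 < x.jump s} := measurableSet_lt measurable_const x.measurable_jump
  rw [jumpTimes, Measure.ae_sum_iff' this]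
  intro s
  rw [ae_dirac_iff this]
  exact (x.mem_jumps_iff _).1 s.2

theorem integrableOn_jumpTimes_iff (x : Path) {A : Set ℝ≥0} (hA : MeasurableSet A) (f : ℝ≥0 → ℝ) :
    IntegrableOn (fun s => x.jump s * f s) A x.jumpTimes ↔
      IntegrableOn f (A ∩ x.jumps) x.stieltjes := by
  rw [IntegrableOn, IntegrableOn, ← Measure.restrict_restrict hA, ← jumpTimes_withDensity_jump,
    restrict_withDensity hA,
    integrable_withDensity_iff_integrable_smul₀' x.measurable_jump.ennreal_ofReal.aemeasurable
      (by simp)]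
  simp only [ENNReal.toReal_ofReal (x.jump_nonneg _), smul_eq_mul]

theorem setIntegral_jumpTimes (x : Path) {A : Set ℝ≥0} (hA : MeasurableSet A) (f : ℝ≥0 → ℝ) :
    ∫ s in A, x.jump s * f s ∂x.jumpTimes = ∫ s in A ∩ x.jumps, f s ∂x.stieltjes := by
  rw [← Measure.restrict_restrict hA, ← jumpTimes_withDensity_jump,
    setIntegral_withDensity_eq_setIntegral_toReal_smul x.measurable_jump.ennreal_ofReal
      (by simp) _ hA]
  simp only [ENNReal.toReal_ofReal (x.jump_nonneg _), smul_eq_mul]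

theorem measurable_jumpGraph (x : Path) : Measurable (fun s => (s, x.jump s)) :=
  measurable_id.prodMk x.measurable_jump

theorem measurableEmbedding_jumpGraph (x : Path) :
    MeasurableEmbedding (fun s => (s, x.jump s)) :=
  x.measurable_jumpGraph.measurableEmbedding fun _ _ h => (Prod.ext_iff.1 h).1

/-- The jump measure lives on the graph of $s\mapsto\Delta x_s$. Pushing forward along this
measurable embedding reduces double integrals to integrals in time. -/
theorem jumpMeasure_eq_map (x : Path) :
    jumpMeasure x = x.jumpTimes.map (fun s => (s, x.jump s)) := by
  have : Countable x.jumps := x.countable_jumps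
  rw [jumpTimes, Measure.map_sum x.measurable_jumpGraph.aemeasurable]
  refine congrArg Measure.sum (funext fun s => ?_)
  rw [Measure.map_dirac' x.measurable_jumpGraph]
  rfl

theorem restrict_jumpMeasure_strip (x : Path) (t : ℝ≥0) :
    (jumpMeasure x).restrict (strip t)
      = (x.jumpTimes.restrict (Ioc 0 t)).map (fun s => (s, x.jump s)) := by
  have h : MeasurableSet (strip t) := measurableSet_Ioc.prod measurableSet_Ioi
  rw [jumpMeasure_eq_map, Measure.restrict_map x.measurable_jumpGraph h]
  congr 1
  -- The constraint $z>0$ of the strip is automatic at jump times.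
  refine Measure.restrict_congr_set ?_
  filter_upwards [x.jumpTimes_ae] with s hs
  exact propext ⟨fun h => h.1, fun h => ⟨h, hs⟩⟩

theorem integrableOn_strip_jumpMeasure (x : Path) (t : ℝ≥0) (f : ℝ≥0 × ℝ → ℝ) :
    IntegrableOn f (strip t) (jumpMeasure x) ↔
      IntegrableOn (fun s => f (s, x.jump s)) (Ioc 0 t) x.jumpTimes := by
  rw [IntegrableOn, restrict_jumpMeasure_strip, x.measurableEmbedding_jumpGraph.integrable_map_iff]
  rfl

theorem setIntegral_strip_jumpMeasure (x : Path) (t : ℝ≥0) (f : ℝ≥0 × ℝ → ℝ) :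
    ∫ p in strip t, f p ∂jumpMeasure x = ∫ s in Ioc 0 t, f (s, x.jump s) ∂x.jumpTimes := by
  rw [restrict_jumpMeasure_strip, x.measurableEmbedding_jumpGraph.integral_map]

end Path

/-! ### The integrands -/

theorem levyDensity_pos {α β z : ℝ} (hα : 0 < α) (hz : 0 < z) : 0 < levyDensity α β z := by
  unfold levyDensity; positivity

/-- Since $\sigma^{-1}(z/\sigma)^{-1}=z^{-1}$, the prefactors of the two Lévy densities cancel and
only exponentials remain. -/
theorem Y_eq_exp {α β : ℝ} (hα : 0 < α) {σ : ℝ → ℝ} (x : Path) (p : ℝ≥0 × ℝ)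
    (hσ : 0 < σ (x.left p.1)) (hp : 0 < p.2) :
    Y α β σ x p = Real.exp (β * p.2 * (1 - 1 / σ (x.left p.1))) := by
  unfold Y levyDensity
  have e : β * p.2 * (1 - 1 / σ (x.left p.1))
      = -β * (p.2 / σ (x.left p.1)) - (-β * p.2) := by field_simp; ring
  rw [e, Real.exp_sub]
  field_simp

theorem log_Y {α β : ℝ} (hα : 0 < α) {σ : ℝ → ℝ} (x : Path) (p : ℝ≥0 × ℝ)
    (hσ : 0 < σ (x.left p.1)) (hp : 0 < p.2) :
    Real.log (Y α β σ x p) = p.2 * (β * (1 - 1 / σ (x.left p.1))) := by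
  rw [Y_eq_exp hα x p hσ hp, Real.log_exp]; ring

theorem measurable_levyDensity (α β : ℝ) : Measurable (levyDensity α β) := by
  unfold levyDensity; fun_prop

theorem measurable_Y {α β : ℝ} {σ : ℝ → ℝ} (hσ : Measurable σ) (x : Path) :
    Measurable (Y α β σ x) := by
  have h1 : Measurable (fun p : ℝ≥0 × ℝ => σ (x.left p.1)) :=
    hσ.comp (x.measurable_left.comp measurable_fst)
  unfold Y
  exact ((h1.const_div 1).mul ((measurable_levyDensity α β).comp (measurable_snd.div h1))).div
    ((measurable_levyDensity α β).comp measurable_snd)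

/-- The tilted gamma Lévy density `(e^{β z (1 - 1 / c)} - 1) v(z)`. -/
theorem exp_sub_one_mul_levyDensity {α β c z : ℝ} (hc : 0 < c) (hz : 0 < z) :
    (Real.exp (β * z * (1 - 1 / c)) - 1) * levyDensity α β z
      = α * (z⁻¹ • (Real.exp (-(β / c * z)) - Real.exp (-(β * z)))) := by
  unfold levyDensity
  have e : -(β / c * z) = β * z * (1 - 1 / c) + -(β * z) := by field_simp; ring
  rw [e, Real.exp_add, smul_eq_mul]; ring_nf

/-- For $a\le b$, the bound $1-e^{-y}\le y$ with $y=(b-a)z$ absorbs the factor $z^{-1}$ and leaves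
the integrable majorant $(b-a)e^{-az}$. -/
theorem integrableOn_frullani_exp {a b : ℝ} (ha : 0 < a) (hb : 0 < b) :
    IntegrableOn (fun z : ℝ => z⁻¹ • (Real.exp (-(a * z)) - Real.exp (-(b * z)))) (Ioi 0) := by
  wlog hab : a ≤ b generalizing a b
  · refine (this hb ha (le_of_not_ge hab)).neg.congr (ae_of_all _ fun z => ?_)
    simp only [Pi.neg_apply, smul_eq_mul]; ring
  have h1 : IntegrableOn (fun z : ℝ => (b - a) * Real.exp (-a * z)) (Ioi 0) :=
    (integrableOn_exp_mul_Ioi (by linarith) 0).const_mul _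
  refine h1.mono' (by fun_prop) ?_
  filter_upwards [ae_restrict_mem measurableSet_Ioi] with z hz
  have hz : 0 < z := hz
  have h2 : Real.exp (-(b * z)) = Real.exp (-a * z) * Real.exp (-((b - a) * z)) := by
    rw [← Real.exp_add]; ring_nf
  have h3 : 0 ≤ Real.exp (-(a * z)) - Real.exp (-(b * z)) := by
    rw [sub_nonneg, Real.exp_le_exp]; nlinarith
  rw [smul_eq_mul, Real.norm_of_nonneg (mul_nonneg (inv_nonneg.2 hz.le) h3), h2,
    show -(a * z) = -a * z by ring]
  have h4 := Real.add_one_le_exp (-((b - a) * z))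
  have h5 : z⁻¹ * z = 1 := inv_mul_cancel₀ hz.ne'
  calc z⁻¹ * (Real.exp (-a * z) - Real.exp (-a * z) * Real.exp (-((b - a) * z)))
      = z⁻¹ * (Real.exp (-a * z) * (1 - Real.exp (-((b - a) * z)))) := by ring
    _ ≤ z⁻¹ * (Real.exp (-a * z) * ((b - a) * z)) := by gcongr; linarith
    _ = (z⁻¹ * z) * ((b - a) * Real.exp (-a * z)) := by ring
    _ = _ := by rw [h5, one_mul]

theorem integral_frullani_exp {a b : ℝ} (ha : 0 < a) (hb : 0 < b) :
    ∫ z in Ioi (0 : ℝ), z⁻¹ • (Real.exp (-(a * z)) - Real.exp (-(b * z))) = Real.log (b / a) := by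
  have h := Frullani.integral_Ioi_eq (f := fun z : ℝ => Real.exp (-z)) (L := 1) (R := 0)
    (a := a) (b := b) (by
      have : Continuous fun z : ℝ => Real.exp (-z) := by fun_prop
      exact this.locallyIntegrable.locallyIntegrableOn _) ha hb
    (by
      have : Continuous fun z : ℝ => Real.exp (-z) := by fun_prop
      simpa using this.continuousWithinAt (s := Ioi 0) (x := 0) |>.tendsto)
    Real.tendsto_exp_neg_atTop_nhds_zero (integrableOn_frullani_exp ha hb)
  simpa using h

/-- The measure `v(z) dz` on `(0,∞)`. -/
noncomputable def levyMeasure (α β : ℝ) : Measure ℝ :=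
  ((volume : Measure ℝ).restrict (Ioi 0)).withDensity fun z => ENNReal.ofReal (levyDensity α β z)

theorem levyDensity_toReal_ae {α β : ℝ} (hα : 0 < α) : ∀ᵐ z ∂(volume : Measure ℝ).restrict (Ioi 0),
    (ENNReal.ofReal (levyDensity α β z)).toReal = levyDensity α β z := by
  filter_upwards [ae_restrict_mem measurableSet_Ioi] with z hz
  exact ENNReal.toReal_ofReal (levyDensity_pos hα hz).le

theorem ae_levyMeasure_pos (α β : ℝ) : ∀ᵐ z ∂levyMeasure α β, 0 < z :=
  (withDensity_absolutelyContinuous _ _).ae_le (ae_restrict_mem measurableSet_Ioi)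

theorem integrable_levyMeasure {α β c : ℝ} (hα : 0 < α) (hβ : 0 < β) (hc : 0 < c) :
    Integrable (fun z => Real.exp (β * z * (1 - 1 / c)) - 1) (levyMeasure α β) := by
  rw [levyMeasure, integrable_withDensity_iff_integrable_smul₀'
    (measurable_levyDensity α β).ennreal_ofReal.aemeasurable (by simp)]
  refine ((integrableOn_frullani_exp (div_pos hβ hc) hβ).const_mul α).congr ?_
  filter_upwards [ae_restrict_mem measurableSet_Ioi, levyDensity_toReal_ae hα] with z hz h
  rw [h, ← exp_sub_one_mul_levyDensity hc hz, smul_eq_mul, mul_comm]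

/-- This is Frullani's integral with rates $\beta/c$ and $\beta$, whose quotient is $c$. It
evaluates the compensator in the exponent of $\mathcal Z$. -/
theorem integral_levyMeasure {α β c : ℝ} (hα : 0 < α) (hβ : 0 < β) (hc : 0 < c) :
    ∫ z, (Real.exp (β * z * (1 - 1 / c)) - 1) ∂levyMeasure α β = α * Real.log c := by
  rw [levyMeasure, integral_withDensity_eq_integral_toReal_smul
    (measurable_levyDensity α β).ennreal_ofReal (by simp)]
  have : Real.log c = Real.log (β / (β / c)) := by congr 1; field_simp
  rw [this, ← integral_frullani_exp (div_pos hβ hc) hβ, ← integral_const_mul]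
  refine integral_congr_ae ?_
  filter_upwards [ae_restrict_mem measurableSet_Ioi, levyDensity_toReal_ae hα] with z hz h
  rw [h, ← exp_sub_one_mul_levyDensity hc hz, smul_eq_mul, mul_comm]

/-- In $z>0$ the integrand has constant sign, that of $1-1/c$ and hence of $\log c$. So the absolute
integral is also explicit, and integrability over the strip becomes a condition in time alone. -/
theorem integral_abs_levyMeasure {α β c : ℝ} (hα : 0 < α) (hβ : 0 < β) (hc : 0 < c) :
    ∫ z, |Real.exp (β * z * (1 - 1 / c)) - 1| ∂levyMeasure α β = α * |Real.log c| := by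
  rcases le_total 1 c with h | h
  · rw [abs_of_nonneg (Real.log_nonneg h), ← integral_levyMeasure hα hβ hc]
    refine integral_congr_ae ?_
    filter_upwards [ae_levyMeasure_pos α β] with z hz
    refine abs_of_nonneg ?_
    rw [sub_nonneg, Real.one_le_exp_iff]
    have : 1 / c ≤ 1 := by rw [div_le_one hc]; exact h
    have : 0 ≤ 1 - 1 / c := by linarith
    positivity
  · rw [abs_of_nonpos (Real.log_nonpos hc.le h), mul_neg, ← integral_levyMeasure hα hβ hc,
      ← integral_neg]
    refine integral_congr_ae ?_
    filter_upwards [ae_levyMeasure_pos α β] with z hz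
    refine abs_of_nonpos ?_
    rw [sub_nonpos, Real.exp_le_one_iff]
    have : 1 ≤ 1 / c := by rw [one_le_div hc]; exact h
    exact mul_nonpos_of_nonneg_of_nonpos (by positivity) (by linarith)

instance : SFinite (lebesgueTime) := by unfold lebesgueTime; infer_instance

instance (α β : ℝ) : SFinite (levyMeasure α β) := by unfold levyMeasure; infer_instance

theorem restrict_compensator_strip (α β : ℝ) (t : ℝ≥0) :
    (compensator α β).restrict (strip t)
      = (lebesgueTime.restrict (Ioc 0 t)).prod (levyMeasure α β) := by
  have : (levyMeasure α β).restrict (Ioi 0) = levyMeasure α β :=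
    Measure.restrict_eq_self_of_ae_mem (ae_levyMeasure_pos α β)
  change (lebesgueTime.prod (levyMeasure α β)).restrict _ = _
  rw [strip, ← Measure.prod_restrict, this]

section

variable {α β : ℝ} {σ : ℝ → ℝ}

theorem Y_ae_eq (hα : 0 < α) (hpos : ∀ y, 0 < σ y) (x : Path) (s : ℝ≥0) :
    (fun z => Y α β σ x (s, z) - 1)
      =ᵐ[levyMeasure α β] fun z => Real.exp (β * z * (1 - 1 / σ (x.left s))) - 1 := by
  filter_upwards [ae_levyMeasure_pos α β] with z hz
  rw [Y_eq_exp hα x (s, z) (hpos _) hz]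

/-- By Tonelli: the inner absolute integral is $\alpha|\varphi\log\sigma|$. The weight $\varphi$
will be $1$ for the exponent and $\mathcal Z_-$ for the equation. -/
theorem integrableOn_strip_compensator (hα : 0 < α) (hβ : 0 < β) (hσ : Measurable σ)
    (hpos : ∀ y, 0 < σ y) (x : Path) (t : ℝ≥0) {φ : ℝ≥0 → ℝ} (hφ : Measurable φ)
    (hint : IntegrableOn (fun s => φ s * Real.log (σ (x.left s))) (Ioc 0 t) lebesgueTime) :
    IntegrableOn (fun p => φ p.1 * (Y α β σ x p - 1)) (strip t) (compensator α β) := by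
  have hm : Measurable (fun p : ℝ≥0 × ℝ => φ p.1 * (Y α β σ x p - 1)) :=
    (hφ.comp measurable_fst).mul ((measurable_Y hσ x).sub measurable_const)
  rw [IntegrableOn, restrict_compensator_strip, integrable_prod_iff hm.aestronglyMeasurable]
  constructor
  · exact ae_of_all _ fun s => ((integrable_levyMeasure hα hβ (hpos (x.left s))).congr
      (Y_ae_eq hα hpos x s).symm).const_mul (φ s)
  · refine (hint.norm.const_mul α).congr (ae_of_all _ fun s => ?_)
    simp only [norm_mul, integral_const_mul]
    have : ∫ z, ‖Y α β σ x (s, z) - 1‖ ∂levyMeasure α β = α * |Real.log (σ (x.left s))| := by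
      rw [← integral_abs_levyMeasure hα hβ (hpos (x.left s))]
      refine integral_congr_ae ?_
      filter_upwards [Y_ae_eq (β := β) hα hpos x s] with z hz
      rw [hz]; rfl
    rw [this, Real.norm_eq_abs (Real.log _)]
    ring

theorem setIntegral_strip_compensator (hα : 0 < α) (hβ : 0 < β) (hσ : Measurable σ)
    (hpos : ∀ y, 0 < σ y) (x : Path) (t : ℝ≥0) {φ : ℝ≥0 → ℝ} (hφ : Measurable φ)
    (hint : IntegrableOn (fun s => φ s * Real.log (σ (x.left s))) (Ioc 0 t) lebesgueTime) :
    ∫ p in strip t, φ p.1 * (Y α β σ x p - 1) ∂compensator α β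
      = ∫ s in Ioc 0 t, φ s * (α * Real.log (σ (x.left s))) ∂lebesgueTime := by
  have h := integrableOn_strip_compensator hα hβ hσ hpos x t hφ hint
  rw [IntegrableOn, restrict_compensator_strip] at h
  rw [restrict_compensator_strip, integral_prod _ h]
  refine integral_congr_ae (ae_of_all _ fun s => ?_)
  simp only [integral_const_mul]
  rw [← integral_levyMeasure hα hβ (hpos (x.left s)), integral_congr_ae (Y_ae_eq hα hpos x s)]

end

/-! ### Lebesgue measure on `[0,∞)` -/

theorem restrict_lebesgueTime_Ioc (s t : ℝ≥0) :
    lebesgueTime.restrict (Ioc s t)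
      = ((volume : Measure ℝ).restrict (Ioc (s : ℝ) t)).map Real.toNNReal := by
  rw [lebesgueTime, Measure.restrict_map measurable_real_toNNReal measurableSet_Ioc,
    Measure.restrict_restrict (measurable_real_toNNReal measurableSet_Ioc)]
  congr 2
  ext r
  simp only [mem_inter_iff, mem_preimage, mem_Ioc, mem_Ici, Real.toNNReal_le_iff_le_coe,
    Real.lt_toNNReal_iff_coe_lt]
  constructor
  · exact fun h => h.1
  · exact fun h => ⟨h, s.2.trans h.1.le⟩

theorem lebesgueTime_Ioc (s t : ℝ≥0) :
    lebesgueTime (Ioc s t) = ENNReal.ofReal ((t : ℝ) - s) := by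
  rw [← Measure.restrict_apply_univ, restrict_lebesgueTime_Ioc,
    Measure.map_apply measurable_real_toNNReal MeasurableSet.univ]
  simp

instance (s t : ℝ≥0) : IsFiniteMeasure (lebesgueTime.restrict (Ioc s t)) :=
  ⟨by simp [lebesgueTime_Ioc]⟩

instance : NullSingletonClass lebesgueTime := by
  refine ⟨fun r => ?_⟩
  rw [lebesgueTime, Measure.map_apply measurable_real_toNNReal (measurableSet_singleton r),
    Measure.restrict_apply (measurable_real_toNNReal (measurableSet_singleton r))]
  refine measure_mono_null (t := {(r : ℝ)}) ?_ (by simp)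
  rintro x ⟨hx, h0⟩
  have : x.toNNReal = r := hx
  rw [mem_singleton_iff, ← this, Real.coe_toNNReal _ h0]

theorem setIntegral_lebesgueTime {f : ℝ≥0 → ℝ} (hf : Measurable f) (t : ℝ≥0) :
    ∫ s in Ioc 0 t, f s ∂lebesgueTime = ∫ r in (0 : ℝ)..t, f r.toNNReal := by
  rw [restrict_lebesgueTime_Ioc,
    integral_map measurable_real_toNNReal.aemeasurable hf.aestronglyMeasurable,
    intervalIntegral.integral_of_le t.coe_nonneg, NNReal.coe_zero]

theorem setIntegral_Ioc_sub {μ : Measure ℝ≥0} {f : ℝ≥0 → ℝ} {s t : ℝ≥0} (hst : s ≤ t)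
    (hf : IntegrableOn f (Ioc 0 t) μ) :
    ∫ r in Ioc s t, f r ∂μ = ∫ r in Ioc 0 t, f r ∂μ - ∫ r in Ioc 0 s, f r ∂μ := by
  rw [← Ioc_union_Ioc_eq_Ioc (zero_le (a := s)) hst, setIntegral_union
    (Ioc_disjoint_Ioc_of_le le_rfl) measurableSet_Ioc (hf.mono_set (Ioc_subset_Ioc_right hst))
    (hf.mono_set (Ioc_subset_Ioc_left (zero_le (a := s))))]
  ring

/-! ### The exponential of a finite variation function with absolutely continuous part -/

section Exponential

variable {c : ℝ≥0 → ℝ} {K : ℝ}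

theorem abs_setIntegral_lebesgueTime_le (hK : ∀ s, |c s| ≤ K) (t : ℝ≥0) :
    |∫ s in Ioc 0 t, c s ∂lebesgueTime| ≤ K * t := by
  have := norm_setIntegral_le_of_norm_le_const (μ := lebesgueTime) (s := Ioc 0 t) (f := c) (C := K)
    (by rw [lebesgueTime_Ioc]; exact ENNReal.ofReal_lt_top) (fun s _ => hK s)
  simpa [Measure.real, lebesgueTime_Ioc] using this

theorem continuous_setIntegral_lebesgueTime (hc : Measurable c) (hK : ∀ s, |c s| ≤ K) :
    Continuous fun t : ℝ≥0 => ∫ s in Ioc 0 t, c s ∂lebesgueTime := by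
  simp_rw [setIntegral_lebesgueTime hc]
  have h : ∀ a b : ℝ, IntervalIntegrable (fun r : ℝ => c r.toNNReal) volume a b := fun a b =>
    (intervalIntegrable_const (c := K)).mono_fun'
      (hc.comp measurable_real_toNNReal).aestronglyMeasurable (ae_of_all _ fun r => hK _)
  exact (intervalIntegral.continuous_primitive h 0).comp NNReal.continuous_coe

/-- The rate $c$ is only measurable, so the primitive is not $C^1$. It is Lipschitz, hence its
exponential is absolutely continuous, and the fundamental theorem applies with Lebesgue's almost
everywhere derivative. -/
theorem exp_neg_setIntegral_lebesgueTime (hc : Measurable c) (hK : ∀ s, |c s| ≤ K) (t : ℝ≥0) :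
    Real.exp (-∫ s in Ioc 0 t, c s ∂lebesgueTime)
      = 1 - ∫ s in Ioc 0 t, Real.exp (-∫ r in Ioc 0 s, c r ∂lebesgueTime) * c s ∂lebesgueTime := by
  have hcont := continuous_setIntegral_lebesgueTime hc hK
  have hb : ∀ a b : ℝ, IntervalIntegrable (fun r : ℝ => c r.toNNReal) volume a b := fun a b =>
    (intervalIntegrable_const (c := K)).mono_fun'
      (hc.comp measurable_real_toNNReal).aestronglyMeasurable (ae_of_all _ fun r => hK _)
  set B : ℝ → ℝ := fun u => ∫ r in (0 : ℝ)..u, c r.toNNReal with hB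
  have hBeq : ∀ u : ℝ≥0, ∫ s in Ioc 0 u, c s ∂lebesgueTime = B u := setIntegral_lebesgueTime hc
  have hLip : LipschitzWith K.toNNReal B := by
    refine LipschitzWith.of_dist_le_mul fun u v => ?_
    rw [Real.dist_eq, Real.dist_eq, hB]
    simp only
    rw [intervalIntegral.integral_interval_sub_left (hb _ _) (hb _ _)]
    refine (intervalIntegral.norm_integral_le_of_norm_le_const (C := K)
      (f := fun r => c r.toNNReal) fun r _ => hK r.toNNReal).trans ?_
    gcongr
    exact Real.le_coe_toNNReal K
  have hBc : Continuous B := hLip.continuous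
  -- The exponential is only locally Lipschitz; the compact range of $B$ on $[0,t]$ supplies a
  -- constant.
  have hAC : AbsolutelyContinuousOnInterval (fun u => Real.exp (-B u)) 0 t := by
    have hcpt : IsCompact (B '' uIcc 0 (t : ℝ)) := isCompact_uIcc.image hBc
    obtain ⟨R, hR⟩ := hcpt.isBounded.subset_closedBall 0
    obtain ⟨M, hM⟩ := (ContDiffOn.exists_lipschitzOnWith (n := 1)
      (f := fun y : ℝ => Real.exp (-y)) (s := Metric.closedBall 0 R)
      (by fun_prop) (by decide) (convex_closedBall _ _) (isCompact_closedBall _ _))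
    exact ((hM.mono hR).comp (hLip.lipschitzOnWith (s := uIcc 0 (t : ℝ)))
      (mapsTo_image _ _)).absolutelyContinuousOnInterval
  have hFTC := hAC.integral_deriv_eq_sub
  have hder : ∫ u in (0 : ℝ)..t, deriv (fun u => Real.exp (-B u)) u
      = ∫ u in (0 : ℝ)..t, -(Real.exp (-B u) * c u.toNNReal) := by
    refine intervalIntegral.integral_congr_ae ?_
    filter_upwards [(hb 0 t).ae_hasDerivAt_integral] with u hu hut
    have h1 : HasDerivAt B (c u.toNNReal) u := hu (uIoc_subset_uIcc hut) 0 (by simp)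
    have : HasDerivAt (fun u => Real.exp (-B u)) (Real.exp (-B u) * -c u.toNNReal) u :=
      h1.neg.exp
    rw [this.deriv]
    ring
  have hBm : Measurable fun s : ℝ≥0 => Real.exp (-B s) * c s :=
    ((Real.continuous_exp.comp (hBc.comp NNReal.continuous_coe).neg).measurable).mul hc
  simp_rw [hBeq]
  rw [setIntegral_lebesgueTime hBm]
  rw [hder, intervalIntegral.integral_neg] at hFTC
  have h0 : B 0 = 0 := by simp [hB]
  rw [h0] at hFTC
  have hcongr : ∫ u in (0 : ℝ)..t, Real.exp (-B u) * c u.toNNReal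
      = ∫ r in (0 : ℝ)..t, Real.exp (-B (r.toNNReal : ℝ)) * c r.toNNReal := by
    refine intervalIntegral.integral_congr fun u hu => ?_
    rw [uIcc_of_le t.coe_nonneg] at hu
    simp only [Real.coe_toNNReal u hu.1]
  rw [← hcongr]
  simp at hFTC
  linarith

variable {ι : Type*} (τ : ι → ℝ≥0) (a : ι → ℝ)

/-- Induction on the jumps. A new jump at $\tau_v$ multiplies the process by $1+k=e^{a_v}$ from
$\tau_v$ on, so its equation at $t$ combines the old equations at $t$ and at $\tau_v$. The sum over
$\tau_l<\tau_i$ encodes the left limit at $\tau_i$. -/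
theorem exp_finite_jumps [DecidableEq ι] (hτ : Function.Injective τ) (hc : Measurable c)
    (hK : ∀ s, |c s| ≤ K) (F : Finset ι) (t : ℝ≥0) :
    Real.exp ((∑ i ∈ F, if τ i ≤ t then a i else 0) - ∫ s in Ioc 0 t, c s ∂lebesgueTime)
      = 1 + (∑ i ∈ F, if τ i ≤ t then
          Real.exp ((∑ l ∈ F, if τ l < τ i then a l else 0)
            - ∫ s in Ioc 0 (τ i), c s ∂lebesgueTime) * (Real.exp (a i) - 1) else 0)
        - ∫ s in Ioc 0 t, Real.exp ((∑ i ∈ F, if τ i ≤ s then a i else 0)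
            - ∫ r in Ioc 0 s, c r ∂lebesgueTime) * c s ∂lebesgueTime := by
  set C : ℝ≥0 → ℝ := fun s => ∫ r in Ioc 0 s, c r ∂lebesgueTime with hC
  have hCcont : Continuous C := continuous_setIntegral_lebesgueTime hc hK
  induction F using Finset.induction_on generalizing t with
  | empty =>
    simpa using exp_neg_setIntegral_lebesgueTime hc hK t
  | insert v F hv ih =>
    set E : ℝ≥0 → ℝ := fun s => Real.exp ((∑ i ∈ F, if τ i ≤ s then a i else 0) - C s) with hE
    set k := Real.exp (a v) - 1 with hk
    set B : ι → ℝ := fun i => Real.exp ((∑ l ∈ F, if τ l < τ i then a l else 0) - C (τ i))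
      * (Real.exp (a i) - 1) with hB
    have hI : ∀ s, IntegrableOn (fun r => E r * c r) (Ioc 0 s) lebesgueTime := by
      intro s
      have hm : Measurable fun r => E r * c r := by
        refine Measurable.mul (Real.measurable_exp.comp (Measurable.sub ?_ hCcont.measurable)) hc
        exact Finset.measurable_sum _ fun i _ => Measurable.ite measurableSet_Ici
          measurable_const measurable_const
      refine Integrable.of_bound hm.aestronglyMeasurable
        (Real.exp ((∑ i ∈ F, |a i|) + |K| * s) * K) ?_
      filter_upwards [ae_restrict_mem measurableSet_Ioc] with r hr
      rw [norm_mul, Real.norm_of_nonneg (Real.exp_pos _).le]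
      refine mul_le_mul (Real.exp_le_exp.2 ?_) (hK r) (norm_nonneg _) (Real.exp_pos _).le
      have h1 : (∑ i ∈ F, if τ i ≤ r then a i else 0) ≤ ∑ i ∈ F, |a i| := by
        refine Finset.sum_le_sum fun i _ => ?_
        split_ifs
        · exact le_abs_self _
        · exact abs_nonneg _
      have h2 : -C r ≤ |K| * s := by
        refine (neg_le_abs _).trans ((abs_setIntegral_lebesgueTime_le hK r).trans ?_)
        have : (r : ℝ) ≤ s := hr.2
        gcongr
        exact le_abs_self K
      linarith
    have e1 : ∀ s, Real.exp ((∑ i ∈ insert v F, if τ i ≤ s then a i else 0) - C s)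
        = E s * (1 + if τ v ≤ s then k else 0) := by
      intro s
      rw [Finset.sum_insert hv]
      split_ifs
      · rw [add_sub_assoc, Real.exp_add, hk]; ring
      · simp [hE]
    have e2 : ∀ i, Real.exp ((∑ l ∈ insert v F, if τ l < τ i then a l else 0) - C (τ i))
        * (Real.exp (a i) - 1) = B i * (1 + if τ v < τ i then k else 0) := by
      intro i
      rw [Finset.sum_insert hv]
      split_ifs
      · rw [add_sub_assoc, Real.exp_add, hk]; ring
      · simp [hB]
    -- The old process does not jump at $\tau_v$, by injectivity of $\tau$, so its left limit there
    -- is its value.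
    have e3 : B v = E (τ v) * k := by
      rw [hB, hE]
      simp only
      congr 3
      refine Finset.sum_congr rfl fun l hl => ?_
      have : τ l ≠ τ v := fun h => hv (hτ h ▸ hl)
      simp only [lt_iff_le_and_ne, this, ne_eq, not_false_eq_true, and_true]
    change Real.exp (_ - C t) = 1 + (∑ i ∈ insert v F, if τ i ≤ t then
      Real.exp (_ - C (τ i)) * (Real.exp (a i) - 1) else 0)
      - ∫ s in Ioc 0 t, Real.exp (_ - C s) * c s ∂lebesgueTime
    simp only [e1, e2]
    rw [Finset.sum_insert hv, if_neg (lt_irrefl (τ v)), add_zero, mul_one, e3]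
    have iht := ih t
    have ihv := ih (τ v)
    by_cases hvt : τ v ≤ t
    · have i1 : ∫ s in Ioc 0 t, E s * (1 + if τ v ≤ s then k else 0) * c s ∂lebesgueTime
          = ∫ s in Ioc 0 t, E s * c s ∂lebesgueTime
            + k * (∫ s in Ioc 0 t, E s * c s ∂lebesgueTime
              - ∫ s in Ioc 0 (τ v), E s * c s ∂lebesgueTime) := by
        rw [← setIntegral_Ioc_sub hvt (hI t)]
        have : ∀ᵐ s ∂lebesgueTime.restrict (Ioc 0 t),
            E s * (1 + if τ v ≤ s then k else 0) * c s
              = E s * c s + k * (Ioc (τ v) t).indicator (fun s => E s * c s) s := by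
          have hne : ∀ᵐ s ∂lebesgueTime.restrict (Ioc 0 t), s ≠ τ v :=
            ae_restrict_of_ae (by simp [ae_iff])
          filter_upwards [ae_restrict_mem measurableSet_Ioc, hne] with s hs hsv
          by_cases h : τ v ≤ s
          · rw [if_pos h, indicator_of_mem (show s ∈ Ioc (τ v) t from
              ⟨lt_of_le_of_ne h hsv.symm, hs.2⟩)]
            ring
          · rw [if_neg h, indicator_of_notMem (fun h' => h h'.1.le)]
            ring
        rw [integral_congr_ae this, integral_add (hI t)
          (((hI t).indicator measurableSet_Ioc).const_mul k), integral_const_mul,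
          setIntegral_indicator measurableSet_Ioc,
          inter_eq_right.2 (Ioc_subset_Ioc_left (zero_le (a := τ v)))]
      have i2 : (∑ i ∈ F, if τ i ≤ t then B i * (1 + if τ v < τ i then k else 0) else 0)
          = (∑ i ∈ F, if τ i ≤ t then B i else 0)
            + k * ((∑ i ∈ F, if τ i ≤ t then B i else 0)
              - ∑ i ∈ F, if τ i ≤ τ v then B i else 0) := by
        rw [← Finset.sum_sub_distrib, Finset.mul_sum, ← Finset.sum_add_distrib]
        refine Finset.sum_congr rfl fun i _ => ?_
        by_cases h1 : τ i ≤ t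
        · by_cases h2 : τ v < τ i
          · simp [h1, h2, not_le.2 h2]; ring
          · simp [h1, h2, not_lt.1 h2]
        · have h2 : ¬ τ i ≤ τ v := fun h => h1 (h.trans hvt)
          simp [h1, h2]
      rw [i1, i2, if_pos hvt, if_pos hvt]
      have iht' : E t = 1 + (∑ i ∈ F, if τ i ≤ t then B i else 0)
        - ∫ s in Ioc 0 t, E s * c s ∂lebesgueTime := iht
      have ihv' : E (τ v) = 1 + (∑ i ∈ F, if τ i ≤ τ v then B i else 0)
        - ∫ s in Ioc 0 (τ v), E s * c s ∂lebesgueTime := ihv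
      -- The new process is $E_t(1+k)$, and its source terms after $\tau_v$ are those of $E$ times
      -- $1+k$. Subtracting $k$ times the equation at $\tau_v$ removes the surplus from before
      -- $\tau_v$.
      linear_combination (1 + k) * iht' - k * ihv'
    · have i1 : ∫ s in Ioc 0 t, E s * (1 + if τ v ≤ s then k else 0) * c s ∂lebesgueTime
          = ∫ s in Ioc 0 t, E s * c s ∂lebesgueTime := by
        refine setIntegral_congr_fun measurableSet_Ioc fun s hs => ?_
        have h2 : ¬ τ v ≤ s := fun h => hvt (h.trans hs.2)
        simp [h2]
      have i2 : (∑ i ∈ F, if τ i ≤ t then B i * (1 + if τ v < τ i then k else 0) else 0)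
          = ∑ i ∈ F, if τ i ≤ t then B i else 0 := by
        refine Finset.sum_congr rfl fun i _ => ?_
        by_cases h1 : τ i ≤ t
        · have h2 : ¬ τ v < τ i := fun h => hvt (h.le.trans h1)
          simp [h1, h2]
        · simp [h1]
      rw [i1, i2, if_neg hvt, if_neg hvt, zero_add, add_zero, mul_one]
      exact iht

theorem abs_exp_sub_one_le_mul (y : ℝ) : |Real.exp y - 1| ≤ |y| * Real.exp |y| := by
  rcases le_total 0 y with h | h
  · rw [abs_of_nonneg h, abs_of_nonneg (sub_nonneg.2 (Real.one_le_exp h))]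
    have := Real.add_one_le_exp (-y)
    have h2 : Real.exp y * Real.exp (-y) = 1 := by rw [← Real.exp_add]; simp
    nlinarith [Real.exp_pos y]
  · rw [abs_of_nonpos h, abs_of_nonpos (sub_nonpos.2 (Real.exp_le_one_iff.2 h))]
    have := Real.add_one_le_exp y
    have h2 : 1 ≤ Real.exp (-y) := Real.one_le_exp (by linarith)
    nlinarith

/-- Limit of the finite formula along finite sets of jumps. All exponents up to $t$ are at most
$\sum|a_i|+|K|t$, which dominates both the jump series and the time integral. -/
theorem exp_summable_jumps [Countable ι] (hτ : Function.Injective τ) (hc : Measurable c)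
    (hK : ∀ s, |c s| ≤ K) (ha : Summable a) (t : ℝ≥0) :
    Summable (fun i => if τ i ≤ t then
          Real.exp ((∑' l, if τ l < τ i then a l else 0)
            - ∫ s in Ioc 0 (τ i), c s ∂lebesgueTime) * (Real.exp (a i) - 1) else 0) ∧
    Real.exp ((∑' i, if τ i ≤ t then a i else 0) - ∫ s in Ioc 0 t, c s ∂lebesgueTime)
      = 1 + (∑' i, if τ i ≤ t then
          Real.exp ((∑' l, if τ l < τ i then a l else 0)
            - ∫ s in Ioc 0 (τ i), c s ∂lebesgueTime) * (Real.exp (a i) - 1) else 0)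
        - ∫ s in Ioc 0 t, Real.exp ((∑' i, if τ i ≤ s then a i else 0)
            - ∫ r in Ioc 0 s, c r ∂lebesgueTime) * c s ∂lebesgueTime := by
  classical
  set C : ℝ≥0 → ℝ := fun s => ∫ r in Ioc 0 s, c r ∂lebesgueTime with hC
  have hCcont : Continuous C := continuous_setIntegral_lebesgueTime hc hK
  have hCb : ∀ s ≤ t, -C s ≤ |K| * t := by
    intro s hs
    refine (neg_le_abs _).trans ((abs_setIntegral_lebesgueTime_le hK s).trans ?_)
    have : (s : ℝ) ≤ t := hs
    gcongr
    exact le_abs_self K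
  set A := ∑' i, |a i| with hA
  have hite : ∀ (p : ι → Prop) [DecidablePred p] (F : Finset ι),
      (∑ i ∈ F, if p i then a i else 0) ≤ A := by
    intro p _ F
    refine (Finset.sum_le_sum fun i _ => ?_).trans (ha.abs.sum_le_tsum F fun i _ => abs_nonneg _)
    split_ifs
    · exact le_abs_self _
    · exact abs_nonneg _
  have hsum : ∀ (p : ι → Prop) [DecidablePred p], Summable fun i => if p i then a i else 0 := by
    intro p _
    refine Summable.of_norm_bounded ha.abs fun i => ?_
    split_ifs <;> simp
  have hite' : ∀ (p : ι → Prop) [DecidablePred p], (∑' i, if p i then a i else 0) ≤ A :=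
    fun p _ => le_of_tendsto (hsum p).hasSum (Eventually.of_forall fun F => hite p F)
  set M := Real.exp (A + |K| * t) with hM
  have hbd : ∀ i, |Real.exp (a i) - 1| ≤ |a i| * Real.exp A := fun i =>
    (abs_exp_sub_one_le_mul _).trans (by
      gcongr; exact ha.abs.le_tsum i fun _ _ => abs_nonneg _)
  have hbsum : Summable fun i => M * (|a i| * Real.exp A) := (ha.abs.mul_right _).mul_left _
  have hterm : ∀ (i : ι) (S : ℝ), S ≤ A → ‖if τ i ≤ t then
      Real.exp (S - C (τ i)) * (Real.exp (a i) - 1) else 0‖ ≤ M * (|a i| * Real.exp A) := by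
    intro i S hS
    split_ifs with h
    · rw [norm_mul, Real.norm_of_nonneg (Real.exp_pos _).le]
      refine mul_le_mul (Real.exp_le_exp.2 ?_) (hbd i) (norm_nonneg _) (Real.exp_pos _).le
      have := hCb _ h
      linarith
    · simp; positivity
  refine ⟨Summable.of_norm_bounded hbsum fun i => hterm i _ (hite' _), ?_⟩
  have hfin := fun F : Finset ι => exp_finite_jumps τ a hτ hc hK F t
  have hlim : ∀ (p : ι → Prop) [DecidablePred p],
      Tendsto (fun F : Finset ι => ∑ i ∈ F, if p i then a i else 0) atTop
        (𝓝 (∑' i, if p i then a i else 0)) := fun p _ => (hsum p).hasSum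
  have hleft := (Real.continuous_exp.tendsto _).comp ((hlim (fun i => τ i ≤ t)).sub_const (C t))
  have hexp : ∀ (p : ι → Prop) [DecidablePred p] (s : ℝ≥0),
      Tendsto (fun F : Finset ι => Real.exp ((∑ i ∈ F, if p i then a i else 0) - C s)) atTop
        (𝓝 (Real.exp ((∑' i, if p i then a i else 0) - C s))) := fun p _ s =>
    (Real.continuous_exp.tendsto _).comp ((hlim p).sub_const (C s))
  refine tendsto_nhds_unique hleft (Tendsto.congr (fun F => (hfin F).symm) ?_)
  refine (Tendsto.add tendsto_const_nhds ?_).sub ?_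
  -- Both the index set and the terms depend on $F$; extending by zero to a full series makes
  -- dominated convergence applicable.
  · have h1 : ∀ F : Finset ι, (∑ i ∈ F, if τ i ≤ t then
          Real.exp ((∑ l ∈ F, if τ l < τ i then a l else 0) - C (τ i)) * (Real.exp (a i) - 1) else 0)
        = ∑' i, if i ∈ F then (if τ i ≤ t then
          Real.exp ((∑ l ∈ F, if τ l < τ i then a l else 0) - C (τ i)) * (Real.exp (a i) - 1) else 0)
          else 0 := by
      intro F
      rw [tsum_eq_sum (s := F) (fun i hi => by simp [hi])]
      exact Finset.sum_congr rfl fun i hi => by simp [hi]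
    simp_rw [hC] at h1 ⊢
    simp_rw [h1]
    refine tendsto_tsum_of_dominated_convergence hbsum ?_ ?_
    · intro i
      refine Tendsto.congr' (f₁ := fun F : Finset ι => if τ i ≤ t then
          Real.exp ((∑ l ∈ F, if τ l < τ i then a l else 0) - C (τ i)) * (Real.exp (a i) - 1) else 0)
        ?_ ?_
      · filter_upwards [eventually_ge_atTop {i}] with F hF
        rw [if_pos (hF (Finset.mem_singleton_self i))]
      · split_ifs
        · exact (hexp _ _).mul_const _
        · exact tendsto_const_nhds
    · refine Eventually.of_forall fun F i => ?_
      split_ifs with h1 h2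
      · have := hterm i _ (hite (fun l => τ l < τ i) F)
        rwa [if_pos h2] at this
      · simp; positivity
      · simp; positivity
  -- The filter of finite sets is countably generated because `ι` is countable.
  · refine tendsto_integral_filter_of_dominated_convergence (fun _ => M * |K|) ?_ ?_ ?_ ?_
    · refine Eventually.of_forall fun F => Measurable.aestronglyMeasurable ?_
      refine Measurable.mul (Real.measurable_exp.comp (Measurable.sub ?_ hCcont.measurable)) hc
      exact Finset.measurable_sum _ fun i _ => Measurable.ite measurableSet_Ici
          measurable_const measurable_const
    · refine Eventually.of_forall fun F => ?_
      filter_upwards [ae_restrict_mem measurableSet_Ioc] with s hs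
      rw [norm_mul, Real.norm_of_nonneg (Real.exp_pos _).le]
      refine mul_le_mul (Real.exp_le_exp.2 ?_) ((hK s).trans (le_abs_self K)) (norm_nonneg _)
        (Real.exp_pos _).le
      have := hCb s hs.2
      have := hite (fun l => τ l ≤ s) F
      linarith
    · exact integrable_const _
    · exact ae_of_all _ fun s => (hexp _ _).mul_const _

end Exponential

/-! ### Uniqueness for the linear equation -/

theorem IsCadlag.tendsto_leftLim {z : ℝ≥0 → ℝ} (hz : IsCadlag z) (t : ℝ≥0) :
    Tendsto z (𝓝[<] t) (𝓝 (Function.leftLim z t)) := tendsto_leftLim_of_tendsto (hz t).2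

/-- At $0$ the left neighbourhood filter in `ℝ≥0` is trivial, so limits from the left are unique
only at positive times. -/
instance nhdsLT_neBot_coe {t : ℝ≥0} [h : Fact (0 < t)] : (𝓝[<] t).NeBot :=
  nhdsLT_neBot_of_exists_lt ⟨0, h.out⟩

theorem strip_mono {s t : ℝ≥0} (h : s ≤ t) : strip s ⊆ strip t :=
  prod_mono (Ioc_subset_Ioc_right h) Subset.rfl

theorem measurableSet_strip (t : ℝ≥0) : MeasurableSet (strip t) :=
  measurableSet_Ioc.prod measurableSet_Ioi

/-- A Grönwall argument that tolerates atoms in time. The measure $\rho=|k|\,(\mu+\nu)$ is finite on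
strips. If $D$ vanishes up to $r$, then on an interval $(r,t_2]$ of $\rho$-mass below $1/2$ any
bound for $|D|$ can be halved, so $D$ vanishes there too. -/
theorem eq_zero_of_linear_equation {μ ν : Measure (ℝ≥0 × ℝ)} {k : ℝ≥0 × ℝ → ℝ} {D : ℝ≥0 → ℝ}
    (hD : IsCadlag D) (hkμ : ∀ t, IntegrableOn k (strip t) μ)
    (hkν : ∀ t, IntegrableOn k (strip t) ν)
    (hμ : ∀ t, IntegrableOn (fun p => Function.leftLim D p.1 * k p) (strip t) μ)
    (hν : ∀ t, IntegrableOn (fun p => Function.leftLim D p.1 * k p) (strip t) ν)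
    (heq : ∀ t, D t = (∫ p in strip t, Function.leftLim D p.1 * k p ∂μ)
      - ∫ p in strip t, Function.leftLim D p.1 * k p ∂ν) (t : ℝ≥0) : D t = 0 := by
  set ρ : Measure (ℝ≥0 × ℝ) := (μ + ν).withDensity fun p => ‖k p‖ₑ with hρ
  have hρfin : ∀ t, ρ (strip t) < ∞ := by
    intro t
    rw [hρ, withDensity_apply _ (measurableSet_strip t), Measure.restrict_add,
      lintegral_add_measure]
    exact ENNReal.add_lt_top.2 ⟨(hkμ t).2, (hkν t).2⟩
  -- the solution is controlled by the size of its left limits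
  have hle : ∀ t, ‖D t‖ₑ ≤ ∫⁻ p in strip t, ‖Function.leftLim D p.1 * k p‖ₑ ∂(μ + ν) := by
    intro t
    rw [heq t, Measure.restrict_add, lintegral_add_measure]
    exact enorm_sub_le.trans (add_le_add (enorm_integral_le_lintegral_enorm _)
      (enorm_integral_le_lintegral_enorm _))
  have hbdd : ∀ t, ∃ B : ℝ, 0 ≤ B ∧ ∀ s ≤ t, |D s| ≤ B := by
    intro t
    have hfin : ∫⁻ p in strip t, ‖Function.leftLim D p.1 * k p‖ₑ ∂(μ + ν) < ∞ := by
      rw [Measure.restrict_add, lintegral_add_measure]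
      exact ENNReal.add_lt_top.2 ⟨(hμ t).2, (hν t).2⟩
    refine ⟨(∫⁻ p in strip t, ‖Function.leftLim D p.1 * k p‖ₑ ∂(μ + ν)).toReal,
      ENNReal.toReal_nonneg, fun s hs => ?_⟩
    have h := (hle s).trans (lintegral_mono_set (strip_mono hs))
    rw [← Real.norm_eq_abs, ← toReal_enorm]
    exact ENNReal.toReal_mono hfin.ne h
  have hleft : ∀ (s t : ℝ≥0) (B : ℝ), s < t → (∀ u, s ≤ u → u < t → |D u| ≤ B) →
      |Function.leftLim D t| ≤ B := by
    intro s t B hst h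
    have : Fact (0 < t) := ⟨(zero_le (a := s)).trans_lt hst⟩
    refine le_of_tendsto (hD.tendsto_leftLim t).abs ?_
    filter_upwards [Ioo_mem_nhdsLT hst] with u hu
    exact h u hu.1.le hu.2
  have hstep : ∀ (s t : ℝ≥0) (B : ℝ), 0 ≤ B → s ≤ t → (∀ u < s, D u = 0) →
      (∀ u, s ≤ u → u ≤ t → |D u| ≤ B) →
      ‖D t‖ₑ ≤ ENNReal.ofReal B * ρ (Ioc s t ×ˢ Ioi 0) := by
    intro s t B hB hst h0 hb
    have hm : MeasurableSet (Ioc s t ×ˢ Ioi (0 : ℝ)) := measurableSet_Ioc.prod measurableSet_Ioi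
    calc ‖D t‖ₑ ≤ ∫⁻ p in strip t, ‖Function.leftLim D p.1 * k p‖ₑ ∂(μ + ν) := hle t
      _ ≤ ∫⁻ p in strip t, (Ioc s t ×ˢ Ioi (0 : ℝ)).indicator
            (fun p => ENNReal.ofReal B * ‖k p‖ₑ) p ∂(μ + ν) := by
          refine lintegral_mono_ae ?_
          filter_upwards [ae_restrict_mem (measurableSet_strip t)] with p hp
          by_cases hs : s < p.1
          · rw [indicator_of_mem (show p ∈ Ioc s t ×ˢ Ioi (0 : ℝ) from ⟨⟨hs, hp.1.2⟩, hp.2⟩),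
              enorm_mul]
            gcongr
            rw [← ofReal_norm]
            exact ENNReal.ofReal_le_ofReal (hleft s p.1 B hs fun u h1 h2 =>
              hb u h1 (h2.le.trans hp.1.2))
          · have : Function.leftLim D p.1 = 0 := by
              refine abs_nonpos_iff.1 (hleft 0 p.1 0 hp.1.1 fun u _ h2 => ?_)
              rw [h0 u (h2.trans_le (not_lt.1 hs)), abs_zero]
            simp [this]
      _ ≤ ∫⁻ p, (Ioc s t ×ˢ Ioi (0 : ℝ)).indicator
            (fun p => ENNReal.ofReal B * ‖k p‖ₑ) p ∂(μ + ν) := setLIntegral_le_lintegral _ _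
      _ = ENNReal.ofReal B * ρ (Ioc s t ×ˢ Ioi 0) := by
          rw [lintegral_indicator hm, lintegral_const_mul' _ _ ENNReal.ofReal_ne_top, hρ,
            withDensity_apply _ hm]
  by_contra ht
  set S : Set ℝ≥0 := {s | ∀ u ≤ s, D u = 0} with hS
  have h00 : D 0 = 0 := by rw [heq 0]; simp [strip]
  have hS0 : (0 : ℝ≥0) ∈ S := fun u hu => by
    rw [le_antisymm hu (zero_le (a := u)), h00]
  have hSb : BddAbove S := ⟨t, fun s hs => le_of_not_ge fun h => ht (hs t h)⟩
  set r := sSup S with hr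
  have hlt : ∀ u < r, D u = 0 := by
    intro u hu
    obtain ⟨s, hs, hus⟩ := exists_lt_of_lt_csSup ⟨0, hS0⟩ hu
    exact hs u hus.le
  -- The equation at $r$ involves only left limits at times up to $r$, and these vanish; so $D$
  -- cannot jump away from zero at $r$.
  have hDr : D r = 0 := by
    obtain ⟨B, hB0, hB⟩ := hbdd r
    have := hstep r r B hB0 le_rfl hlt fun u _ hu => hB u hu
    simpa using this
  -- a right neighbourhood of `r` carries little mass
  obtain ⟨t2, hrt2, hmass⟩ : ∃ t2, r < t2 ∧ ρ (Ioc r t2 ×ˢ Ioi 0) < 1 / 2 := by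
    obtain ⟨v, hva, hvr, hv⟩ := exists_seq_strictAnti_tendsto r
    have hlim : Tendsto (fun n => ρ (Ioc r (v n) ×ˢ Ioi 0)) atTop
        (𝓝 (ρ (⋂ n, Ioc r (v n) ×ˢ Ioi (0 : ℝ)))) := by
      refine tendsto_measure_iInter_atTop
        (fun n => (measurableSet_Ioc.prod measurableSet_Ioi).nullMeasurableSet)
        (fun m n hmn => prod_mono (Ioc_subset_Ioc_right (hva.antitone hmn)) Subset.rfl)
        ⟨0, ((measure_mono (prod_mono (Ioc_subset_Ioc_left (zero_le (a := r)))
          Subset.rfl)).trans_lt (hρfin (v 0))).ne⟩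
    -- The intervals exclude $r$, so an atom of $\rho$ at $r$ does no harm.
    have hempty : (⋂ n, Ioc r (v n) ×ˢ Ioi (0 : ℝ)) = ∅ := by
      rw [eq_empty_iff_forall_notMem]
      intro p hp
      rw [mem_iInter] at hp
      exact absurd (ge_of_tendsto' hv fun n => (hp n).1.2) (not_le.2 (hp 0).1.1)
    rw [hempty, measure_empty] at hlim
    obtain ⟨n, hn⟩ := (hlim.eventually_lt_const (show (0 : ℝ≥0∞) < 1 / 2 by simp)).exists
    exact ⟨v n, hvr n, hn⟩
  obtain ⟨B, hB0, hB⟩ := hbdd t2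
  have hiter : ∀ n : ℕ, ∀ u, r ≤ u → u ≤ t2 → |D u| ≤ B * (1 / 2) ^ n := by
    intro n
    induction n with
    | zero => intro u _ hu; simpa using hB u hu
    | succ n ih =>
      intro u hru hut
      have h1 := hstep r u (B * (1 / 2) ^ n) (by positivity) hru hlt
        fun w h1 h2 => ih w h1 (h2.trans hut)
      have h2 : ρ (Ioc r u ×ˢ Ioi 0) ≤ ENNReal.ofReal (1 / 2) := by
        refine (measure_mono (prod_mono (Ioc_subset_Ioc_right hut) Subset.rfl)).trans
          (hmass.le.trans ?_)
        rw [ENNReal.ofReal_div_of_pos two_pos]; simp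
      have h3 := h1.trans (mul_le_mul_right h2 _)
      rw [← ENNReal.ofReal_mul (by positivity), ← ofReal_norm,
        ENNReal.ofReal_le_ofReal_iff (by positivity), Real.norm_eq_abs] at h3
      rw [pow_succ, ← mul_assoc]
      exact h3
  have hmem : t2 ∈ S := by
    intro u hu
    rcases lt_or_ge u r with h | h
    · exact hlt u h
    · have hl : Tendsto (fun n : ℕ => B * (1 / 2 : ℝ) ^ n) atTop (𝓝 (B * 0)) :=
        (tendsto_pow_atTop_nhds_zero_of_lt_one (by norm_num) (by norm_num)).const_mul B
      rw [mul_zero] at hl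
      exact abs_nonpos_iff.1 (ge_of_tendsto' hl fun n => hiter n u h hu)
  exact absurd (le_csSup hSb hmem) (not_le.2 hrt2)

theorem eq_of_linear_equation {μ ν : Measure (ℝ≥0 × ℝ)} {k : ℝ≥0 × ℝ → ℝ} {z w : ℝ≥0 → ℝ}
    (hkμ : ∀ t, IntegrableOn k (strip t) μ) (hkν : ∀ t, IntegrableOn k (strip t) ν)
    (hz : IsCadlag z) (hw : IsCadlag w)
    (hzeq : ∀ t, IntegrableOn (fun p => Function.leftLim z p.1 * k p) (strip t) μ ∧
      IntegrableOn (fun p => Function.leftLim z p.1 * k p) (strip t) ν ∧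
      z t = 1 + ((∫ p in strip t, Function.leftLim z p.1 * k p ∂μ)
        - ∫ p in strip t, Function.leftLim z p.1 * k p ∂ν))
    (hweq : ∀ t, IntegrableOn (fun p => Function.leftLim w p.1 * k p) (strip t) μ ∧
      IntegrableOn (fun p => Function.leftLim w p.1 * k p) (strip t) ν ∧
      w t = 1 + ((∫ p in strip t, Function.leftLim w p.1 * k p ∂μ)
        - ∫ p in strip t, Function.leftLim w p.1 * k p ∂ν)) (t : ℝ≥0) : z t = w t := by
  have hD : IsCadlag (fun t => z t - w t) := fun t =>
    ⟨(hz t).1.sub (hw t).1, _, (hz.tendsto_leftLim t).sub (hw.tendsto_leftLim t)⟩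
  have hleft : ∀ t, 0 < t → Function.leftLim (fun t => z t - w t) t
      = Function.leftLim z t - Function.leftLim w t := by
    intro t ht
    have : Fact (0 < t) := ⟨ht⟩
    exact leftLim_eq_of_tendsto ((hz.tendsto_leftLim t).sub (hw.tendsto_leftLim t))
  have hcongr : ∀ t, EqOn (fun p : ℝ≥0 × ℝ => Function.leftLim (fun t => z t - w t) p.1 * k p)
      (fun p => Function.leftLim z p.1 * k p - Function.leftLim w p.1 * k p) (strip t) := by
    intro t p hp
    simp only [hleft p.1 hp.1.1, sub_mul]
  refine sub_eq_zero.1 (eq_zero_of_linear_equation hD hkμ hkν (fun t => ?_) (fun t => ?_)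
    (fun t => ?_) t)
  · exact ((hzeq t).1.sub (hweq t).1).congr_fun (hcongr t).symm (measurableSet_strip t)
  · exact ((hzeq t).2.1.sub (hweq t).2.1).congr_fun (hcongr t).symm (measurableSet_strip t)
  · rw [setIntegral_congr_fun (measurableSet_strip t) (hcongr t),
      setIntegral_congr_fun (measurableSet_strip t) (hcongr t),
      integral_sub (hzeq t).1 (hweq t).1, integral_sub (hzeq t).2.1 (hweq t).2.1,
      (hzeq t).2.2, (hweq t).2.2]
    ring

/-! ### The explicit density -/

/-- `σ` is measurable, bounded on the intervals `[0, b]`, and bounded below by `σ₀ > 0`. -/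
structure IsAdmissible (σ : ℝ → ℝ) (σ₀ : ℝ) : Prop where
  measurable : Measurable σ
  bddAbove : ∀ b : ℝ, BddAbove (σ '' Icc 0 b)
  lower_pos : 0 < σ₀
  lower : ∀ y, σ₀ ≤ σ y

namespace IsAdmissible

variable {σ : ℝ → ℝ} {σ₀ : ℝ}

theorem pos (h : IsAdmissible σ σ₀) (y : ℝ) : 0 < σ y := h.lower_pos.trans_le (h.lower y)

theorem exists_upper (h : IsAdmissible σ σ₀) (b : ℝ) :
    ∃ M, 1 ≤ M ∧ ∀ y, 0 ≤ y → y ≤ b → σ y ≤ M := by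
  obtain ⟨M, hM⟩ := h.bddAbove b
  exact ⟨max 1 M, le_max_left _ _, fun y h0 hb => (hM ⟨y, ⟨h0, hb⟩, rfl⟩).trans (le_max_right _ _)⟩

/-- Up to time $T$ the left limits stay in $[0,x_T]$, where $\sigma$ lies between $\sigma_0$ and a
finite bound. -/
theorem exists_abs_log_le (h : IsAdmissible σ σ₀) (x : Path) (T : ℝ≥0) :
    ∃ K, ∀ s ≤ T, |Real.log (σ (x.left s))| ≤ K := by
  obtain ⟨M, hM1, hM⟩ := h.exists_upper (x T)
  refine ⟨max |Real.log σ₀| |Real.log M|, fun s hs => abs_le_max_abs_abs ?_ ?_⟩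
  · exact Real.log_le_log h.lower_pos (h.lower _)
  · exact Real.log_le_log (h.pos _) (hM _ (x.left_nonneg s) ((x.left_le s).trans (x.mono hs)))

theorem abs_one_sub_le (h : IsAdmissible σ σ₀) (y : ℝ) : |1 - 1 / σ y| ≤ 1 + 1 / σ₀ := by
  have h1 : 0 < 1 / σ y := one_div_pos.2 (h.pos y)
  have h2 : 1 / σ y ≤ 1 / σ₀ := one_div_le_one_div_of_le h.lower_pos (h.lower y)
  rw [abs_le]
  constructor <;> linarith

theorem measurable_left (h : IsAdmissible σ σ₀) (x : Path) : Measurable fun s => σ (x.left s) :=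
  h.measurable.comp x.measurable_left

theorem integrableOn_log (h : IsAdmissible σ σ₀) (x : Path) (T : ℝ≥0) :
    IntegrableOn (fun s => Real.log (σ (x.left s))) (Ioc 0 T) lebesgueTime := by
  obtain ⟨K, hK⟩ := h.exists_abs_log_le x T
  refine Integrable.of_bound (Real.measurable_log.comp (h.measurable_left x)).aestronglyMeasurable
    K ?_
  filter_upwards [ae_restrict_mem measurableSet_Ioc] with s hs using hK s hs.2

theorem integrableOn_one_sub (h : IsAdmissible σ σ₀) (x : Path) (β : ℝ) (T : ℝ≥0) :
    IntegrableOn (fun s => β * (1 - 1 / σ (x.left s))) (Ioc 0 T) x.stieltjes :=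
  (Integrable.of_bound
    ((((h.measurable_left x).const_div 1).const_sub 1)).aestronglyMeasurable _
    (ae_of_all _ fun s => h.abs_one_sub_le (x.left s))).const_mul β

end IsAdmissible

namespace Path

theorem setIntegral_jumpTimes_eq_tsum (x : Path) {A : Set ℝ≥0} (hA : MeasurableSet A)
    (f : ℝ≥0 → ℝ) : ∫ s in A, f s ∂x.jumpTimes = ∑' s : x.jumps, A.indicator f s := by
  have : Countable x.jumps := x.countable_jumps
  rw [← integral_indicator hA, jumpTimes]
  have := integral_sum_dirac (x := fun s : x.jumps => (s : ℝ≥0)) (c := fun _ => 1)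
    (f := A.indicator f) (by simp)
  simpa using this

theorem integrableOn_jumpTimes_iff_summable (x : Path) {A : Set ℝ≥0} (hA : MeasurableSet A)
    (f : ℝ≥0 → ℝ) :
    IntegrableOn f A x.jumpTimes ↔ Summable fun s : x.jumps => A.indicator f s := by
  have : Countable x.jumps := x.countable_jumps
  rw [← integrable_indicator_iff hA, jumpTimes]
  have := integrable_sum_dirac_iff (x := fun s : x.jumps => (s : ℝ≥0)) (c := fun _ => 1)
    (f := A.indicator f) (by simp)
  simp only [one_smul, ENNReal.toReal_one, one_mul] at this
  rw [this]
  exact summable_norm_iff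

end Path

section

variable {α β : ℝ} {σ : ℝ → ℝ} {σ₀ : ℝ}

/-- The factor $1-1/\sigma$ is bounded thanks to $\sigma\ge\sigma_0$, and $dx$ is finite on $(0,T]$.
-/
theorem integrableOn_jump_mul (h : IsAdmissible σ σ₀) (x : Path) (β : ℝ) (T : ℝ≥0) :
    IntegrableOn (fun s => x.jump s * (β * (1 - 1 / σ (x.left s)))) (Ioc 0 T) x.jumpTimes :=
  (x.integrableOn_jumpTimes_iff measurableSet_Ioc _).2
    ((h.integrableOn_one_sub x β T).mono_set inter_subset_left)

theorem log_Y_ae_eq (hα : 0 < α) (h : IsAdmissible σ σ₀) (x : Path) (T : ℝ≥0) :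
    (fun s => Real.log (Y α β σ x (s, x.jump s))) =ᵐ[x.jumpTimes.restrict (Ioc 0 T)]
      fun s => x.jump s * (β * (1 - 1 / σ (x.left s))) := by
  filter_upwards [ae_restrict_of_ae x.jumpTimes_ae] with s hs
  exact log_Y hα x (s, x.jump s) (h.pos _) hs

theorem integrableOn_log_Y (hα : 0 < α) (h : IsAdmissible σ σ₀) (x : Path) (T : ℝ≥0) :
    IntegrableOn (fun p => Real.log (Y α β σ x p)) (strip T) (jumpMeasure x) := by
  rw [x.integrableOn_strip_jumpMeasure]
  exact (integrableOn_jump_mul h x β T).congr (log_Y_ae_eq hα h x T).symm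

theorem integrableOn_Y_sub_one (hα : 0 < α) (hβ : 0 < β) (h : IsAdmissible σ σ₀) (x : Path)
    (T : ℝ≥0) : IntegrableOn (fun p => Y α β σ x p - 1) (strip T) (compensator α β) := by
  simpa using integrableOn_strip_compensator (φ := fun _ => 1) hα hβ h.measurable h.pos x T
    measurable_const (by simpa using h.integrableOn_log x T)

theorem explicitDensity_eq (hα : 0 < α) (hβ : 0 < β) (h : IsAdmissible σ σ₀) (x : Path) (T : ℝ≥0) :
    explicitDensity α β σ T x
      = Real.exp ((∫ s in Ioc 0 T, x.jump s * (β * (1 - 1 / σ (x.left s))) ∂x.jumpTimes)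
        - ∫ s in Ioc 0 T, α * Real.log (σ (x.left s)) ∂lebesgueTime) := by
  have h1 := setIntegral_strip_compensator (φ := fun _ => 1) hα hβ h.measurable h.pos x T
    measurable_const (by simpa using h.integrableOn_log x T)
  simp only [one_mul] at h1
  rw [explicitDensity, h1, x.setIntegral_strip_jumpMeasure, integral_congr_ae (log_Y_ae_eq hα h x T)]

theorem explicitDensity_eq_stieltjes (hα : 0 < α) (hβ : 0 < β) (h : IsAdmissible σ σ₀) (x : Path)
    (T : ℝ≥0) :
    explicitDensity α β σ T x
      = Real.exp ((∫ s in Ioc 0 T ∩ x.jumps, β * (1 - 1 / σ (x.left s)) ∂x.stieltjes)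
        - ∫ s in Ioc 0 T, α * Real.log (σ (x.left s)) ∂lebesgueTime) := by
  rw [explicitDensity_eq hα hβ h, x.setIntegral_jumpTimes measurableSet_Ioc]

/-- `log` of the jump factor at the jump time `i`, cut off after time `T`. -/
noncomputable def logFactor (β : ℝ) (σ : ℝ → ℝ) (x : Path) (T : ℝ≥0) (i : x.jumps) : ℝ :=
  if (i : ℝ≥0) ≤ T then x.jump i * (β * (1 - 1 / σ (x.left i))) else 0

/-- The logarithmic decay rate between jumps, cut off after time `T`. -/
noncomputable def decayRate (α : ℝ) (σ : ℝ → ℝ) (x : Path) (T s : ℝ≥0) : ℝ :=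
  if s ≤ T then α * Real.log (σ (x.left s)) else 0

theorem jumps_pos (x : Path) (i : x.jumps) : 0 < (i : ℝ≥0) := by
  refine pos_iff_ne_zero.2 fun h => i.2 ?_
  rw [h, x.left_zero, x.map_zero]

theorem summable_logFactor (h : IsAdmissible σ σ₀) (x : Path) (β : ℝ) (T : ℝ≥0) :
    Summable (logFactor β σ x T) := by
  refine ((x.integrableOn_jumpTimes_iff_summable measurableSet_Ioc _).1
    (integrableOn_jump_mul h x β T)).congr fun i => ?_
  simp [logFactor, indicator, jumps_pos x i]

theorem measurable_decayRate (h : IsAdmissible σ σ₀) (x : Path) (T : ℝ≥0) :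
    Measurable (decayRate α σ x T) :=
  Measurable.ite measurableSet_Iic ((Real.measurable_log.comp (h.measurable_left x)).const_mul α)
    measurable_const

theorem exists_decayRate_le (h : IsAdmissible σ σ₀) (x : Path) (α : ℝ) (T : ℝ≥0) :
    ∃ K, ∀ s, |decayRate α σ x T s| ≤ K := by
  obtain ⟨K, hK⟩ := h.exists_abs_log_le x T
  refine ⟨|α| * max K 0, fun s => ?_⟩
  unfold decayRate
  split_ifs with hs
  · rw [abs_mul]; gcongr; exact (hK s hs).trans (le_max_left _ _)
  · simp; positivity

theorem explicitDensity_eq_tsum (hα : 0 < α) (hβ : 0 < β) (h : IsAdmissible σ σ₀) (x : Path)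
    {t T : ℝ≥0} (ht : t ≤ T) :
    explicitDensity α β σ t x
      = Real.exp ((∑' i : x.jumps, if (i : ℝ≥0) ≤ t then logFactor β σ x T i else 0)
        - ∫ s in Ioc 0 t, decayRate α σ x T s ∂lebesgueTime) := by
  rw [explicitDensity_eq hα hβ h, x.setIntegral_jumpTimes_eq_tsum measurableSet_Ioc]
  congr 2
  · congr 1 with i
    simp only [indicator, mem_Ioc, jumps_pos x i, true_and, logFactor]
    split_ifs with h1 h2
    · rfl
    · exact absurd (h1.trans ht) h2
    · rfl
  · refine setIntegral_congr_fun measurableSet_Ioc fun s hs => ?_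
    simp [decayRate, hs.2.trans ht]

/-- The left limit of the explicit density at `t ≤ T`. -/
noncomputable def leftDensity (α β : ℝ) (σ : ℝ → ℝ) (x : Path) (T t : ℝ≥0) : ℝ :=
  Real.exp ((∑' i : x.jumps, if (i : ℝ≥0) < t then logFactor β σ x T i else 0)
        - ∫ s in Ioc 0 t, decayRate α σ x T s ∂lebesgueTime)

theorem continuous_integral_decayRate (h : IsAdmissible σ σ₀) (x : Path) (α : ℝ) (T : ℝ≥0) :
    Continuous fun t : ℝ≥0 => ∫ s in Ioc 0 t, decayRate α σ x T s ∂lebesgueTime := by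
  obtain ⟨K, hK⟩ := exists_decayRate_le h x α T
  exact continuous_setIntegral_lebesgueTime (measurable_decayRate h x T) hK

theorem measurable_leftDensity (h : IsAdmissible σ σ₀) (x : Path) (T : ℝ≥0) :
    Measurable (leftDensity α β σ x T) := by
  have : Countable x.jumps := x.countable_jumps
  refine Real.measurable_exp.comp (Measurable.sub ?_ (continuous_integral_decayRate h x α T).measurable)
  exact Measurable.tsum fun i => Measurable.ite measurableSet_Ioi measurable_const measurable_const

/-- The predicate `p` selects the jumps counted in the limit: those before $t$ for limits from the
left, those up to $t$ for limits from the right. -/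
theorem tendsto_tsum_ite (h : IsAdmissible σ σ₀) (x : Path) (β : ℝ) (T : ℝ≥0)
    {l : Filter ℝ≥0} {p : ℝ≥0 → Prop} [DecidablePred p] (hp : ∀ s, ∀ᶠ t in l, (s ≤ t ↔ p s)) :
    Tendsto (fun t => ∑' i : x.jumps, if (i : ℝ≥0) ≤ t then logFactor β σ x T i else 0) l
      (𝓝 (∑' i : x.jumps, if p i then logFactor β σ x T i else 0)) := by
  refine tendsto_tsum_of_dominated_convergence (summable_logFactor h x β T).abs
    (fun i => ?_) (Eventually.of_forall fun t i => ?_)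
  · refine tendsto_const_nhds.congr' ?_
    filter_upwards [hp i] with t ht
    simp only [ht]
  · split_ifs <;> simp

theorem tendsto_explicitDensity_left (hα : 0 < α) (hβ : 0 < β) (h : IsAdmissible σ σ₀) (x : Path)
    {t T : ℝ≥0} (ht : t ≤ T) :
    Tendsto (fun s => explicitDensity α β σ s x) (𝓝[<] t) (𝓝 (leftDensity α β σ x T t)) := by
  have h1 := tendsto_tsum_ite h x β T (l := 𝓝[<] t) (p := fun s => s < t) fun s => by
    by_cases hs : s < t
    · filter_upwards [nhdsWithin_le_nhds (Ioi_mem_nhds hs)] with u hu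
      simp only [hs, iff_true]
      exact hu.le
    · filter_upwards [self_mem_nhdsWithin] with u hu
      simp only [hs, iff_false, not_le]
      exact lt_of_lt_of_le hu (not_lt.1 hs)
  have h2 := ((continuous_integral_decayRate h x α T).tendsto t).mono_left
    (nhdsWithin_le_nhds (s := Iio t))
  refine ((Real.continuous_exp.tendsto _).comp (h1.sub h2)).congr' ?_
  filter_upwards [self_mem_nhdsWithin] with s hs
  exact (explicitDensity_eq_tsum hα hβ h x ((le_of_lt hs).trans ht)).symm

theorem leftLim_explicitDensity (hα : 0 < α) (hβ : 0 < β) (h : IsAdmissible σ σ₀) (x : Path)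
    {t T : ℝ≥0} (h0 : 0 < t) (ht : t ≤ T) :
    Function.leftLim (fun s => explicitDensity α β σ s x) t = leftDensity α β σ x T t := by
  have : Fact (0 < t) := ⟨h0⟩
  exact leftLim_eq_of_tendsto (tendsto_explicitDensity_left hα hβ h x ht)

theorem isCadlag_explicitDensity (hα : 0 < α) (hβ : 0 < β) (h : IsAdmissible σ σ₀) (x : Path) :
    IsCadlag fun t => explicitDensity α β σ t x := by
  intro t
  refine ⟨?_, _, tendsto_explicitDensity_left hα hβ h x le_rfl⟩
  -- Limits from the right look beyond $t$, so the cut-off horizon has to exceed $t$.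
  have htT : t < t + 1 := lt_add_of_pos_right t one_pos
  have h1 := tendsto_tsum_ite h x β (t + 1) (l := 𝓝[≥] t) (p := fun s => s ≤ t) fun s => by
    by_cases hs : s ≤ t
    · filter_upwards [self_mem_nhdsWithin] with u hu
      simp only [hs, iff_true]
      exact hs.trans hu
    · filter_upwards [nhdsWithin_le_nhds (Iio_mem_nhds (not_le.1 hs))] with u hu
      simp only [hs, iff_false, not_le]
      exact hu
  have h2 := ((continuous_integral_decayRate h x α (t + 1)).tendsto t).mono_left
    (nhdsWithin_le_nhds (s := Ici t))
  have h3 := (Real.continuous_exp.tendsto _).comp (h1.sub h2)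
  rw [← explicitDensity_eq_tsum hα hβ h x htT.le] at h3
  refine Tendsto.congr' ?_ h3
  filter_upwards [nhdsWithin_le_nhds (Iio_mem_nhds htT)] with s hs
  exact (explicitDensity_eq_tsum hα hβ h x (le_of_lt hs)).symm

theorem integrableOn_Y_sub_one_jumpMeasure (hα : 0 < α) (h : IsAdmissible σ σ₀) (x : Path)
    (T : ℝ≥0) : IntegrableOn (fun p => Y α β σ x p - 1) (strip T) (jumpMeasure x) := by
  rw [x.integrableOn_strip_jumpMeasure, x.integrableOn_jumpTimes_iff_summable measurableSet_Ioc]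
  have hs := summable_logFactor h x β T
  refine Summable.of_norm_bounded
    (g := fun i => |logFactor β σ x T i| * Real.exp (∑' l, |logFactor β σ x T l|))
    (hs.abs.mul_right _) fun i => ?_
  simp only [indicator]
  split_ifs with hi
  · have e : Y α β σ x (↑i, x.jump i) = Real.exp (logFactor β σ x T i) := by
      rw [Y_eq_exp hα x _ (h.pos _) ((x.mem_jumps_iff _).1 i.2), logFactor, if_pos hi.2]
      ring_nf
    rw [e, Real.norm_eq_abs]
    refine (abs_exp_sub_one_le_mul _).trans ?_
    gcongr
    exact hs.abs.le_tsum i fun _ _ => abs_nonneg _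
  · simp; positivity

/-- This is `exp_summable_jumps` with the jump times as index set: $e^{a_i}-1$ is $Y-1$ at the jump,
and integrating $Y-1$ against $v\,dz$ gives the decay rate $\alpha\log\sigma$. -/
theorem explicitDensity_solves (hα : 0 < α) (hβ : 0 < β) (h : IsAdmissible σ σ₀) (x : Path)
    (t : ℝ≥0) :
    IntegrableOn (fun p => Function.leftLim (fun s => explicitDensity α β σ s x) p.1
        * (Y α β σ x p - 1)) (strip t) (jumpMeasure x) ∧
      IntegrableOn (fun p => Function.leftLim (fun s => explicitDensity α β σ s x) p.1
        * (Y α β σ x p - 1)) (strip t) (compensator α β) ∧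
      explicitDensity α β σ t x = 1
        + ((∫ p in strip t, Function.leftLim (fun s => explicitDensity α β σ s x) p.1
            * (Y α β σ x p - 1) ∂(jumpMeasure x))
          - ∫ p in strip t, Function.leftLim (fun s => explicitDensity α β σ s x) p.1
            * (Y α β σ x p - 1) ∂(compensator α β)) := by
  have : Countable x.jumps := x.countable_jumps
  obtain ⟨K, hK⟩ := exists_decayRate_le h x α t
  have hcm := measurable_decayRate (α := α) h x t
  obtain ⟨hsum, heq⟩ := exp_summable_jumps (fun i : x.jumps => (i : ℝ≥0)) (logFactor β σ x t)
    Subtype.val_injective hcm hK (summable_logFactor h x β t) t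
  have hleftY : ∀ i : x.jumps, (Ioc 0 t).indicator
      (fun s => Function.leftLim (fun s => explicitDensity α β σ s x) s
        * (Y α β σ x (s, x.jump s) - 1)) i
      = if (i : ℝ≥0) ≤ t then leftDensity α β σ x t i * (Real.exp (logFactor β σ x t i) - 1)
        else 0 := by
    intro i
    simp only [indicator, mem_Ioc, jumps_pos x i, true_and]
    split_ifs with hi
    · rw [leftLim_explicitDensity hα hβ h x (jumps_pos x i) hi,
        Y_eq_exp hα x _ (h.pos _) ((x.mem_jumps_iff _).1 i.2), logFactor, if_pos hi]
      ring_nf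
    · rfl
  have hcongr : EqOn (fun p : ℝ≥0 × ℝ => Function.leftLim (fun s => explicitDensity α β σ s x) p.1
        * (Y α β σ x p - 1)) (fun p => leftDensity α β σ x t p.1 * (Y α β σ x p - 1)) (strip t) := by
    intro p hp
    simp only [leftLim_explicitDensity hα hβ h x hp.1.1 hp.1.2]
  -- The jump times are countable, hence $dt$-null, so left limits and values may be exchanged under
  -- $dt$.
  have hleft_ae : ∀ᵐ s ∂lebesgueTime.restrict (Ioc 0 t),
      leftDensity α β σ x t s = explicitDensity α β σ s x := by
    have hnull : ∀ᵐ s ∂lebesgueTime.restrict (Ioc 0 t), s ∉ x.jumps :=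
      ae_restrict_of_ae (measure_eq_zero_iff_ae_notMem.1 (x.countable_jumps.measure_zero _))
    filter_upwards [ae_restrict_mem measurableSet_Ioc, hnull] with s hs hsj
    rw [explicitDensity_eq_tsum hα hβ h x hs.2, leftDensity]
    congr 3
    ext i
    have hne : (i : ℝ≥0) ≠ s := fun e => hsj (e ▸ i.2)
    simp only [lt_iff_le_and_ne, hne, ne_eq, not_false_eq_true, and_true]
  have hφint : IntegrableOn (fun s => leftDensity α β σ x t s * Real.log (σ (x.left s))) (Ioc 0 t)
      lebesgueTime := by
    have hA : ∀ s, (∑' i : x.jumps, if (i : ℝ≥0) < s then logFactor β σ x t i else 0)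
        ≤ ∑' i, |logFactor β σ x t i| := by
      intro s
      have hle : ∀ i : x.jumps, ‖if (i : ℝ≥0) < s then logFactor β σ x t i else 0‖
          ≤ |logFactor β σ x t i| := fun i => by split_ifs <;> simp
      exact (le_abs_self _).trans (tsum_of_norm_bounded (summable_logFactor h x β t).abs.hasSum hle)
    obtain ⟨K', hK'⟩ := h.exists_abs_log_le x t
    refine Integrable.of_bound ((measurable_leftDensity h x t).mul
      (Real.measurable_log.comp (h.measurable_left x))).aestronglyMeasurable
      (Real.exp ((∑' i, |logFactor β σ x t i|) + |K| * t) * K') ?_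
    filter_upwards [ae_restrict_mem measurableSet_Ioc] with s hs
    rw [norm_mul]
    refine mul_le_mul ?_ (hK' s hs.2) (norm_nonneg _) (Real.exp_pos _).le
    rw [leftDensity, Real.norm_of_nonneg (Real.exp_pos _).le, Real.exp_le_exp]
    have h1 := hA s
    have h2 : -∫ r in Ioc 0 s, decayRate α σ x t r ∂lebesgueTime ≤ |K| * t := by
      refine (neg_le_abs _).trans ((abs_setIntegral_lebesgueTime_le hK s).trans ?_)
      have : (s : ℝ) ≤ t := hs.2
      gcongr
      exact le_abs_self K
    linarith
  refine ⟨?_, ?_, ?_⟩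
  · rw [x.integrableOn_strip_jumpMeasure, x.integrableOn_jumpTimes_iff_summable measurableSet_Ioc]
    exact hsum.congr fun i => (hleftY i).symm
  · refine IntegrableOn.congr_fun ?_ hcongr.symm (measurableSet_strip t)
    exact integrableOn_strip_compensator hα hβ h.measurable h.pos x t
      (measurable_leftDensity h x t) hφint
  · rw [setIntegral_congr_fun (μ := compensator α β) (measurableSet_strip t) hcongr,
      setIntegral_strip_compensator hα hβ h.measurable h.pos x t
      (measurable_leftDensity h x t) hφint, x.setIntegral_strip_jumpMeasure,
      x.setIntegral_jumpTimes_eq_tsum measurableSet_Ioc, ← add_sub_assoc, tsum_congr hleftY,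
      explicitDensity_eq_tsum hα hβ h x le_rfl, heq]
    congr 1
    refine integral_congr_ae ?_
    filter_upwards [ae_restrict_mem measurableSet_Ioc, hleft_ae] with s hs hse
    rw [hse, explicitDensity_eq_tsum hα hβ h x hs.2, decayRate, if_pos hs.2]

theorem solvesDensitySDE_explicitDensity (hα : 0 < α) (hβ : 0 < β) (h : IsAdmissible σ σ₀)
    (P : Measure Path) : SolvesDensitySDE α β σ P (explicitDensity α β σ) :=
  ae_of_all _ fun x => ⟨isCadlag_explicitDensity hα hβ h x, explicitDensity_solves hα hβ h x⟩

theorem eq_explicitDensity_of_solves (hα : 0 < α) (hβ : 0 < β) (h : IsAdmissible σ σ₀)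
    {P : Measure Path} {Z : ℝ≥0 → Path → ℝ} (hZ : SolvesDensitySDE α β σ P Z) :
    ∀ᵐ x ∂P, ∀ T : ℝ≥0, Z T x = explicitDensity α β σ T x := by
  filter_upwards [hZ] with x hx
  exact eq_of_linear_equation (integrableOn_Y_sub_one_jumpMeasure hα h x)
    (integrableOn_Y_sub_one hα hβ h x) hx.1 (isCadlag_explicitDensity hα hβ h x) hx.2
    (explicitDensity_solves hα hβ h x)

end

/-! ### Measurable dependence on the path -/

/-- Splitting $\Omega$ by the integer part of the total mass gives countably many bounded kernels.
The Stieltjes measures of random paths have finite masses without a uniform bound. -/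
theorem isSFiniteKernel_of_isFiniteMeasure {Ω E : Type*} [MeasurableSpace Ω] [MeasurableSpace E]
    (κ : Kernel Ω E) (hκ : ∀ ω, IsFiniteMeasure (κ ω)) : IsSFiniteKernel κ := by
  classical
  have hm : Measurable fun ω => ⌊(κ ω univ).toReal⌋₊ :=
    Nat.measurable_floor.comp (κ.measurable_coe MeasurableSet.univ).ennreal_toReal
  have hA : ∀ n, MeasurableSet {ω | ⌊(κ ω univ).toReal⌋₊ = n} := fun n =>
    hm (measurableSet_singleton n)
  refine ⟨fun n => Kernel.piecewise (hA n) κ 0, fun n => ⟨⟨n + 1, by finiteness, fun ω => ?_⟩⟩, ?_⟩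
  · rw [Kernel.piecewise_apply']
    split_ifs with h
    · have h1 := (Nat.lt_floor_add_one (κ ω univ).toReal).le
      rw [show ⌊(κ ω univ).toReal⌋₊ = n from h] at h1
      rw [← ENNReal.ofReal_toReal (measure_ne_top (κ ω) univ)]
      refine (ENNReal.ofReal_le_ofReal h1).trans ?_
      rw [ENNReal.ofReal_add (by positivity) zero_le_one]
      simp
    · simp
  · ext ω s hs
    rw [Kernel.sum_apply' _ _ hs, tsum_eq_single ⌊(κ ω univ).toReal⌋₊]
    · simp [Kernel.piecewise_apply']
    · intro n hn
      rw [Kernel.piecewise_apply', if_neg (fun h : ω ∈ {ω | ⌊(κ ω univ).toReal⌋₊ = n} => hn (Eq.symm h))]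
      simp

theorem Path.tendsto_left (x : Path) (t : ℝ≥0) : Tendsto x (𝓝[<] t) (𝓝 (x.left t)) :=
  x.mono.tendsto_leftLim t

section

variable {Ω : Type*} [MeasurableSpace Ω] {X : Ω → Path} {T : ℝ≥0}

/-- Progressive measurability from right-continuity: sample at dyadic points to the right. Stopping
at $T$ keeps every sampled time within $[0,T]$. -/
theorem measurable_path_min (hX : ∀ t ≤ T, Measurable fun ω => X ω t) :
    Measurable fun p : Ω × ℝ≥0 => X p.1 (min p.2 T) := by
  let r : ℕ → ℕ → ℝ≥0 := fun n k => (k + 1) / 2 ^ n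
  have hf : ∀ n : ℕ, Measurable fun p : Ω × ℝ≥0 => X p.1 (min (r n ⌊p.2 * 2 ^ n⌋₊) T) := by
    intro n
    have h1 : Measurable fun q : Ω × ℕ => X q.1 (min (r n q.2) T) :=
      measurable_from_prod_countable_left fun k => hX (min (r n k) T) (min_le_right _ _)
    exact h1.comp (measurable_fst.prodMk
      (Nat.measurable_floor.comp (measurable_snd.mul measurable_const)))
  refine measurable_of_tendsto_metrizable hf (tendsto_pi_nhds.2 fun p => ?_)
  have hgt : ∀ n, p.2 ≤ r n ⌊p.2 * 2 ^ n⌋₊ := fun n => by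
    rw [le_div_iff₀ (by positivity)]
    exact (Nat.lt_floor_add_one _).le
  have hle : ∀ n : ℕ, r n ⌊p.2 * 2 ^ n⌋₊ ≤ p.2 + (1 / 2) ^ n := fun n => by
    have h1 : (⌊p.2 * 2 ^ n⌋₊ : ℝ≥0) ≤ p.2 * 2 ^ n := Nat.floor_le (zero_le (a := p.2 * 2 ^ n))
    rw [div_le_iff₀ (by positivity), add_mul, ← mul_pow]
    simpa using h1
  have hlim : Tendsto (fun n => r n ⌊p.2 * 2 ^ n⌋₊) atTop (𝓝 p.2) := by
    refine tendsto_of_tendsto_of_tendsto_of_le_of_le tendsto_const_nhds ?_ hgt hle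
    have : Tendsto (fun n : ℕ => (1 / 2 : ℝ≥0) ^ n) atTop (𝓝 0) :=
      NNReal.tendsto_pow_atTop_nhds_zero_of_lt_one (by
        rw [← NNReal.coe_lt_coe]; norm_num)
    simpa using this.const_add p.2
  have hrc := (X p.1).1.right_continuous (min p.2 T)
  refine hrc.tendsto.comp (tendsto_nhdsWithin_iff.2 ⟨hlim.min tendsto_const_nhds,
    Eventually.of_forall fun n => min_le_min (hgt n) le_rfl⟩)

theorem measurable_left_min (hX : ∀ t ≤ T, Measurable fun ω => X ω t) :
    Measurable fun p : Ω × ℝ≥0 => (X p.1).left (min p.2 T) := by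
  have hf : ∀ n : ℕ, Measurable fun p : Ω × ℝ≥0 =>
      X p.1 (min (min p.2 T - 1 / (n + 1)) T) := fun n =>
    (measurable_path_min hX).comp (measurable_fst.prodMk
      ((measurable_snd.min measurable_const).sub measurable_const))
  refine measurable_of_tendsto_metrizable hf (tendsto_pi_nhds.2 fun p => ?_)
  set u := min p.2 T with hu
  have e : ∀ n : ℕ, min (u - 1 / ((n : ℝ≥0) + 1)) T = u - 1 / (n + 1) := fun n =>
    min_eq_left (tsub_le_self.trans (min_le_right _ _))
  simp_rw [e]
  -- At $u=0$ the truncated subtraction stays at $0$, in agreement with $x_{0-}=0$.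
  rcases eq_or_lt_of_le (zero_le (a := u)) with h0 | h0
  · rw [← h0]
    simp [Path.left_zero, Path.map_zero]
  · refine ((X p.1).tendsto_left u).comp (tendsto_nhdsWithin_iff.2 ⟨?_, ?_⟩)
    · have h1 : Tendsto (fun n : ℕ => 1 / ((n : ℝ≥0) + 1)) atTop (𝓝 0) :=
        tendsto_one_div_add_atTop_nhds_zero_nat
      simpa using h1.const_sub u
    · exact Eventually.of_forall fun n => tsub_lt_self h0 (by positivity)

/-- The kernel `ω ↦ dX(ω)` on `(0, T]`. -/
noncomputable def stieltjesKernel (X : Ω → Path) (T : ℝ≥0)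
    (hX : ∀ t ≤ T, Measurable fun ω => X ω t) : Kernel Ω ℝ≥0 where
  toFun ω := (X ω).stieltjes.restrict (Ioc 0 T)
  measurable' := by
    refine Measurable.measure_of_isPiSystem (BorelSpace.measurable_eq.trans
      (borel_eq_generateFrom_Iic ℝ≥0)) isPiSystem_Iic ?_ ?_
    · rintro _ ⟨a, rfl⟩
      have : ∀ ω, (X ω).stieltjes.restrict (Ioc 0 T) (Iic a)
          = ENNReal.ofReal (X ω (min a T)) := fun ω => by
        rw [Measure.restrict_apply measurableSet_Iic, inter_comm, Ioc_inter_Iic, min_comm,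
          Path.stieltjes_Ioc, Path.map_zero, sub_zero]
      simp_rw [this]
      exact (hX _ (min_le_right _ _)).ennreal_ofReal
    · have : ∀ ω, (X ω).stieltjes.restrict (Ioc 0 T) univ = ENNReal.ofReal (X ω T) := fun ω => by
        rw [Measure.restrict_apply_univ, Path.stieltjes_Ioc, Path.map_zero, sub_zero]
      simp_rw [this]
      exact (hX _ le_rfl).ennreal_ofReal

instance (X : Ω → Path) (T : ℝ≥0) (hX : ∀ t ≤ T, Measurable fun ω => X ω t) :
    IsSFiniteKernel (stieltjesKernel X T hX) :=
  isSFiniteKernel_of_isFiniteMeasure _ fun ω => by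
    change IsFiniteMeasure ((X ω).stieltjes.restrict (Ioc 0 T))
    infer_instance

theorem measurable_setIntegral_stieltjes (hX : ∀ t ≤ T, Measurable fun ω => X ω t)
    {f : Ω → ℝ≥0 → ℝ} (hf : Measurable (Function.uncurry f)) :
    Measurable fun ω => ∫ s in Ioc 0 T, f ω s ∂(X ω).stieltjes :=
  (hf.stronglyMeasurable.integral_kernel_prod_right (κ := stieltjesKernel X T hX)).measurable

theorem measurable_setLIntegral_stieltjes (hX : ∀ t ≤ T, Measurable fun ω => X ω t)
    {f : Ω → ℝ≥0 → ℝ≥0∞} (hf : Measurable (Function.uncurry f)) :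
    Measurable fun ω => ∫⁻ s in Ioc 0 T, f ω s ∂(X ω).stieltjes :=
  hf.lintegral_kernel_prod_right (κ := stieltjesKernel X T hX)

theorem measurable_setIntegral_lebesgueTime {f : Ω → ℝ≥0 → ℝ}
    (hf : Measurable (Function.uncurry f)) :
    Measurable fun ω => ∫ s in Ioc 0 T, f ω s ∂lebesgueTime :=
  (hf.stronglyMeasurable.integral_prod_right (ν := lebesgueTime.restrict (Ioc 0 T))).measurable

theorem measurableSet_jumps_min (hX : ∀ t ≤ T, Measurable fun ω => X ω t) :
    MeasurableSet {p : Ω × ℝ≥0 | min p.2 T ∈ (X p.1).jumps} :=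
  (measurableSet_eq_fun (measurable_left_min hX) (measurable_path_min hX)).compl

theorem measurable_explicitDensity_comp {α β : ℝ} {σ : ℝ → ℝ} {σ₀ : ℝ} (hα : 0 < α) (hβ : 0 < β)
    (h : IsAdmissible σ σ₀) (hX : ∀ t ≤ T, Measurable fun ω => X ω t) :
    Measurable fun ω => explicitDensity α β σ T (X ω) := by
  classical
  simp_rw [explicitDensity_eq_stieltjes hα hβ h]
  have hσ : Measurable fun p : Ω × ℝ≥0 => σ ((X p.1).left (min p.2 T)) :=
    h.measurable.comp (measurable_left_min hX)
  refine Real.measurable_exp.comp (Measurable.sub ?_ ?_)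
  · have e : ∀ ω, ∫ s in Ioc 0 T ∩ (X ω).jumps, β * (1 - 1 / σ ((X ω).left s)) ∂(X ω).stieltjes
        = ∫ s in Ioc 0 T, (if min s T ∈ (X ω).jumps then
          β * (1 - 1 / σ ((X ω).left (min s T))) else 0) ∂(X ω).stieltjes := fun ω => by
      rw [← setIntegral_indicator (X ω).measurableSet_jumps]
      refine setIntegral_congr_fun measurableSet_Ioc fun s hs => ?_
      simp only [min_eq_left hs.2, indicator]
    simp_rw [e]
    exact measurable_setIntegral_stieltjes hX (f := fun ω s => if min s T ∈ (X ω).jumps then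
          β * (1 - 1 / σ ((X ω).left (min s T))) else 0)
      (Measurable.ite (measurableSet_jumps_min hX) (((hσ.const_div 1).const_sub 1).const_mul β)
        measurable_const)
  · have e : ∀ ω, ∫ s in Ioc 0 T, α * Real.log (σ ((X ω).left s)) ∂lebesgueTime
        = ∫ s in Ioc 0 T, α * Real.log (σ ((X ω).left (min s T))) ∂lebesgueTime := fun ω => by
      refine setIntegral_congr_fun measurableSet_Ioc fun s hs => ?_
      simp only [min_eq_left hs.2]
    simp_rw [e]
    exact measurable_setIntegral_lebesgueTime
      (f := fun ω s => α * Real.log (σ ((X ω).left (min s T))))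
      ((Real.measurable_log.comp hσ).const_mul α)

end

theorem measurable_coordinate {s T : ℝ≥0} (h : s ≤ T) :
    Measurable[pathFiltration T] fun x : Path => x s := by
  have h1 : Measurable[pathFiltration s] fun x : Path => x s :=
    Measurable.of_comap_le (le_iSup₂_of_le s le_rfl le_rfl)
  exact h1.mono (pathFiltration.mono h) le_rfl

theorem measurable_explicitDensity {α β : ℝ} {σ : ℝ → ℝ} {σ₀ : ℝ} (hα : 0 < α) (hβ : 0 < β)
    (h : IsAdmissible σ σ₀) (T : ℝ≥0) :
    Measurable[pathFiltration T] (explicitDensity α β σ T) :=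
  -- Adaptedness is joint measurability with $\mathcal F^X_T$ itself as the ambient σ-algebra and
  -- the identity as the process.
  @measurable_explicitDensity_comp Path (pathFiltration T) id T α β σ σ₀ hα hβ h
    fun _ ht => measurable_coordinate ht

/-! ### Scaling of gamma distributions -/

theorem mul_gammaPDF_mul (a r : ℝ) {g : ℝ} (hg : 0 < g) (x : ℝ) :
    ENNReal.ofReal (Real.exp (r * (1 - g) * x + a * Real.log g)) * gammaPDF a r x
      = ENNReal.ofReal g * gammaPDF a r (g * x) := by
  rcases lt_or_ge x 0 with hx | hx
  · rw [gammaPDF_of_neg hx, gammaPDF_of_neg (mul_neg_of_pos_of_neg hg hx), mul_zero, mul_zero]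
  · rw [gammaPDF_of_nonneg hx, gammaPDF_of_nonneg (mul_nonneg hg.le hx),
      ← ENNReal.ofReal_mul (Real.exp_pos _).le, ← ENNReal.ofReal_mul hg.le]
    congr 1
    have e1 : Real.exp (r * (1 - g) * x + a * Real.log g) * Real.exp (-(r * x))
        = Real.exp (-(r * (g * x))) * (g ^ (a - 1) * g) := by
      rw [← Real.rpow_add_one hg.ne', sub_add_cancel, Real.rpow_def_of_pos hg, ← Real.exp_add,
        ← Real.exp_add]
      ring_nf
    rw [Real.mul_rpow hg.le hx]
    calc _ = (r ^ a / Real.Gamma a * x ^ (a - 1)) *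
          (Real.exp (r * (1 - g) * x + a * Real.log g) * Real.exp (-(r * x))) := by ring
      _ = _ := by rw [e1]; ring

theorem measurable_gammaPDF (a r : ℝ) : Measurable (gammaPDF a r) :=
  (measurable_gammaPDFReal a r).ennreal_ofReal

/-- The weight $e^{r(1-g)x}g^a$ exactly undoes the scaling $x\mapsto gx$ of a gamma variable. Every
change of measure below is built from this identity. -/
theorem lintegral_gammaMeasure_tilt (a r : ℝ) {g : ℝ} (hg : 0 < g)
    {f : ℝ → ℝ≥0∞} (hf : Measurable f) :
    ∫⁻ x, ENNReal.ofReal (Real.exp (r * (1 - g) * x + a * Real.log g)) * f (g * x)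
      ∂gammaMeasure a r = ∫⁻ x, f x ∂gammaMeasure a r := by
  have hm := measurable_gammaPDF a r
  rw [gammaMeasure, lintegral_withDensity_eq_lintegral_mul _ hm (by fun_prop),
    lintegral_withDensity_eq_lintegral_mul _ hm hf]
  calc _ = ∫⁻ x, ENNReal.ofReal |g| * (gammaPDF a r * f) (g * x) := by
        refine lintegral_congr fun x => ?_
        have := mul_gammaPDF_mul a r hg x
        simp only [Pi.mul_apply]
        rw [abs_of_pos hg, ← mul_assoc, ← mul_assoc, ← this]
        ring
    _ = ∫⁻ x, (gammaPDF a r * f) x ∂(ENNReal.ofReal |g| • Measure.map (g * ·) volume) := by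
        rw [lintegral_smul_measure, lintegral_map (hm.mul hf) (by fun_prop),
          lintegral_const_mul' _ _ ENNReal.ofReal_ne_top]
        rfl
    _ = _ := by rw [Real.smul_map_volume_mul_left hg.ne']

/-! ### Change of measure for step coefficients -/

section Step

variable {Ω : Type*} {m : MeasurableSpace Ω} {α β : ℝ} {𝔽 : Filtration ℝ≥0 m} {P : Measure Ω}
  {L : Ω → Path}

/-- The density factor of the increment of `L` over `(s, t]` when it is multiplied by `g`. -/
noncomputable def stepDensity (α β : ℝ) (L : Ω → Path) (s t : ℝ≥0) (g : Ω → ℝ) (ω : Ω) : ℝ :=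
  Real.exp (β * (1 - g ω) * (L ω t - L ω s) + α * ((t : ℝ) - s) * Real.log (g ω))

theorem IsGammaProcess.measurable (hL : IsGammaProcess α β 𝔽 P L) (t : ℝ≥0) :
    Measurable fun ω => L ω t := (hL.adapted t).mono (𝔽.le t) le_rfl

theorem measurable_stepDensity {m' : MeasurableSpace Ω} {s t : ℝ≥0} {g : Ω → ℝ}
    (hs : Measurable[m'] fun ω => L ω s) (ht : Measurable[m'] fun ω => L ω t)
    (hg : Measurable[m'] g) : Measurable[m'] (stepDensity α β L s t g) := by
  unfold stepDensity
  exact Real.measurable_exp.comp ((((hg.const_sub 1).const_mul β).mul (ht.sub hs)).add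
    ((Real.measurable_log.comp hg).const_mul _))

/-- The increment is independent of $(W,g)$, so $(W,g)$ can be frozen by Fubini and the scaling
identity applied for each value of $g$. -/
theorem lintegral_mul_step [IsProbabilityMeasure P] (hα : 0 < α) (hβ : 0 < β)
    (hL : IsGammaProcess α β 𝔽 P L) {s t : ℝ≥0} (hst : s < t) {W : Ω → ℝ≥0∞} {g : Ω → ℝ}
    (hW : Measurable[𝔽 s] W) (hg : Measurable[𝔽 s] g) (hpos : ∀ ω, 0 < g ω) {f : ℝ → ℝ≥0∞}
    (hf : Measurable f) :
    ∫⁻ ω, W ω * (ENNReal.ofReal (stepDensity α β L s t g ω) * f (g ω * (L ω t - L ω s))) ∂P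
      = (∫⁻ ω, W ω ∂P) * ∫⁻ x, f x ∂gammaMeasure (α * ((t : ℝ) - s)) β := by
  have ha : 0 < α * ((t : ℝ) - s) := mul_pos hα (sub_pos.2 hst)
  have : IsProbabilityMeasure (gammaMeasure (α * ((t : ℝ) - s)) β) :=
    isProbabilityMeasure_gammaMeasure ha hβ
  have hWg : Measurable[𝔽 s] fun ω => (W ω, g ω) := hW.prodMk hg
  have hWg' : Measurable fun ω => (W ω, g ω) := hWg.mono (𝔽.le s) le_rfl
  have hΔ : Measurable fun ω => L ω t - L ω s := (hL.measurable t).sub (hL.measurable s)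
  have hind : IndepFun (fun ω => (W ω, g ω)) (fun ω => L ω t - L ω s) P :=
    indep_of_indep_of_le_left (hL.indep_increment s t hst) hWg.comap_le
  have hmap := (indepFun_iff_map_prod_eq_prod_map_map hWg'.aemeasurable hΔ.aemeasurable).1 hind
  rw [hL.law_increment s t hst] at hmap
  let F : (ℝ≥0∞ × ℝ) × ℝ → ℝ≥0∞ := fun q => q.1.1 * (ENNReal.ofReal (Real.exp
    (β * (1 - q.1.2) * q.2 + α * ((t : ℝ) - s) * Real.log q.1.2)) * f (q.1.2 * q.2))
  have hF : Measurable F := by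
    refine Measurable.mul (by fun_prop) (Measurable.mul ?_ (by fun_prop))
    exact (Real.measurable_exp.comp (by fun_prop)).ennreal_ofReal
  calc _ = ∫⁻ ω, F ((W ω, g ω), L ω t - L ω s) ∂P := rfl
    _ = ∫⁻ q, F q ∂(P.map fun ω => ((W ω, g ω), L ω t - L ω s)) :=
        (lintegral_map hF (hWg'.prodMk hΔ)).symm
    _ = ∫⁻ w, ∫⁻ x, F (w, x) ∂gammaMeasure (α * ((t : ℝ) - s)) β ∂(P.map fun ω => (W ω, g ω)) := by
        rw [hmap, lintegral_prod _ hF.aemeasurable]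
    _ = ∫⁻ ω, ∫⁻ x, F ((W ω, g ω), x) ∂gammaMeasure (α * ((t : ℝ) - s)) β ∂P :=
        lintegral_map hF.lintegral_prod_right' hWg'
    _ = ∫⁻ ω, W ω * ∫⁻ x, f x ∂gammaMeasure (α * ((t : ℝ) - s)) β ∂P := by
        refine lintegral_congr fun ω => ?_
        rw [← lintegral_gammaMeasure_tilt _ _ (hpos ω) hf]
        refine lintegral_const_mul _ ?_
        have := hf.comp (measurable_id.const_mul (g ω))
        exact Measurable.mul (by fun_prop) this
    _ = _ := lintegral_mul_const _ (hW.mono (𝔽.le s) le_rfl)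

variable {t : ℕ → ℝ≥0} {g : ℕ → Ω → ℝ}

/-- The last step is peeled off: all earlier factors are known at its left endpoint and serve as the
weight `W`. -/
theorem lintegral_prod_step [IsProbabilityMeasure P] (hα : 0 < α) (hβ : 0 < β)
    (hL : IsGammaProcess α β 𝔽 P L) (ht : StrictMono t) (hg : ∀ i, Measurable[𝔽 (t i)] (g i))
    (hpos : ∀ i ω, 0 < g i ω) {f : ℕ → ℝ → ℝ≥0∞} (hf : ∀ i, Measurable (f i)) (N : ℕ) :
    ∫⁻ ω, ∏ i ∈ Finset.range N, (ENNReal.ofReal (stepDensity α β L (t i) (t (i + 1)) (g i) ω)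
        * f i (g i ω * (L ω (t (i + 1)) - L ω (t i)))) ∂P
      = ∏ i ∈ Finset.range N, ∫⁻ x, f i x ∂gammaMeasure (α * ((t (i + 1) : ℝ) - t i)) β := by
  induction N with
  | zero => simp
  | succ N ih =>
    simp_rw [Finset.prod_range_succ]
    rw [← ih]
    refine lintegral_mul_step hα hβ hL (ht N.lt_succ_self) ?_ (hg N) (hpos N) (hf N)
    refine Finset.measurable_prod _ fun i hi => ?_
    have hi' : i + 1 ≤ N := Finset.mem_range.1 hi
    have hs : Measurable[𝔽 (t N)] fun ω => L ω (t i) :=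
      (hL.adapted _).mono (𝔽.mono (ht.monotone (Nat.le_of_succ_le hi'))) le_rfl
    have hs' : Measurable[𝔽 (t N)] fun ω => L ω (t (i + 1)) :=
      (hL.adapted _).mono (𝔽.mono (ht.monotone hi')) le_rfl
    have hgi : Measurable[𝔽 (t N)] (g i) :=
      (hg i).mono (𝔽.mono (ht.monotone (Nat.le_of_succ_le hi'))) le_rfl
    exact (measurable_stepDensity hs hs' hgi).ennreal_ofReal.mul
      ((hf i).comp (hgi.mul (hs'.sub hs)))

theorem map_step_eq_pi [IsProbabilityMeasure P] (hα : 0 < α) (hβ : 0 < β)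
    (hL : IsGammaProcess α β 𝔽 P L) (ht : StrictMono t) (hg : ∀ i, Measurable[𝔽 (t i)] (g i))
    (hpos : ∀ i ω, 0 < g i ω) (N : ℕ) :
    (P.withDensity fun ω => ∏ i ∈ Finset.range N,
        ENNReal.ofReal (stepDensity α β L (t i) (t (i + 1)) (g i) ω)).map
        (fun ω (i : Fin N) => g i ω * (L ω (t (i + 1)) - L ω (t i)))
      = Measure.pi fun i : Fin N => gammaMeasure (α * ((t (i + 1) : ℝ) - t i)) β := by
  have hprob : ∀ i : Fin N, IsProbabilityMeasure (gammaMeasure (α * ((t (i + 1) : ℝ) - t i)) β) :=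
    fun i => isProbabilityMeasure_gammaMeasure
      (mul_pos hα (sub_pos.2 (ht (Nat.lt_succ_self i)))) hβ
  have hgm : ∀ i, Measurable (g i) := fun i => (hg i).mono (𝔽.le _) le_rfl
  have hvm : Measurable (fun ω (i : Fin N) => g i ω * (L ω (t (i + 1)) - L ω (t i))) :=
    measurable_pi_lambda _ fun i => (hgm i).mul ((hL.measurable _).sub (hL.measurable _))
  symm
  refine Measure.pi_eq fun s hs => ?_
  let f : ℕ → ℝ → ℝ≥0∞ := fun i => if h : i < N then (s ⟨i, h⟩).indicator 1 else 1
  have hf : ∀ i, Measurable (f i) := by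
    intro i
    simp only [f]
    split_ifs with h
    · exact measurable_one.indicator (hs _)
    · exact measurable_one
  have key := lintegral_prod_step hα hβ hL ht hg hpos hf N
  have hR : ∏ i ∈ Finset.range N, ∫⁻ x, f i x ∂gammaMeasure (α * ((t (i + 1) : ℝ) - t i)) β
      = ∏ i : Fin N, gammaMeasure (α * ((t (i + 1) : ℝ) - t i)) β (s i) := by
    rw [Finset.prod_range]
    refine Finset.prod_congr rfl fun i _ => ?_
    simp only [f, i.2, dif_pos]
    rw [lintegral_indicator_one (hs _)]
  have hpm : MeasurableSet (univ.pi s) := MeasurableSet.univ_pi hs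
  rw [← hR, ← key, Measure.map_apply hvm hpm, withDensity_apply _ (hvm hpm),
    ← lintegral_indicator (hvm hpm)]
  refine lintegral_congr fun ω => ?_
  rw [Finset.prod_mul_distrib, Finset.prod_range (fun i => f i _)]
  have : ∏ i : Fin N, f i (g i ω * (L ω (t (i + 1)) - L ω (t i)))
      = ((fun ω (i : Fin N) => g i ω * (L ω (t (i + 1)) - L ω (t i))) ⁻¹' univ.pi s).indicator 1 ω := by
    simp only [f, Fin.is_lt, dif_pos, Fin.eta]
    by_cases h : ∀ i : Fin N, g i ω * (L ω (t (i + 1)) - L ω (t i)) ∈ s i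
    · rw [indicator_of_mem (by simpa [Set.mem_pi] using h)]
      exact Finset.prod_eq_one fun i _ => by rw [indicator_of_mem (h i)]; rfl
    · rw [indicator_of_notMem (by simpa [Set.mem_pi] using h)]
      push Not at h
      obtain ⟨i, hi⟩ := h
      exact Finset.prod_eq_zero (Finset.mem_univ i) (indicator_of_notMem hi _)
  rw [this]
  by_cases h : ω ∈ (fun ω (i : Fin N) => g i ω * (L ω (t (i + 1)) - L ω (t i))) ⁻¹' univ.pi s <;>
    simp [h]

theorem map_increments_eq_pi [IsProbabilityMeasure P] (hα : 0 < α) (hβ : 0 < β)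
    (hL : IsGammaProcess α β 𝔽 P L) (ht : StrictMono t) (N : ℕ) :
    P.map (fun ω (i : Fin N) => L ω (t (i + 1)) - L ω (t i))
      = Measure.pi fun i : Fin N => gammaMeasure (α * ((t (i + 1) : ℝ) - t i)) β := by
  have := map_step_eq_pi (g := fun _ _ => 1) hα hβ hL ht (fun _ => measurable_const)
    (fun _ _ => one_pos) N
  simpa [stepDensity] using this

theorem lintegral_step_eq [IsProbabilityMeasure P] (hα : 0 < α) (hβ : 0 < β)
    (hL : IsGammaProcess α β 𝔽 P L) (ht : StrictMono t) (hg : ∀ i, Measurable[𝔽 (t i)] (g i))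
    (hpos : ∀ i ω, 0 < g i ω) (N : ℕ) {F : (Fin N → ℝ) → ℝ≥0∞} (hF : Measurable F) :
    ∫⁻ ω, (∏ i ∈ Finset.range N, ENNReal.ofReal (stepDensity α β L (t i) (t (i + 1)) (g i) ω))
        * F (fun i => g i ω * (L ω (t (i + 1)) - L ω (t i))) ∂P
      = ∫⁻ ω, F (fun i => L ω (t (i + 1)) - L ω (t i)) ∂P := by
  have hgm : ∀ i, Measurable (g i) := fun i => (hg i).mono (𝔽.le _) le_rfl
  have hvm : Measurable (fun ω (i : Fin N) => g i ω * (L ω (t (i + 1)) - L ω (t i))) :=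
    measurable_pi_lambda _ fun i => (hgm i).mul ((hL.measurable _).sub (hL.measurable _))
  have hum : Measurable (fun ω (i : Fin N) => L ω (t (i + 1)) - L ω (t i)) :=
    measurable_pi_lambda _ fun i => (hL.measurable _).sub (hL.measurable _)
  have hDm : Measurable fun ω => ∏ i ∈ Finset.range N,
      ENNReal.ofReal (stepDensity α β L (t i) (t (i + 1)) (g i) ω) :=
    Finset.measurable_prod _ fun i _ =>
      (measurable_stepDensity (hL.measurable _) (hL.measurable _) (hgm i)).ennreal_ofReal
  have h1 := map_step_eq_pi hα hβ hL ht hg hpos N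
  rw [← map_increments_eq_pi hα hβ hL ht N] at h1
  have h2 := congrArg (lintegral · F) h1
  beta_reduce at h2
  rw [lintegral_map hF hvm, lintegral_map hF hum] at h2
  exact (lintegral_withDensity_eq_lintegral_mul _ hDm (hF.comp hvm)).symm.trans h2

/-- The exponent $\beta(1-g)$ stays below the rate $\beta$, so the moment is finite for every $g>0$.
It is the source of all dominating functions. -/
theorem lintegral_exp_increment [IsProbabilityMeasure P] (hα : 0 < α) (hβ : 0 < β)
    (hL : IsGammaProcess α β 𝔽 P L) {s t : ℝ≥0} (hst : s < t) {g : ℝ} (hg : 0 < g) :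
    ∫⁻ ω, ENNReal.ofReal (Real.exp (β * (1 - g) * (L ω t - L ω s))) ∂P
      = ENNReal.ofReal (Real.exp (-(α * ((t : ℝ) - s) * Real.log g))) := by
  have ha : 0 < α * ((t : ℝ) - s) := mul_pos hα (sub_pos.2 hst)
  have : IsProbabilityMeasure (gammaMeasure (α * ((t : ℝ) - s)) β) :=
    isProbabilityMeasure_gammaMeasure ha hβ
  have h := lintegral_mul_step hα hβ hL hst (W := fun _ => 1) (g := fun _ => g) (f := fun _ => 1)
    measurable_const measurable_const (fun _ => hg) measurable_const
  simp only [one_mul, mul_one, lintegral_const, measure_univ] at h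
  have e : ∀ ω, ENNReal.ofReal (Real.exp (β * (1 - g) * (L ω t - L ω s)))
      = ENNReal.ofReal (Real.exp (-(α * ((t : ℝ) - s) * Real.log g)))
        * ENNReal.ofReal (stepDensity α β L s t (fun _ => g) ω) := fun ω => by
    rw [← ENNReal.ofReal_mul (Real.exp_pos _).le, stepDensity, ← Real.exp_add]
    ring_nf
  rw [lintegral_congr e, lintegral_const_mul' _ _ ENNReal.ofReal_ne_top, h, mul_one]

end Step

/-! ### Change of measure for predictable coefficients -/

/-- The dyadic points `T i / 2 ^ n`. -/
noncomputable def grid (T : ℝ≥0) (n i : ℕ) : ℝ≥0 := T * i / 2 ^ n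

theorem grid_zero (T : ℝ≥0) (n : ℕ) : grid T n 0 = 0 := by simp [grid]

theorem grid_last (T : ℝ≥0) (n : ℕ) : grid T n (2 ^ n) = T := by
  simp [grid]

theorem grid_strictMono {T : ℝ≥0} (hT : 0 < T) (n : ℕ) : StrictMono (grid T n) := by
  intro i j hij
  unfold grid
  gcongr

theorem grid_le {T : ℝ≥0} {n i : ℕ} (h : i ≤ 2 ^ n) : grid T n i ≤ T := by
  refine (show grid T n i ≤ grid T n (2 ^ n) by unfold grid; gcongr).trans_eq (grid_last T n)

theorem grid_refine (T : ℝ≥0) {m n : ℕ} (h : m ≤ n) (i : ℕ) :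
    grid T m i = grid T n (i * 2 ^ (n - m)) := by
  unfold grid
  have h2 : (2 : ℝ≥0) ^ n = 2 ^ (n - m) * 2 ^ m := by rw [← pow_add, Nat.sub_add_cancel h]
  rw [h2]
  push_cast
  have h3 : (2 : ℝ≥0) ^ (n - m) ≠ 0 := by positivity
  field_simp

/-- The index of the dyadic interval `(T i / 2 ^ n, T (i + 1) / 2 ^ n]` containing `s`. -/
noncomputable def gridIndex (T : ℝ≥0) (n : ℕ) (s : ℝ≥0) : ℕ := ⌈s * 2 ^ n / T⌉₊ - 1

theorem measurable_gridIndex (T : ℝ≥0) (n : ℕ) : Measurable (gridIndex T n) := by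
  have : Measurable fun s : ℝ≥0 => ⌈s * 2 ^ n / T⌉₊ := Nat.measurable_ceil.comp (by fun_prop)
  exact (measurable_from_top (f := fun k : ℕ => k - 1)).comp this

theorem gridIndex_eq {T : ℝ≥0} (hT : 0 < T) {n i : ℕ} {s : ℝ≥0}
    (hs : s ∈ Ioc (grid T n i) (grid T n (i + 1))) : gridIndex T n s = i := by
  have h : ⌈s * 2 ^ n / T⌉₊ = i + 1 := by
    rw [Nat.ceil_eq_iff (Nat.succ_ne_zero i)]
    obtain ⟨h1, h2⟩ := hs
    unfold grid at h1 h2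
    rw [div_lt_iff₀ (by positivity)] at h1
    rw [le_div_iff₀ (by positivity)] at h2
    constructor
    · rw [lt_div_iff₀ hT]; simpa [mul_comm] using h1
    · rw [div_le_iff₀ hT, mul_comm _ T]; exact_mod_cast h2
  rw [gridIndex, h, Nat.add_sub_cancel]

theorem grid_gridIndex_lt {T : ℝ≥0} (hT : 0 < T) (n : ℕ) {s : ℝ≥0} (hs : 0 < s) :
    grid T n (gridIndex T n s) < s ∧ s ≤ grid T n (gridIndex T n s) + T * (1 / 2) ^ n := by
  have hpos : 0 < ⌈s * 2 ^ n / T⌉₊ := Nat.ceil_pos.2 (by positivity)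
  obtain ⟨k, hk⟩ := Nat.exists_eq_succ_of_ne_zero hpos.ne'
  have hki : gridIndex T n s = k := by rw [gridIndex, hk]; rfl
  obtain ⟨h1, h2⟩ := (Nat.ceil_eq_iff (Nat.succ_ne_zero k)).1 hk
  rw [hki]
  unfold grid
  constructor
  · rw [div_lt_iff₀ (by positivity)]
    rw [lt_div_iff₀ hT] at h1
    simpa [mul_comm] using h1
  · rw [div_le_iff₀ hT] at h2
    have e : T * (k : ℝ≥0) / 2 ^ n + T * (1 / 2) ^ n = T * ((k.succ : ℕ) : ℝ≥0) / 2 ^ n := by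
      push_cast
      rw [one_div, inv_pow]
      field_simp
    rw [e, le_div_iff₀ (by positivity), mul_comm T]
    exact h2

theorem tendsto_grid_gridIndex {T : ℝ≥0} (hT : 0 < T) {s : ℝ≥0} (hs : 0 < s) :
    Tendsto (fun n => grid T n (gridIndex T n s)) atTop (𝓝[<] s) := by
  refine tendsto_nhdsWithin_iff.2 ⟨?_, Eventually.of_forall fun n => (grid_gridIndex_lt hT n hs).1⟩
  have h0 : Tendsto (fun n : ℕ => (1 / 2 : ℝ≥0) ^ n) atTop (𝓝 0) :=
    NNReal.tendsto_pow_atTop_nhds_zero_of_lt_one (by rw [← NNReal.coe_lt_coe]; norm_num)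
  have h1 : Tendsto (fun n : ℕ => s - T * (1 / 2 : ℝ≥0) ^ n) atTop (𝓝 s) := by
    simpa using (h0.const_mul T).const_sub s
  exact tendsto_of_tendsto_of_tendsto_of_le_of_le h1 tendsto_const_nhds
    (fun n => tsub_le_iff_right.2 (grid_gridIndex_lt hT n hs).2)
    (fun n => (grid_gridIndex_lt hT n hs).1.le)

theorem setIntegral_gridIndex {T : ℝ≥0} (hT : 0 < T) (n : ℕ) (μ : Measure ℝ≥0)
    (hμ : ∀ s t, μ (Ioc s t) < ∞) (φ : ℕ → ℝ) (j : ℕ) :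
    IntegrableOn (fun s => φ (gridIndex T n s)) (Ioc 0 (grid T n j)) μ ∧
    ∫ s in Ioc 0 (grid T n j), φ (gridIndex T n s) ∂μ
      = ∑ i ∈ Finset.range j, φ i * μ.real (Ioc (grid T n i) (grid T n (i + 1))) := by
  induction j with
  | zero => simp [grid_zero]
  | succ j ih =>
    have hle : grid T n j ≤ grid T n (j + 1) := (grid_strictMono hT n).monotone j.le_succ
    have hcongr : EqOn (fun s => φ (gridIndex T n s)) (fun _ => φ j)
        (Ioc (grid T n j) (grid T n (j + 1))) := fun s hs => by
      simp only [gridIndex_eq hT hs]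
    have hint : IntegrableOn (fun s => φ (gridIndex T n s))
        (Ioc (grid T n j) (grid T n (j + 1))) μ :=
      (integrableOn_const (hμ _ _).ne).congr_fun hcongr.symm measurableSet_Ioc
    rw [← Ioc_union_Ioc_eq_Ioc (zero_le (a := grid T n j)) hle]
    refine ⟨ih.1.union hint, ?_⟩
    rw [setIntegral_union (Ioc_disjoint_Ioc_of_le le_rfl) measurableSet_Ioc ih.1 hint, ih.2,
      Finset.sum_range_succ, setIntegral_congr_fun measurableSet_Ioc hcongr, setIntegral_const,
      smul_eq_mul, mul_comm]

/-! ### From step coefficients to continuous functions of the left limit -/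

section Tilting

variable {Ω : Type*} {m : MeasurableSpace Ω}

/-- The density `exp (∫ β (1 - G) dL + ∫ α log G dt)` over `(0, T]`. -/
noncomputable def tilt (α β : ℝ) (L : Ω → Path) (T : ℝ≥0) (G : Ω → ℝ≥0 → ℝ) (ω : Ω) : ℝ :=
  Real.exp ((∫ s in Ioc 0 T, β * (1 - G ω s) ∂(L ω).stieltjes)
    + ∫ s in Ioc 0 T, α * Real.log (G ω s) ∂lebesgueTime)

/-- The pathwise integral `∫ G dL` over `(0, t]`. -/
noncomputable def pathInt (L : Ω → Path) (G : Ω → ℝ≥0 → ℝ) (ω : Ω) (t : ℝ≥0) : ℝ :=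
  ∫ s in Ioc 0 t, G ω s ∂(L ω).stieltjes

/-- After the change of measure with density `tilt`, the process `∫ G dL` has the law of `L` on the
dyadic grid of level `k`. -/
def IsTilting (α β : ℝ) (P : Measure Ω) (L : Ω → Path) (T : ℝ≥0) (k : ℕ) (G : Ω → ℝ≥0 → ℝ) :
    Prop :=
  ∀ Φ : BoundedContinuousFunction (Fin (2 ^ k) → ℝ) ℝ≥0,
    ∫⁻ ω, ENNReal.ofReal (tilt α β L T G ω)
        * (Φ fun i => pathInt L G ω (grid T k (i + 1)) : ℝ≥0) ∂P
      = ∫⁻ ω, (Φ fun i => L ω (grid T k (i + 1)) : ℝ≥0) ∂P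

variable {α β : ℝ} {𝔽 : Filtration ℝ≥0 m} {P : Measure Ω} {L : Ω → Path} {T : ℝ≥0}

theorem sum_fin_ite_lt {N J : ℕ} (h : J ≤ N) (a : ℕ → ℝ) :
    (∑ i : Fin N, if (i : ℕ) < J then a i else 0) = ∑ i ∈ Finset.range J, a i := by
  rw [← Finset.sum_range (fun i => if i < J then a i else 0), ← Finset.sum_filter]
  congr 1
  ext i
  simp only [Finset.mem_filter, Finset.mem_range]
  omega

theorem real_stieltjes_Ioc (x : Path) {s t : ℝ≥0} (h : s ≤ t) :
    x.stieltjes.real (Ioc s t) = x t - x s := by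
  rw [Measure.real, x.stieltjes_Ioc, ENNReal.toReal_ofReal (sub_nonneg.2 (x.mono h))]

theorem real_lebesgueTime_Ioc {s t : ℝ≥0} (h : s ≤ t) :
    lebesgueTime.real (Ioc s t) = (t : ℝ) - s := by
  rw [Measure.real, lebesgueTime_Ioc, ENNReal.toReal_ofReal (sub_nonneg.2 (NNReal.coe_le_coe.2 h))]

/-- For a coefficient constant on cells of level $n$, the density factors over the cells and $\int
G\,dL$ at grid points is a partial sum of the scaled increments. -/
theorem isTilting_step [IsProbabilityMeasure P] (hα : 0 < α) (hβ : 0 < β)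
    (hL : IsGammaProcess α β 𝔽 P L) (hT : 0 < T) {k n : ℕ} (hkn : k ≤ n) {g : ℕ → Ω → ℝ}
    (hg : ∀ i, Measurable[𝔽 (grid T n i)] (g i)) (hpos : ∀ i ω, 0 < g i ω) :
    IsTilting α β P L T k (fun ω s => g (gridIndex T n s) ω) := by
  intro Φ
  have hmono := (grid_strictMono hT n).monotone
  have hfinL : ∀ ω (s t : ℝ≥0), (L ω).stieltjes (Ioc s t) < ∞ := fun ω =>
    (L ω).stieltjes_Ioc_lt_top
  have hfinl : ∀ s t : ℝ≥0, lebesgueTime (Ioc s t) < ∞ := fun s t => by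
    rw [lebesgueTime_Ioc]; exact ENNReal.ofReal_lt_top
  have hD : ∀ ω, ENNReal.ofReal (tilt α β L T (fun ω s => g (gridIndex T n s) ω) ω)
      = ∏ i ∈ Finset.range (2 ^ n),
        ENNReal.ofReal (stepDensity α β L (grid T n i) (grid T n (i + 1)) (g i) ω) := by
    intro ω
    refine Eq.trans ?_ (ENNReal.ofReal_prod_of_nonneg fun i _ => (Real.exp_pos _).le)
    unfold stepDensity tilt
    rw [← Real.exp_sum]
    congr 2
    have h1 := (setIntegral_gridIndex hT n (L ω).stieltjes (hfinL ω)
      (fun i => β * (1 - g i ω)) (2 ^ n)).2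
    have h2 := (setIntegral_gridIndex hT n lebesgueTime hfinl
      (fun i => α * Real.log (g i ω)) (2 ^ n)).2
    rw [grid_last] at h1 h2
    rw [h1, h2, ← Finset.sum_add_distrib]
    refine Finset.sum_congr rfl fun i _ => ?_
    rw [real_stieltjes_Ioc _ (hmono i.le_succ), real_lebesgueTime_Ioc (hmono i.le_succ)]
    ring
  -- The number of level-$n$ cells to the left of the grid point of level $k$ with index $i+1$.
  set J : Fin (2 ^ k) → ℕ := fun i => (i + 1) * 2 ^ (n - k) with hJ
  have hJle : ∀ i, J i ≤ 2 ^ n := fun i => by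
    have h1 : (i : ℕ) + 1 ≤ 2 ^ k := i.2
    calc J i ≤ 2 ^ k * 2 ^ (n - k) := Nat.mul_le_mul_right _ h1
      _ = 2 ^ n := by rw [← pow_add, Nat.add_sub_cancel' hkn]
  let F : (Fin (2 ^ n) → ℝ) → ℝ≥0∞ := fun v =>
    (Φ fun i => ∑ l : Fin (2 ^ n), if (l : ℕ) < J i then v l else 0 : ℝ≥0)
  have hF : Measurable F := by
    refine measurable_coe_nnreal_ennreal.comp (Φ.continuous.measurable.comp
      (measurable_pi_lambda _ fun i => Finset.measurable_sum _ fun l _ => ?_))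
    split_ifs
    · exact measurable_pi_apply l
    · exact measurable_const
  have hV : ∀ ω, (Φ fun i => pathInt L (fun ω s => g (gridIndex T n s) ω) ω (grid T k (i + 1)) :
      ℝ≥0) = F fun i => g i ω * (L ω (grid T n (i + 1)) - L ω (grid T n i)) := by
    intro ω
    simp only [F]
    congr 3 with i
    rw [sum_fin_ite_lt (hJle i) fun l => g l ω * (L ω (grid T n (l + 1)) - L ω (grid T n l)),
      grid_refine T hkn, pathInt,
      (setIntegral_gridIndex hT n (L ω).stieltjes (hfinL ω) (fun i => g i ω) _).2]
    refine Finset.sum_congr rfl fun l _ => ?_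
    rw [real_stieltjes_Ioc _ (hmono l.le_succ)]
  have hU : ∀ ω, (Φ fun i => L ω (grid T k (i + 1)) : ℝ≥0)
      = F fun i => L ω (grid T n (i + 1)) - L ω (grid T n i) := by
    intro ω
    simp only [F]
    congr 3 with i
    rw [sum_fin_ite_lt (hJle i) fun l => L ω (grid T n (l + 1)) - L ω (grid T n l),
      Finset.sum_range_sub (fun l => L ω (grid T n l)), grid_refine T hkn, grid_zero,
      Path.map_zero, sub_zero]
  simp only [hD, hV, hU]
  exact lintegral_step_eq hα hβ hL (grid_strictMono hT n) hg hpos (2 ^ n) hF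

variable {c C : ℝ}

theorem abs_log_sub_log_le {a b c : ℝ} (hc : 0 < c) (ha : c ≤ a) (hb : c ≤ b) :
    |Real.log a - Real.log b| ≤ c⁻¹ * |a - b| := by
  have key : ∀ {a b : ℝ}, c ≤ a → c ≤ b → Real.log a - Real.log b ≤ c⁻¹ * |a - b| := by
    intro a b ha hb
    have ha' := hc.trans_le ha
    have hb' := hc.trans_le hb
    rw [← Real.log_div ha'.ne' hb'.ne']
    refine (Real.log_le_sub_one_of_pos (div_pos ha' hb')).trans ?_
    have e : a / b - 1 = b⁻¹ * (a - b) := by field_simp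
    rw [e]
    calc b⁻¹ * (a - b) ≤ b⁻¹ * |a - b| := by gcongr; exact le_abs_self _
      _ ≤ c⁻¹ * |a - b| := by gcongr
  rw [abs_le]
  constructor
  · have := key hb ha
    rw [abs_sub_comm] at this
    linarith
  · exact key ha hb

theorem integrableOn_of_mem_Icc {μ : Measure ℝ≥0} {A : Set ℝ≥0} [IsFiniteMeasure (μ.restrict A)]
    {G : ℝ≥0 → ℝ} (hG : Measurable G) (hcC : ∀ s, G s ∈ Icc c C) : IntegrableOn G A μ :=
  Integrable.of_bound hG.aestronglyMeasurable (max |c| |C|)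
    (ae_of_all _ fun s => abs_le_max_abs_abs (hcC s).1 (hcC s).2)

theorem integrableOn_log_of_mem_Icc {μ : Measure ℝ≥0} {A : Set ℝ≥0} [IsFiniteMeasure (μ.restrict A)]
    {G : ℝ≥0 → ℝ} (hc : 0 < c) (hG : Measurable G) (hcC : ∀ s, G s ∈ Icc c C) :
    IntegrableOn (fun s => Real.log (G s)) A μ :=
  integrableOn_of_mem_Icc (c := Real.log c) (C := Real.log C) (Real.measurable_log.comp hG) fun s =>
    ⟨Real.log_le_log hc (hcC s).1, Real.log_le_log (hc.trans_le (hcC s).1) (hcC s).2⟩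

theorem lintegral_exp_le [IsProbabilityMeasure P] (hα : 0 < α) (hβ : 0 < β)
    (hL : IsGammaProcess α β 𝔽 P L) (hT : 0 < T) (hc : 0 < c) (K : ℝ) :
    ∫⁻ ω, ENNReal.ofReal (Real.exp (β * (1 - c) * L ω T + K)) ∂P < ∞ := by
  have h := lintegral_exp_increment hα hβ hL hT hc
  have e : ∀ ω, ENNReal.ofReal (Real.exp (β * (1 - c) * L ω T + K))
      = ENNReal.ofReal (Real.exp K)
        * ENNReal.ofReal (Real.exp (β * (1 - c) * (L ω T - L ω 0))) := fun ω => by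
    rw [← ENNReal.ofReal_mul (Real.exp_pos _).le, ← Real.exp_add, Path.map_zero, sub_zero, add_comm]
  rw [lintegral_congr e, lintegral_const_mul' _ _ ENNReal.ofReal_ne_top, h]
  exact ENNReal.mul_lt_top ENNReal.ofReal_lt_top ENNReal.ofReal_lt_top

theorem tilt_le (hα : 0 < α) (hβ : 0 < β) (hc : 0 < c) {G : Ω → ℝ≥0 → ℝ}
    (hG : ∀ ω, Measurable (G ω)) (hcC : ∀ ω s, G ω s ∈ Icc c C) (ω : Ω) :
    tilt α β L T G ω ≤ Real.exp (β * (1 - c) * L ω T + α * Real.log C * T) := by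
  refine Real.exp_le_exp.2 (add_le_add ?_ ?_)
  · have h1 : ∫ s in Ioc 0 T, β * (1 - G ω s) ∂(L ω).stieltjes
        ≤ ∫ s in Ioc 0 T, β * (1 - c) ∂(L ω).stieltjes := by
      refine integral_mono (((integrable_const _).sub
        (integrableOn_of_mem_Icc (hG ω) (hcC ω))).const_mul β) (integrable_const _) fun s => ?_
      have := (hcC ω s).1
      simp only
      gcongr
    rw [setIntegral_const, real_stieltjes_Ioc _ (zero_le (a := T)), Path.map_zero, sub_zero,
      smul_eq_mul, mul_comm] at h1
    exact h1
  · have h1 : ∫ s in Ioc 0 T, α * Real.log (G ω s) ∂lebesgueTime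
        ≤ ∫ s in Ioc 0 T, α * Real.log C ∂lebesgueTime := by
      refine integral_mono ((integrableOn_log_of_mem_Icc hc (hG ω) (hcC ω)).const_mul α)
        (integrable_const _) fun s => ?_
      have := Real.log_le_log (hc.trans_le (hcC ω s).1) (hcC ω s).2
      simp only
      gcongr
    rw [setIntegral_const, real_lebesgueTime_Ioc (zero_le (a := T)),
      smul_eq_mul, mul_comm] at h1
    simpa using h1

theorem measurable_pathInt {t : ℝ≥0} (hL : ∀ s ≤ t, Measurable fun ω => L ω s) {G : Ω → ℝ≥0 → ℝ}
    (hG : Measurable (Function.uncurry G)) : Measurable fun ω => pathInt L G ω t :=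
  measurable_setIntegral_stieltjes hL hG

theorem measurable_tilt (hL : ∀ s ≤ T, Measurable fun ω => L ω s) {G : Ω → ℝ≥0 → ℝ}
    (hG : Measurable (Function.uncurry G)) : Measurable (tilt α β L T G) :=
  Real.measurable_exp.comp (Measurable.add
    (measurable_setIntegral_stieltjes hL (f := fun ω s => β * (1 - G ω s))
      ((hG.const_sub 1).const_mul β))
    (measurable_setIntegral_lebesgueTime (f := fun ω s => α * Real.log (G ω s))
      ((Real.measurable_log.comp hG).const_mul α)))

theorem tendsto_pathInt {G : ℕ → Ω → ℝ≥0 → ℝ} {H : Ω → ℝ≥0 → ℝ} {ω : Ω}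
    (hG : ∀ n, Measurable (G n ω)) (hH : Measurable (H ω)) (hcC : ∀ n s, G n ω s ∈ Icc c C)
    (hlim : Tendsto (fun n => ∫⁻ s in Ioc 0 T, ‖G n ω s - H ω s‖ₑ ∂(L ω).stieltjes) atTop (𝓝 0))
    {t : ℝ≥0} (ht : t ≤ T) :
    Tendsto (fun n => pathInt L (G n) ω t) atTop (𝓝 (pathInt L H ω t)) := by
  refine tendsto_integral_of_L1 _ hH.aestronglyMeasurable
    (Eventually.of_forall fun n => integrableOn_of_mem_Icc (hG n) (hcC n)) ?_
  exact tendsto_of_tendsto_of_tendsto_of_le_of_le tendsto_const_nhds hlim (fun _ => zero_le)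
    fun n => lintegral_mono_set (Ioc_subset_Ioc_right ht)

theorem tendsto_tilt {G : ℕ → Ω → ℝ≥0 → ℝ} {H : Ω → ℝ≥0 → ℝ} {ω : Ω} (hc : 0 < c)
    (hG : ∀ n, Measurable (G n ω)) (hH : Measurable (H ω)) (hcC : ∀ n s, G n ω s ∈ Icc c C)
    (hHC : ∀ s, H ω s ∈ Icc c C)
    (hlim : Tendsto (fun n => ∫⁻ s in Ioc 0 T, ‖G n ω s - H ω s‖ₑ ∂(L ω).stieltjes) atTop (𝓝 0))
    (hlim' : Tendsto (fun n => ∫⁻ s in Ioc 0 T, ‖G n ω s - H ω s‖ₑ ∂lebesgueTime) atTop (𝓝 0)) :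
    Tendsto (fun n => tilt α β L T (G n) ω) atTop (𝓝 (tilt α β L T H ω)) := by
  refine (Real.continuous_exp.tendsto _).comp (Tendsto.add ?_ ?_)
  · simp only [integral_const_mul]
    refine Tendsto.const_mul β ?_
    have e : ∀ {K : ℝ≥0 → ℝ}, IntegrableOn K (Ioc 0 T) (L ω).stieltjes →
        ∫ s in Ioc 0 T, (1 - K s) ∂(L ω).stieltjes
          = (∫ _ in Ioc 0 T, (1 : ℝ) ∂(L ω).stieltjes) - ∫ s in Ioc 0 T, K s ∂(L ω).stieltjes :=
      fun hK => integral_sub (integrable_const _) hK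
    rw [e (integrableOn_of_mem_Icc hH hHC)]
    simp only [fun n => e (integrableOn_of_mem_Icc (μ := (L ω).stieltjes) (A := Ioc 0 T)
      (hG n) (hcC n))]
    exact (tendsto_pathInt hG hH hcC hlim le_rfl).const_sub _
  · simp only [integral_const_mul]
    refine Tendsto.const_mul α (tendsto_integral_of_L1 _
      (Real.measurable_log.comp hH).aestronglyMeasurable
      (Eventually.of_forall fun n => integrableOn_log_of_mem_Icc hc (hG n) (hcC n)) ?_)
    have h0 : Tendsto (fun n => ENNReal.ofReal c⁻¹
        * ∫⁻ s in Ioc 0 T, ‖G n ω s - H ω s‖ₑ ∂lebesgueTime) atTop (𝓝 0) := by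
      simpa using ENNReal.Tendsto.const_mul hlim' (Or.inr ENNReal.ofReal_ne_top)
    refine tendsto_of_tendsto_of_tendsto_of_le_of_le tendsto_const_nhds h0 (fun _ => zero_le)
      fun n => ?_
    simp only
    rw [← lintegral_const_mul' _ _ ENNReal.ofReal_ne_top]
    refine lintegral_mono fun s => ?_
    rw [← ofReal_norm, ← ofReal_norm, ← ENNReal.ofReal_mul (by positivity)]
    exact ENNReal.ofReal_le_ofReal (abs_log_sub_log_le hc (hcC n s).1 (hHC s).1)

/-- Pathwise $L^1$ convergence of the coefficients gives convergence of the densities and the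
integrals. The lower bound $c>0$ dominates all densities by $e^{\beta(1-c)L_T}$ times a constant;
bounded continuous test functions let the limit pass through $\Phi$. -/
theorem IsTilting.of_tendsto [IsProbabilityMeasure P] (hα : 0 < α) (hβ : 0 < β)
    (hL : IsGammaProcess α β 𝔽 P L) (hT : 0 < T) (hc : 0 < c) {k : ℕ}
    {G : ℕ → Ω → ℝ≥0 → ℝ} {H : Ω → ℝ≥0 → ℝ}
    (hG : ∀ n, Measurable (Function.uncurry (G n))) (hH : Measurable (Function.uncurry H))
    (hcC : ∀ n ω s, G n ω s ∈ Icc c C) (hHC : ∀ ω s, H ω s ∈ Icc c C)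
    (hlim : ∀ᵐ ω ∂P,
      Tendsto (fun n => ∫⁻ s in Ioc 0 T, ‖G n ω s - H ω s‖ₑ ∂(L ω).stieltjes) atTop (𝓝 0) ∧
      Tendsto (fun n => ∫⁻ s in Ioc 0 T, ‖G n ω s - H ω s‖ₑ ∂lebesgueTime) atTop (𝓝 0))
    (htilt : ∀ᶠ n in atTop, IsTilting α β P L T k (G n)) : IsTilting α β P L T k H := by
  intro Φ
  have hGs : ∀ n ω, Measurable (G n ω) := fun n ω => (hG n).of_uncurry_left
  have hHs : ∀ ω, Measurable (H ω) := fun ω => hH.of_uncurry_left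
  have hLm : ∀ s : ℝ≥0, Measurable fun ω => L ω s := hL.measurable
  have hlast : ∀ i : Fin (2 ^ k), grid T k (i + 1) ≤ T := fun i => grid_le i.2
  refine tendsto_nhds_unique (f := fun n => ∫⁻ ω, ENNReal.ofReal (tilt α β L T (G n) ω)
        * (Φ fun i => pathInt L (G n) ω (grid T k (i + 1)) : ℝ≥0) ∂P) (l := atTop) ?_
    (tendsto_const_nhds.congr' (htilt.mono fun n hn => (hn Φ).symm))
  set M : ℝ≥0 := nndist Φ 0 with hM
  refine tendsto_lintegral_of_dominated_convergence
    (fun ω => ENNReal.ofReal (Real.exp (β * (1 - c) * L ω T + α * Real.log C * T)) * M)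
    (fun n => ?_) (fun n => ae_of_all _ fun ω => ?_) ?_ ?_
  · refine (measurable_tilt (fun s _ => hLm s) (hG n)).ennreal_ofReal.mul
      (measurable_coe_nnreal_ennreal.comp (Φ.continuous.measurable.comp
        (measurable_pi_lambda _ fun i => measurable_pathInt (fun s _ => hLm s) (hG n))))
  · refine mul_le_mul' (ENNReal.ofReal_le_ofReal (tilt_le hα hβ hc (hGs n) (hcC n) ω)) ?_
    exact ENNReal.coe_le_coe.2 (BoundedContinuousFunction.NNReal.upper_bound Φ _)
  · rw [lintegral_mul_const' _ _ ENNReal.coe_ne_top]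
    exact (ENNReal.mul_lt_top (lintegral_exp_le hα hβ hL hT hc _) ENNReal.coe_lt_top).ne
  · filter_upwards [hlim] with ω hω
    refine ENNReal.Tendsto.mul (ENNReal.tendsto_ofReal (tendsto_tilt hc (fun n => hGs n ω) (hHs ω)
      (fun n => hcC n ω) (hHC ω) hω.1 hω.2)) (Or.inr ENNReal.coe_ne_top)
      (ENNReal.tendsto_coe.2 ((Φ.continuous.tendsto _).comp (tendsto_pi_nhds.2 fun i => ?_)))
      (Or.inr ENNReal.ofReal_ne_top)
    exact tendsto_pathInt (fun n => hGs n ω) (hHs ω) (fun n => hcC n ω) hω.1 (hlast i)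

theorem tendsto_setLIntegral_of_tendsto {μ : Measure ℝ≥0} [IsFiniteMeasure (μ.restrict (Ioc 0 T))]
    {G : ℕ → ℝ≥0 → ℝ} {H : ℝ≥0 → ℝ} (hG : ∀ n, Measurable (G n)) (hH : Measurable H)
    (hcC : ∀ n s, G n s ∈ Icc c C) (hHC : ∀ s, H s ∈ Icc c C)
    (hlim : ∀ s ∈ Ioc 0 T, Tendsto (fun n => G n s) atTop (𝓝 (H s))) :
    Tendsto (fun n => ∫⁻ s in Ioc 0 T, ‖G n s - H s‖ₑ ∂μ) atTop (𝓝 0) := by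
  have h := tendsto_lintegral_of_dominated_convergence (μ := μ.restrict (Ioc 0 T))
    (F := fun n s => ‖G n s - H s‖ₑ) (f := fun _ => 0) (fun _ => ENNReal.ofReal (C - c))
    (fun n => ((hG n).sub hH).enorm) (fun n => ae_of_all _ fun s => ?_) ?_ ?_
  · simpa using h
  · simp only
    rw [← ofReal_norm]
    refine ENNReal.ofReal_le_ofReal ?_
    rw [Real.norm_eq_abs, abs_le]
    have h1 := hcC n s
    have h2 := hHC s
    constructor <;> linarith [h1.1, h1.2, h2.1, h2.2]
  · rw [lintegral_const]
    exact ENNReal.mul_ne_top ENNReal.ofReal_ne_top (measure_ne_top _ _)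
  · filter_upwards [ae_restrict_mem measurableSet_Ioc] with s hs
    have := ((hlim s hs).sub_const (H s)).enorm
    simpa using this

variable {X : Ω → Path}

/-- On each cell the coefficient is frozen at the left endpoint, where it is known. The endpoints
approach $s$ strictly from below, so the limit is $g(X_{s-})$. -/
theorem isTilting_continuous [IsProbabilityMeasure P] (hα : 0 < α) (hβ : 0 < β)
    (hL : IsGammaProcess α β 𝔽 P L) (hX : ∀ t : ℝ≥0, Measurable[𝔽 t] fun ω => X ω t) (hT : 0 < T)
    (hc : 0 < c) {g : ℝ → ℝ} (hg : Continuous g) (hgC : ∀ y, g y ∈ Icc c C) (k : ℕ) :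
    IsTilting α β P L T k fun ω s => g ((X ω).left (min s T)) := by
  have hXm : ∀ t : ℝ≥0, Measurable fun ω => X ω t := fun t => (hX t).mono (𝔽.le t) le_rfl
  let G : ℕ → Ω → ℝ≥0 → ℝ := fun n ω s => g (X ω (grid T n (gridIndex T n s)))
  have hG : ∀ n, Measurable (Function.uncurry (G n)) := by
    intro n
    have h1 : Measurable fun q : Ω × ℕ => g (X q.1 (grid T n q.2)) :=
      measurable_from_prod_countable_left fun i => hg.measurable.comp (hXm (grid T n i))
    exact h1.comp (measurable_fst.prodMk ((measurable_gridIndex T n).comp measurable_snd))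
  have hH : Measurable (Function.uncurry fun ω s => g ((X ω).left (min s T))) :=
    hg.measurable.comp (measurable_left_min fun t _ => hXm t)
  have hpt : ∀ ω, ∀ s ∈ Ioc 0 T, Tendsto (fun n => G n ω s) atTop (𝓝 (g ((X ω).left (min s T)))) :=
    fun ω s hs => by
      rw [min_eq_left hs.2]
      exact (hg.tendsto _).comp (((X ω).tendsto_left s).comp (tendsto_grid_gridIndex hT hs.1))
  refine IsTilting.of_tendsto hα hβ hL hT hc hG hH (fun _ _ _ => hgC _) (fun _ _ => hgC _)
    (ae_of_all _ fun ω => ⟨?_, ?_⟩) ?_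
  · exact tendsto_setLIntegral_of_tendsto (fun n => (hG n).of_uncurry_left) hH.of_uncurry_left
      (fun _ _ => hgC _) (fun _ => hgC _) (hpt ω)
  · exact tendsto_setLIntegral_of_tendsto (fun n => (hG n).of_uncurry_left) hH.of_uncurry_left
      (fun _ _ => hgC _) (fun _ => hgC _) (hpt ω)
  · filter_upwards [eventually_ge_atTop k] with n hn
    exact isTilting_step hα hβ hL hT hn (g := fun i ω => g (X ω (grid T n i)))
      (fun i => hg.measurable.comp (hX _)) (fun i ω => hc.trans_le (hgC _).1)

end Tilting

/-! ### Bounded measurable coefficients -/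

theorem ae_tendsto_zero_of_tsum_lintegral {Ω : Type*} {m : MeasurableSpace Ω} {P : Measure Ω}
    {f : ℕ → Ω → ℝ≥0∞} (hf : ∀ n, Measurable (f n)) {ε : ℕ → ℝ≥0∞} (hε : ∑' n, ε n ≠ ∞)
    (h : ∀ n, ∫⁻ ω, f n ω ∂P ≤ ε n) : ∀ᵐ ω ∂P, Tendsto (fun n => f n ω) atTop (𝓝 0) := by
  have h1 : ∫⁻ ω, ∑' n, f n ω ∂P ≠ ∞ := by
    rw [lintegral_tsum fun n => (hf n).aemeasurable]
    exact ne_top_of_le_ne_top hε (ENNReal.tsum_le_tsum h)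
  filter_upwards [ae_lt_top (Measurable.tsum hf) h1] with ω hω
  exact ENNReal.tendsto_atTop_zero_of_tsum_ne_top hω.ne

section

variable {Ω : Type*} {m : MeasurableSpace Ω} {α β : ℝ} {𝔽 : Filtration ℝ≥0 m} {P : Measure Ω}
  {L X : Ω → Path} {T : ℝ≥0} {c C : ℝ}

theorem lintegral_gamma_lt_top [IsProbabilityMeasure P] (hα : 0 < α) (hβ : 0 < β)
    (hL : IsGammaProcess α β 𝔽 P L) (hT : 0 < T) : ∫⁻ ω, ENNReal.ofReal (L ω T) ∂P < ∞ := by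
  -- With $c=1/2$ the exponent is $\beta L_T/2$, and $y\le(2/\beta)e^{\beta y/2}$.
  have h := lintegral_exp_le hα hβ hL hT (c := 1 / 2) (by norm_num) 0
  refine lt_of_le_of_lt (b := ENNReal.ofReal (2 / β) * ∫⁻ ω, ENNReal.ofReal
    (Real.exp (β * (1 - 1 / 2) * L ω T + 0)) ∂P) ?_ (ENNReal.mul_lt_top ENNReal.ofReal_lt_top h)
  rw [← lintegral_const_mul' _ _ ENNReal.ofReal_ne_top]
  refine lintegral_mono fun ω => ?_
  rw [← ENNReal.ofReal_mul (by positivity)]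
  refine ENNReal.ofReal_le_ofReal ?_
  have h1 := Real.add_one_le_exp (β * (1 - 1 / 2) * L ω T + 0)
  calc L ω T = 2 / β * (β * (1 - 1 / 2) * L ω T + 0) := by field_simp; ring
    _ ≤ _ := by gcongr; linarith

/-- Bounded continuous functions are dense in $L^1(\mu)$. Clamping to $[c,C]$ is 1-Lipschitz and
fixes $g$, so the error does not grow. -/
theorem exists_continuous_approx (μ : Measure ℝ) [IsFiniteMeasure μ] {g : ℝ → ℝ}
    (hg : Measurable g) (hgC : ∀ y, g y ∈ Icc c C) {ε : ℝ≥0∞} (hε : ε ≠ 0) :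
    ∃ f : ℝ → ℝ, Continuous f ∧ (∀ y, f y ∈ Icc c C) ∧ ∫⁻ y, ‖f y - g y‖ₑ ∂μ ≤ ε := by
  have hcC : c ≤ C := (hgC 0).1.trans (hgC 0).2
  have hint : Integrable g μ := Integrable.of_bound hg.aestronglyMeasurable (max |c| |C|)
    (ae_of_all _ fun s => abs_le_max_abs_abs (hgC s).1 (hgC s).2)
  obtain ⟨f, hf, -⟩ := hint.exists_boundedContinuous_lintegral_sub_le hε
  refine ⟨fun y => max c (min C (f y)), by fun_prop, fun y => ⟨le_max_left _ _,
    max_le hcC (min_le_left _ _)⟩, (lintegral_mono fun y => ?_).trans hf⟩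
  rw [← ofReal_norm, ← ofReal_norm]
  refine ENNReal.ofReal_le_ofReal ?_
  have h1 := (hgC y).1
  have h2 := (hgC y).2
  have e : g y = max c (min C (g y)) := by rw [min_eq_right h2, max_eq_right h1]
  rw [norm_sub_rev (g y), Real.norm_eq_abs, Real.norm_eq_abs]
  conv_lhs => rw [e]
  calc |max c (min C (f y)) - max c (min C (g y))| ≤ |min C (f y) - min C (g y)| := by
        simpa using abs_max_sub_max_le_max c (min C (f y)) c (min C (g y))
    _ ≤ |f y - g y| := by simpa using abs_min_sub_min_le_max C (f y) C (g y)

theorem isTilting_measurable [IsProbabilityMeasure P] (hα : 0 < α) (hβ : 0 < β)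
    (hL : IsGammaProcess α β 𝔽 P L) (hX : ∀ t : ℝ≥0, Measurable[𝔽 t] fun ω => X ω t) (hT : 0 < T)
    (hc : 0 < c) {g : ℝ → ℝ} (hg : Measurable g) (hgC : ∀ y, g y ∈ Icc c C) (k : ℕ) :
    IsTilting α β P L T k fun ω s => g ((X ω).left (min s T)) := by
  have hXm : ∀ t ≤ T, Measurable fun ω => X ω t := fun t _ => (hX t).mono (𝔽.le t) le_rfl
  have hLm : ∀ t ≤ T, Measurable fun ω => L ω t := fun t _ => hL.measurable t
  have hleft := measurable_left_min hXm
  set M₁ : Measure (Ω × ℝ≥0) := P ⊗ₘ stieltjesKernel L T hLm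
  set M₂ : Measure (Ω × ℝ≥0) := P.prod (lebesgueTime.restrict (Ioc 0 T))
  have hfin : IsFiniteMeasure M₁ := ⟨by
    have e : M₁ univ = ∫⁻ ω, ENNReal.ofReal (L ω T) ∂P := by
      rw [Measure.compProd_apply MeasurableSet.univ]
      refine lintegral_congr fun ω => ?_
      change ((L ω).stieltjes.restrict (Ioc 0 T)) univ = _
      rw [Measure.restrict_apply_univ, Path.stieltjes_Ioc, Path.map_zero, sub_zero]
    exact e ▸ lintegral_gamma_lt_top hα hβ hL hT⟩
  -- The occupation measure of $X_-$ under $P\otimes(dL+dt)$, finite because $L_T$ is integrable.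
  -- Approximation in $L^1(\mu)$ with errors $2^{-n}$ yields almost sure convergence for $dL$ and
  -- $dt$ together.
  let μ : Measure ℝ := (M₁ + M₂).map fun p => (X p.1).left (min p.2 T)
  have hε : ∀ n : ℕ, ((1 / 2 : ℝ≥0∞) ^ n) ≠ 0 := fun n => by simp
  choose f hfc hfC hfμ using fun n : ℕ => exists_continuous_approx μ hg hgC (hε n)
  have hsum : ∑' n : ℕ, (1 / 2 : ℝ≥0∞) ^ n ≠ ∞ := by
    rw [ENNReal.tsum_geometric]
    norm_num
  have hm : ∀ n, Measurable fun y => ‖f n y - g y‖ₑ := fun n => ((hfc n).measurable.sub hg).enorm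
  have hbound : ∀ n, (∫⁻ p, ‖f n ((X p.1).left (min p.2 T)) - g ((X p.1).left (min p.2 T))‖ₑ ∂M₁)
      + ∫⁻ p, ‖f n ((X p.1).left (min p.2 T)) - g ((X p.1).left (min p.2 T))‖ₑ ∂M₂
        ≤ (1 / 2 : ℝ≥0∞) ^ n := fun n => by
    refine le_trans (le_of_eq ?_) (hfμ n)
    rw [lintegral_map (hm n) hleft, lintegral_add_measure]
  have hmc : ∀ n, Measurable fun p : Ω × ℝ≥0 =>
      ‖f n ((X p.1).left (min p.2 T)) - g ((X p.1).left (min p.2 T))‖ₑ := fun n =>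
    (hm n).comp hleft
  refine IsTilting.of_tendsto hα hβ hL hT hc
    (G := fun n ω s => f n ((X ω).left (min s T))) (fun n => (hfc n).measurable.comp hleft)
    (hg.comp hleft) (fun n _ _ => hfC n _) (fun _ _ => hgC _) ?_
    (Eventually.of_forall fun n => isTilting_continuous hα hβ hL hX hT hc (hfc n) (hfC n) k)
  refine Eventually.and ?_ ?_
  · refine ae_tendsto_zero_of_tsum_lintegral
      (fun n => measurable_setLIntegral_stieltjes hLm (hmc n)) hsum fun n => ?_
    refine le_trans (le_of_eq ?_) (le_self_add.trans (hbound n))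
    exact (Measure.lintegral_compProd (μ := P) (κ := stieltjesKernel L T hLm) (hmc n)).symm
  · refine ae_tendsto_zero_of_tsum_lintegral
      (fun n => (hmc n).lintegral_prod_right' (ν := lebesgueTime.restrict (Ioc 0 T))) hsum
      fun n => ?_
    refine le_trans (le_of_eq ?_) (le_add_self.trans (hbound n))
    exact (lintegral_prod _ (hmc n).aemeasurable).symm

end

/-! ### Localization -/

/-- The path `x` solves `dx = σ(x₋) dl`, `x 0 = 0`. -/
def IsPathSolution (σ : ℝ → ℝ) (x l : Path) : Prop :=
  ∀ t : ℝ≥0, IntegrableOn (fun s => σ (x.left s)) (Ioc 0 t) l.stieltjes ∧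
    x t = ∫ s in Ioc 0 t, σ (x.left s) ∂l.stieltjes

open Classical in
/-- The coefficient `σ` on `[0, b]`, and `1` elsewhere. -/
noncomputable def truncate (σ : ℝ → ℝ) (b y : ℝ) : ℝ := if y ∈ Icc 0 b then σ y else 1

section

variable {σ : ℝ → ℝ} {σ₀ : ℝ}

theorem measurable_truncate (hσ : Measurable σ) (b : ℝ) : Measurable (truncate σ b) :=
  Measurable.ite measurableSet_Icc hσ measurable_const

theorem truncate_of_mem {b y : ℝ} (hy : y ∈ Icc 0 b) : truncate σ b y = σ y := if_pos hy

theorem IsAdmissible.exists_truncate_mem (h : IsAdmissible σ σ₀) (b : ℝ) :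
    ∃ C, ∀ y, truncate σ b y ∈ Icc (min σ₀ 1) C := by
  obtain ⟨C, hC1, hC⟩ := h.exists_upper b
  refine ⟨C, fun y => ?_⟩
  unfold truncate
  split_ifs with hy
  · exact ⟨(min_le_left _ _).trans (h.lower y), hC y hy.1 hy.2⟩
  · exact ⟨min_le_right _ _, hC1⟩

theorem IsAdmissible.measurable_truncate_left (h : IsAdmissible σ σ₀) (b : ℝ) (x : Path)
    (T : ℝ≥0) : Measurable fun s => truncate σ b (x.left (min s T)) :=
  (measurable_truncate h.measurable b).comp
    (x.measurable_left.comp (measurable_id.min measurable_const))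

theorem Path.left_le_of_forall_lt (x : Path) {s : ℝ≥0} (hs : 0 < s) {b : ℝ}
    (h : ∀ r < s, x r ≤ b) : x.left s ≤ b := by
  have : Fact (0 < s) := ⟨hs⟩
  exact le_of_tendsto (x.tendsto_left s) (eventually_nhdsWithin_of_forall fun r hr => h r hr)

theorem Path.exists_passage (x : Path) {T : ℝ≥0} {b : ℝ} (h : b < x T) :
    ∃ τ ≤ T, b ≤ x τ ∧ ∀ r < τ, x r ≤ b := by
  have hne : {t | b < x t}.Nonempty := ⟨T, h⟩
  refine ⟨sInf {t | b < x t}, csInf_le' h, ?_, fun r hr => ?_⟩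
  · have e := x.1.iInf_Ioi_eq (sInf {t | b < x t})
    refine (le_ciInf fun r => ?_).trans e.le
    obtain ⟨t, ht, htr⟩ := exists_lt_of_csInf_lt hne r.2
    exact (le_of_lt ht).trans (x.mono htr.le)
  · exact not_lt.1 fun h' => notMem_of_lt_csInf' hr h'

/-- The integrand sees only left limits, so it suffices that $x\le b$ before $t$; the jump across
$b$ at time $t$ is still reproduced. -/
theorem setIntegral_truncate_eq {x l : Path} (hx : IsPathSolution σ x l) {b : ℝ} {t T : ℝ≥0}
    (ht : t ≤ T) (hb : ∀ r < t, x r ≤ b) :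
    ∫ s in Ioc 0 t, truncate σ b (x.left (min s T)) ∂l.stieltjes = x t := by
  rw [(hx t).2]
  refine setIntegral_congr_fun measurableSet_Ioc fun s hs => ?_
  rw [min_eq_left (hs.2.trans ht), truncate_of_mem]
  exact ⟨x.left_nonneg s, x.left_le_of_forall_lt hs.1 fun r hr => hb r (hr.trans_le hs.2)⟩

/-- Let $V$ be the truncated integral. If $x_T>b$, then $V$ equals $x$ at the first passage $\tau$,
where both are at least $b$. Since the coefficient is bounded below, $V_T\le b$ would force $dl=0$
on $(\tau,T]$, whence $x_T=x_\tau=V_\tau=V_T\le b$. So the localizing event can be read from $V$ or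
from $x$. -/
theorem setIntegral_truncate_le_iff (h : IsAdmissible σ σ₀) {x l : Path}
    (hx : IsPathSolution σ x l) (b : ℝ) (T : ℝ≥0) :
    ∫ s in Ioc 0 T, truncate σ b (x.left (min s T)) ∂l.stieltjes ≤ b ↔ x T ≤ b := by
  constructor
  · intro hV
    by_contra! hb
    obtain ⟨τ, hτT, hbτ, hτ⟩ := x.exists_passage hb
    obtain ⟨C, hC⟩ := h.exists_truncate_mem b
    have hc : 0 < min σ₀ 1 := lt_min h.lower_pos one_pos
    have hm := h.measurable_truncate_left b x T
    have hsub := setIntegral_Ioc_sub hτT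
      (integrableOn_of_mem_Icc (μ := l.stieltjes) (A := Ioc 0 T) hm fun s => hC _)
    rw [setIntegral_truncate_eq hx hτT hτ] at hsub
    have hlow : ∫ s in Ioc τ T, min σ₀ 1 ∂l.stieltjes
        ≤ ∫ s in Ioc τ T, truncate σ b (x.left (min s T)) ∂l.stieltjes :=
      integral_mono (integrable_const _)
        (integrableOn_of_mem_Icc (μ := l.stieltjes) hm fun s => hC _) fun s => (hC _).1
    rw [setIntegral_const, real_stieltjes_Ioc _ hτT, smul_eq_mul] at hlow
    have hl0 : l T - l τ ≤ 0 := by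
      by_contra! hpos
      have := mul_pos hpos hc
      linarith
    have hnull : l.stieltjes (Ioc τ T) = 0 := by
      rw [Path.stieltjes_Ioc, ENNReal.ofReal_eq_zero]; exact hl0
    have hxT := setIntegral_Ioc_sub hτT (hx T).1
    rw [← (hx T).2, ← (hx τ).2, setIntegral_measure_zero _ hnull] at hxT
    rw [setIntegral_measure_zero _ hnull] at hsub
    linarith
  · intro hb
    rw [setIntegral_truncate_eq hx le_rfl fun r hr => (x.mono hr.le).trans hb]
    exact hb

end

section

variable {Ω : Type*} {m : MeasurableSpace Ω} {α β : ℝ} {𝔽 : Filtration ℝ≥0 m} {P : Measure Ω}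
  {L X : Ω → Path} {T : ℝ≥0} {c C : ℝ} {σ : ℝ → ℝ} {σ₀ : ℝ}

theorem lintegral_tilt_lt_top [IsProbabilityMeasure P] (hα : 0 < α) (hβ : 0 < β)
    (hL : IsGammaProcess α β 𝔽 P L) (hT : 0 < T) (hc : 0 < c) {G : Ω → ℝ≥0 → ℝ}
    (hG : ∀ ω, Measurable (G ω)) (hcC : ∀ ω s, G ω s ∈ Icc c C) :
    ∫⁻ ω, ENNReal.ofReal (tilt α β L T G ω) ∂P < ∞ :=
  (lintegral_mono fun ω => ENNReal.ofReal_le_ofReal (tilt_le hα hβ hc hG hcC ω)).trans_lt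
    (lintegral_exp_le hα hβ hL hT hc _)

theorem IsTilting.map_eq [IsProbabilityMeasure P] (hα : 0 < α) (hβ : 0 < β)
    (hL : IsGammaProcess α β 𝔽 P L) (hT : 0 < T) (hc : 0 < c) {G : Ω → ℝ≥0 → ℝ}
    (hG : Measurable (Function.uncurry G)) (hcC : ∀ ω s, G ω s ∈ Icc c C) {k : ℕ}
    (h : IsTilting α β P L T k G) :
    (P.withDensity fun ω => ENNReal.ofReal (tilt α β L T G ω)).map
        (fun ω (i : Fin (2 ^ k)) => pathInt L G ω (grid T k (i + 1)))
      = P.map fun ω (i : Fin (2 ^ k)) => L ω (grid T k (i + 1)) := by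
  have hLm : ∀ t : ℝ≥0, Measurable fun ω => L ω t := hL.measurable
  have hV : Measurable fun ω (i : Fin (2 ^ k)) => pathInt L G ω (grid T k (i + 1)) :=
    measurable_pi_lambda _ fun i => measurable_pathInt (fun s _ => hLm s) hG
  have hU : Measurable fun ω (i : Fin (2 ^ k)) => L ω (grid T k (i + 1)) :=
    measurable_pi_lambda _ fun i => hLm _
  have hD : Measurable fun ω => ENNReal.ofReal (tilt α β L T G ω) :=
    (measurable_tilt (fun s _ => hLm s) hG).ennreal_ofReal
  have : IsFiniteMeasure (P.withDensity fun ω => ENNReal.ofReal (tilt α β L T G ω)) :=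
    isFiniteMeasure_withDensity
      (lintegral_tilt_lt_top hα hβ hL hT hc (fun ω => hG.of_uncurry_left) hcC).ne
  refine ext_of_forall_lintegral_eq_of_IsFiniteMeasure fun Φ => ?_
  have hΦ : Measurable fun v => (Φ v : ℝ≥0∞) :=
    measurable_coe_nnreal_ennreal.comp Φ.continuous.measurable
  rw [lintegral_map hΦ hV, lintegral_map hΦ hU]
  exact (lintegral_withDensity_eq_lintegral_mul _ hD (hΦ.comp hV)).trans (h Φ)

/-- Under the measure with density `tilt`, a solution `X` has the law of `L` on the dyadic grid. -/
theorem withDensity_tilt_map_eq [IsProbabilityMeasure P] (hα : 0 < α) (hβ : 0 < β)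
    (h : IsAdmissible σ σ₀) (hL : IsGammaProcess α β 𝔽 P L)
    (hX : ∀ t : ℝ≥0, Measurable[𝔽 t] fun ω => X ω t)
    (hsol : ∀ᵐ ω ∂P, IsPathSolution σ (X ω) (L ω)) (hT : 0 < T) (k : ℕ) :
    (P.withDensity fun ω => ENNReal.ofReal
        (tilt α β L T (fun ω s => σ ((X ω).left (min s T))) ω)).map
        (fun ω (i : Fin (2 ^ k)) => X ω (grid T k (i + 1)))
      = P.map fun ω (i : Fin (2 ^ k)) => L ω (grid T k (i + 1)) := by
  have hLm : ∀ t : ℝ≥0, Measurable fun ω => L ω t := hL.measurable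
  have hXm : ∀ t : ℝ≥0, Measurable fun ω => X ω t := fun t => (hX t).mono (𝔽.le t) le_rfl
  have hVm : Measurable fun ω (i : Fin (2 ^ k)) => X ω (grid T k (i + 1)) :=
    measurable_pi_lambda _ fun i => hXm _
  have hUm : Measurable fun ω (i : Fin (2 ^ k)) => L ω (grid T k (i + 1)) :=
    measurable_pi_lambda _ fun i => hLm _
  have hc : 0 < min σ₀ 1 := lt_min h.lower_pos one_pos
  have hleft := measurable_left_min (X := X) (T := T) fun t _ => hXm t
  set Q := P.withDensity fun ω => ENNReal.ofReal
        (tilt α β L T (fun ω s => σ ((X ω).left (min s T))) ω) with hQ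
  ext B hB
  rw [Measure.map_apply hVm hB, Measure.map_apply hUm hB]
  -- On $\{X_T\le n\}$ the truncated coefficient agrees with $\sigma$ along the path, so the bounded
  -- case applies there.
  have key : ∀ n : ℕ,
      Q ((fun ω (i : Fin (2 ^ k)) => X ω (grid T k (i + 1))) ⁻¹' B ∩ {ω | X ω T ≤ n})
      = P ((fun ω (i : Fin (2 ^ k)) => L ω (grid T k (i + 1))) ⁻¹' B ∩ {ω | L ω T ≤ n}) := by
    intro n
    obtain ⟨C, hC⟩ := h.exists_truncate_mem (n : ℝ)
    let G : Ω → ℝ≥0 → ℝ := fun ω s => truncate σ n ((X ω).left (min s T))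
    have hG : Measurable (Function.uncurry G) :=
      (measurable_truncate h.measurable n).comp hleft
    have hVG : Measurable fun ω (i : Fin (2 ^ k)) => pathInt L G ω (grid T k (i + 1)) :=
      measurable_pi_lambda _ fun i => measurable_pathInt (fun s _ => hLm s) hG
    have hmap := (isTilting_measurable hα hβ hL hX hT hc (measurable_truncate h.measurable n)
      hC k).map_eq hα hβ hL hT hc hG (fun _ _ => hC _)
    have hlast : 2 ^ k - 1 < 2 ^ k := Nat.sub_lt (by positivity) one_pos
    have hgl : grid T k (2 ^ k - 1 + 1) = T := by
      rw [Nat.sub_add_cancel Nat.one_le_two_pow, grid_last]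
    -- The last coordinate is the value at $T$, so the localizing event is itself a grid event.
    have hB' : MeasurableSet (B ∩ {v | v ⟨2 ^ k - 1, hlast⟩ ≤ n}) :=
      hB.inter (measurableSet_le (measurable_pi_apply _) measurable_const)
    have h1 := congrArg (fun μ => μ (B ∩ {v | v ⟨2 ^ k - 1, hlast⟩ ≤ n})) hmap
    beta_reduce at h1
    rw [Measure.map_apply hVG hB', Measure.map_apply hUm hB',
      withDensity_apply _ (hVG hB')] at h1
    have hS : MeasurableSet
        ((fun ω (i : Fin (2 ^ k)) => X ω (grid T k (i + 1))) ⁻¹' B ∩ {ω | X ω T ≤ n}) :=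
      (hVm hB).inter (measurableSet_le (hXm T) measurable_const)
    have h2 : (fun ω (i : Fin (2 ^ k)) => L ω (grid T k (i + 1))) ⁻¹'
        (B ∩ {v | v ⟨2 ^ k - 1, hlast⟩ ≤ n})
        = (fun ω (i : Fin (2 ^ k)) => L ω (grid T k (i + 1))) ⁻¹' B ∩ {ω | L ω T ≤ n} := by
      ext ω
      simp only [preimage_inter, mem_inter_iff, mem_preimage, mem_ofPred_eq, hgl]
    rw [h2] at h1
    rw [← h1, hQ, withDensity_apply _ hS, ← lintegral_indicator hS,
      ← lintegral_indicator (hVG hB')]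
    refine lintegral_congr_ae ?_
    filter_upwards [hsol] with ω hω
    have hiff := setIntegral_truncate_le_iff h hω n T
    by_cases hn : X ω T ≤ n
    · have hle : ∀ r < T, X ω r ≤ n := fun r hr => ((X ω).mono hr.le).trans hn
      have hVX : (fun i : Fin (2 ^ k) => pathInt L G ω (grid T k (i + 1)))
          = fun i : Fin (2 ^ k) => X ω (grid T k (i + 1)) := by
        funext i
        have hi : grid T k (i + 1) ≤ T := grid_le i.2
        exact setIntegral_truncate_eq hω hi fun r hr => hle r (hr.trans_le hi)
      have hGσ : ∀ s ∈ Ioc 0 T, G ω s = σ ((X ω).left (min s T)) := fun s hs =>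
        truncate_of_mem ⟨(X ω).left_nonneg _, by
          rw [min_eq_left hs.2]
          exact ((X ω).left_le s).trans (((X ω).mono hs.2).trans hn)⟩
      have htilt : tilt α β L T G ω = tilt α β L T (fun ω s => σ ((X ω).left (min s T))) ω := by
        unfold tilt
        congr 2
        · exact setIntegral_congr_fun measurableSet_Ioc fun s hs => by beta_reduce; rw [hGσ s hs]
        · exact setIntegral_congr_fun measurableSet_Ioc fun s hs => by beta_reduce; rw [hGσ s hs]
      have hmem : ω ∈ (fun ω (i : Fin (2 ^ k)) => pathInt L G ω (grid T k (i + 1))) ⁻¹'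
            (B ∩ {v | v ⟨2 ^ k - 1, hlast⟩ ≤ n}) ↔
          ω ∈ (fun ω (i : Fin (2 ^ k)) => X ω (grid T k (i + 1))) ⁻¹' B ∩ {ω | X ω T ≤ n} := by
        simp only [mem_preimage, mem_inter_iff, mem_ofPred_eq, hVX, hgl]
      by_cases hS : ω ∈ (fun ω (i : Fin (2 ^ k)) => X ω (grid T k (i + 1))) ⁻¹' B ∩ {ω | X ω T ≤ n}
      · rw [indicator_of_mem hS, indicator_of_mem (hmem.2 hS), htilt]
      · rw [indicator_of_notMem hS, indicator_of_notMem (mt hmem.1 hS)]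
    · rw [indicator_of_notMem fun hh => hn hh.2, indicator_of_notMem]
      rintro ⟨-, hh⟩
      simp only [mem_ofPred_eq, hgl] at hh
      exact hn (hiff.1 hh)
  -- Continuity from below on both sides; no integrability of the untruncated density is needed, its
  -- total mass one is part of the outcome.
  have hunion : ∀ (μ : Measure Ω) (Z : Ω → Path) (A : Set Ω),
      Tendsto (fun n : ℕ => μ (A ∩ {ω | Z ω T ≤ n})) atTop (𝓝 (μ A)) := by
    intro μ Z A
    have hmono : Monotone fun n : ℕ => A ∩ {ω | Z ω T ≤ n} := fun i j hij ω hω =>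
      ⟨hω.1, (show Z ω T ≤ i from hω.2).trans (Nat.cast_le.2 hij)⟩
    have e : ⋃ n : ℕ, A ∩ {ω | Z ω T ≤ n} = A := by
      rw [← inter_iUnion, inter_eq_left]
      intro ω _
      exact mem_iUnion.2 (exists_nat_ge (Z ω T))
    have := tendsto_measure_iUnion_atTop (μ := μ) hmono
    rwa [e] at this
  have hq := hunion Q X ((fun ω (i : Fin (2 ^ k)) => X ω (grid T k (i + 1))) ⁻¹' B)
  simp only [key] at hq
  exact tendsto_nhds_unique hq (hunion P L _)

end

/-! ### The gamma process is a pure jump process -/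

theorem grid_gridIndex_succ (T : ℝ≥0) (n : ℕ) (s : ℝ≥0) :
    grid T n (gridIndex T n s + 1) = grid T n (gridIndex T n s) + T * (1 / 2) ^ n := by
  unfold grid
  rw [one_div, inv_pow]
  push_cast
  field_simp

theorem tendsto_grid_gridIndex_succ {T : ℝ≥0} (hT : 0 < T) {s : ℝ≥0} (hs : 0 < s) :
    Tendsto (fun n => grid T n (gridIndex T n s + 1)) atTop (𝓝[≥] s) := by
  refine tendsto_nhdsWithin_iff.2 ⟨?_, Eventually.of_forall fun n => ?_⟩
  · have h0 : Tendsto (fun n : ℕ => (1 / 2 : ℝ≥0) ^ n) atTop (𝓝 0) :=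
      NNReal.tendsto_pow_atTop_nhds_zero_of_lt_one (by rw [← NNReal.coe_lt_coe]; norm_num)
    have h1 := (tendsto_nhdsWithin_iff.1 (tendsto_grid_gridIndex hT hs)).1.add (h0.const_mul T)
    simp only [grid_gridIndex_succ]
    simpa using h1
  · rw [mem_Ici, grid_gridIndex_succ]
    exact (grid_gridIndex_lt hT n hs).2

/-- The increment of `x` over the dyadic interval `(T i / 2 ^ n, T (i + 1) / 2 ^ n]`. -/
noncomputable def Path.increment (x : Path) (T : ℝ≥0) (n i : ℕ) : ℝ :=
  x (grid T n (i + 1)) - x (grid T n i)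

theorem Path.increment_nonneg (x : Path) {T : ℝ≥0} (hT : 0 < T) (n i : ℕ) :
    0 ≤ x.increment T n i :=
  sub_nonneg.2 (x.mono ((grid_strictMono hT n).monotone i.le_succ))

theorem Path.tendsto_increment (x : Path) {T : ℝ≥0} (hT : 0 < T) {s : ℝ≥0} (hs : 0 < s) :
    Tendsto (fun n => x.increment T n (gridIndex T n s)) atTop (𝓝 (x.jump s)) :=
  ((x.1.right_continuous s).tendsto.comp (tendsto_grid_gridIndex_succ hT hs)).sub
    ((x.tendsto_left s).comp (tendsto_grid_gridIndex hT hs))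

theorem lintegral_gridIndex (x : Path) {T : ℝ≥0} (hT : 0 < T) (n : ℕ) {φ : ℕ → ℝ}
    (hφ : ∀ i, 0 ≤ φ i) :
    ∫⁻ s in Ioc 0 T, ENNReal.ofReal (φ (gridIndex T n s)) ∂x.stieltjes
      = ∑ i ∈ Finset.range (2 ^ n), ENNReal.ofReal (φ i * x.increment T n i) := by
  obtain ⟨h1, h2⟩ := setIntegral_gridIndex hT n x.stieltjes x.stieltjes_Ioc_lt_top φ (2 ^ n)
  rw [grid_last] at h1 h2
  rw [← ofReal_integral_eq_lintegral_ofReal h1 (ae_of_all _ fun s => hφ _), h2,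
    ENNReal.ofReal_sum_of_nonneg fun i _ => mul_nonneg (hφ i) measureReal_nonneg]
  refine Finset.sum_congr rfl fun i _ => ?_
  rw [real_stieltjes_Ioc _ ((grid_strictMono hT n).monotone i.le_succ), Path.increment]

/-- At a continuity point the increment over the dyadic cell tends to zero, so the weight tends to
$1$; then Fatou. With $b$ very negative the weight suppresses the jumps. -/
theorem stieltjes_diff_jumps_le (x : Path) {T : ℝ≥0} (hT : 0 < T) (b : ℝ) :
    x.stieltjes (Ioc 0 T \ x.jumps) ≤ liminf (fun n => ∫⁻ s in Ioc 0 T,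
      ENNReal.ofReal (Real.exp (b * x.increment T n (gridIndex T n s))) ∂x.stieltjes) atTop := by
  have hm : ∀ n, Measurable fun s =>
      ENNReal.ofReal (Real.exp (b * x.increment T n (gridIndex T n s))) := fun n =>
    (measurable_from_top (f := fun i : ℕ =>
      ENNReal.ofReal (Real.exp (b * x.increment T n i)))).comp (measurable_gridIndex T n)
  have hA : MeasurableSet (Ioc 0 T \ x.jumps) := measurableSet_Ioc.diff x.measurableSet_jumps
  calc x.stieltjes (Ioc 0 T \ x.jumps) = ∫⁻ _ in Ioc 0 T \ x.jumps, 1 ∂x.stieltjes := by simp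
    _ = ∫⁻ s in Ioc 0 T \ x.jumps, liminf (fun n =>
          ENNReal.ofReal (Real.exp (b * x.increment T n (gridIndex T n s)))) atTop
          ∂x.stieltjes := by
        refine setLIntegral_congr_fun hA fun s hs => ?_
        have hj : x.jump s = 0 := by
          have := hs.2
          rw [x.mem_jumps_iff] at this
          exact le_antisymm (not_lt.1 this) (x.jump_nonneg s)
        have h1 := (x.tendsto_increment hT hs.1.1).const_mul b
        have h2 := ENNReal.tendsto_ofReal ((Real.continuous_exp.tendsto _).comp h1)
        rw [hj, mul_zero, Real.exp_zero, ENNReal.ofReal_one] at h2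
        exact h2.liminf_eq.symm
    _ ≤ liminf (fun n => ∫⁻ s in Ioc 0 T \ x.jumps,
          ENNReal.ofReal (Real.exp (b * x.increment T n (gridIndex T n s))) ∂x.stieltjes) atTop :=
        lintegral_liminf_le hm
    _ ≤ _ := liminf_le_liminf (Eventually.of_forall fun n => lintegral_mono_set sdiff_subset)

section

variable {Ω : Type*} {m : MeasurableSpace Ω} {α β : ℝ} {𝔽 : Filtration ℝ≥0 m} {P : Measure Ω}
  {L X : Ω → Path} {T : ℝ≥0}

/-- The scaling identity with test function $x$ gives
$E[e^{\beta(1-g)\Delta}g^a\,g\Delta]=E[\Delta]$. Dropping $g^a\ge1$ leaves the gain $g^{-1}$,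
independent of the length of the interval. -/
theorem lintegral_exp_mul_increment_le [IsProbabilityMeasure P] (hα : 0 < α) (hβ : 0 < β)
    (hL : IsGammaProcess α β 𝔽 P L) {s t : ℝ≥0} (hst : s < t) {g : ℝ} (hg : 1 ≤ g) :
    ∫⁻ ω, ENNReal.ofReal (Real.exp (β * (1 - g) * (L ω t - L ω s)) * (L ω t - L ω s)) ∂P
      ≤ ENNReal.ofReal g⁻¹ * ∫⁻ ω, ENNReal.ofReal (L ω t - L ω s) ∂P := by
  have hg0 : 0 < g := one_pos.trans_le hg
  have hΔ : Measurable fun ω => L ω t - L ω s := (hL.measurable t).sub (hL.measurable s)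
  have h := lintegral_mul_step hα hβ hL hst (W := fun _ => 1) (g := fun _ => g)
    measurable_const measurable_const (fun _ => hg0) ENNReal.measurable_ofReal
  rw [← hL.law_increment s t hst, lintegral_map ENNReal.measurable_ofReal hΔ] at h
  simp only [lintegral_const, measure_univ, one_mul] at h
  rw [← h, ← lintegral_const_mul' _ _ ENNReal.ofReal_ne_top]
  refine lintegral_mono fun ω => ?_
  have hpos : 0 ≤ L ω t - L ω s := sub_nonneg.2 ((L ω).mono hst.le)
  have hsd : 0 ≤ stepDensity α β L s t (fun _ => g) ω := (Real.exp_pos _).le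
  rw [← ENNReal.ofReal_mul hsd, ← ENNReal.ofReal_mul (by positivity)]
  refine ENNReal.ofReal_le_ofReal ?_
  have e : g⁻¹ * (stepDensity α β L s t (fun _ => g) ω * (g * (L ω t - L ω s)))
      = stepDensity α β L s t (fun _ => g) ω * (L ω t - L ω s) := by field_simp
  rw [e]
  refine mul_le_mul_of_nonneg_right (Real.exp_le_exp.2 ?_) hpos
  have h1 : 0 ≤ α * ((t : ℝ) - s) * Real.log g :=
    mul_nonneg (mul_nonneg hα.le (sub_nonneg.2 (NNReal.coe_le_coe.2 hst.le))) (Real.log_nonneg hg)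
  linarith

/-- The gain $g^{-1}$ on each cell adds up to a bound uniform in the mesh, which survives Fatou in
$\omega$. Letting $g\to\infty$ shows that a gamma process has no continuous part. -/
theorem lintegral_stieltjes_diff_jumps_le [IsProbabilityMeasure P] (hα : 0 < α) (hβ : 0 < β)
    (hL : IsGammaProcess α β 𝔽 P L) (hT : 0 < T) {g : ℝ} (hg : 1 ≤ g) :
    ∫⁻ ω, (L ω).stieltjes (Ioc 0 T \ (L ω).jumps) ∂P
      ≤ ENNReal.ofReal g⁻¹ * ∫⁻ ω, ENNReal.ofReal (L ω T) ∂P := by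
  have hmi : ∀ n i, Measurable fun ω => (L ω).increment T n i := fun n i =>
    (hL.measurable _).sub (hL.measurable _)
  have hms : ∀ n i, Measurable fun ω => ENNReal.ofReal
      (Real.exp (β * (1 - g) * (L ω).increment T n i) * (L ω).increment T n i) := fun n i =>
    ((Real.measurable_exp.comp ((hmi n i).const_mul _)).mul (hmi n i)).ennreal_ofReal
  have hF := fun n ω => lintegral_gridIndex (L ω) hT n
    (φ := fun i => Real.exp (β * (1 - g) * (L ω).increment T n i)) fun i => (Real.exp_pos _).le
  have hsum : ∀ n ω, ∑ i ∈ Finset.range (2 ^ n), ENNReal.ofReal ((L ω).increment T n i)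
      = ENNReal.ofReal (L ω T) := fun n ω => by
    rw [← ENNReal.ofReal_sum_of_nonneg fun i _ => (L ω).increment_nonneg hT n i]
    unfold Path.increment
    rw [Finset.sum_range_sub fun i => L ω (grid T n i), grid_zero, grid_last, Path.map_zero,
      sub_zero]
  have hbound : ∀ n, ∫⁻ ω, ∑ i ∈ Finset.range (2 ^ n), ENNReal.ofReal
      (Real.exp (β * (1 - g) * (L ω).increment T n i) * (L ω).increment T n i) ∂P
        ≤ ENNReal.ofReal g⁻¹ * ∫⁻ ω, ENNReal.ofReal (L ω T) ∂P := fun n => by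
    rw [lintegral_finsetSum _ fun i _ => hms n i, ← lintegral_congr (hsum n),
      lintegral_finsetSum _ fun i _ => (hmi n i).ennreal_ofReal, Finset.mul_sum]
    exact Finset.sum_le_sum fun i _ =>
      lintegral_exp_mul_increment_le hα hβ hL (grid_strictMono hT n i.lt_succ_self) hg
  calc _ ≤ ∫⁻ ω, liminf (fun n => ∑ i ∈ Finset.range (2 ^ n), ENNReal.ofReal
      (Real.exp (β * (1 - g) * (L ω).increment T n i) * (L ω).increment T n i)) atTop ∂P := by
        refine lintegral_mono fun ω => ?_
        have := stieltjes_diff_jumps_le (L ω) hT (β * (1 - g))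
        simpa only [hF] using this
    _ ≤ liminf (fun n => ∫⁻ ω, ∑ i ∈ Finset.range (2 ^ n), ENNReal.ofReal
      (Real.exp (β * (1 - g) * (L ω).increment T n i) * (L ω).increment T n i) ∂P) atTop :=
        lintegral_liminf_le fun n => Finset.measurable_sum _ fun i _ => hms n i
    _ ≤ _ := (liminf_le_liminf (Eventually.of_forall hbound)).trans_eq (by simp)

theorem measurable_stieltjes_diff_jumps (hX : ∀ t ≤ T, Measurable fun ω => X ω t) :
    Measurable fun ω => (X ω).stieltjes (Ioc 0 T \ (X ω).jumps) := by
  have hm : Measurable (Function.uncurry fun (ω : Ω) (s : ℝ≥0) =>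
      {p : Ω × ℝ≥0 | min p.2 T ∈ (X p.1).jumps}ᶜ.indicator (1 : Ω × ℝ≥0 → ℝ≥0∞) (ω, s)) :=
    measurable_one.indicator (measurableSet_jumps_min hX).compl
  convert measurable_setLIntegral_stieltjes hX hm using 2 with ω
  rw [← setLIntegral_one, ← lintegral_indicator (measurableSet_Ioc.diff (X ω).measurableSet_jumps),
    ← lintegral_indicator measurableSet_Ioc]
  refine lintegral_congr fun s => ?_
  by_cases hs : s ∈ Ioc 0 T
  · by_cases hj : s ∈ (X ω).jumps <;>
      simp [indicator, hs.1, hs.2, hj]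
  · rw [indicator_of_notMem hs, indicator_of_notMem fun h => hs h.1]

theorem ae_stieltjes_diff_jumps [IsProbabilityMeasure P] (hα : 0 < α) (hβ : 0 < β)
    (hL : IsGammaProcess α β 𝔽 P L) (hT : 0 < T) :
    ∀ᵐ ω ∂P, (L ω).stieltjes (Ioc 0 T \ (L ω).jumps) = 0 := by
  refine (lintegral_eq_zero_iff (measurable_stieltjes_diff_jumps fun t _ => hL.measurable t)).1 ?_
  have hlim : Tendsto (fun n : ℕ => ENNReal.ofReal ((n : ℝ) + 1)⁻¹
      * ∫⁻ ω, ENNReal.ofReal (L ω T) ∂P) atTop (𝓝 0) := by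
    have h0 : Tendsto (fun n : ℕ => ENNReal.ofReal ((n : ℝ) + 1)⁻¹) atTop (𝓝 0) := by
      have := ENNReal.tendsto_ofReal (tendsto_one_div_add_atTop_nhds_zero_nat (𝕜 := ℝ))
      simpa using this
    simpa using ENNReal.Tendsto.mul_const h0 (Or.inr (lintegral_gamma_lt_top hα hβ hL hT).ne)
  refine le_antisymm (ge_of_tendsto' hlim fun n => ?_) zero_le
  exact lintegral_stieltjes_diff_jumps_le hα hβ hL hT (by simp)

end

/-! ### The tilting density of a solution -/

section

variable {σ : ℝ → ℝ} {σ₀ : ℝ} {x l : Path} {T : ℝ≥0}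

theorem restrict_stieltjes_eq_withDensity (h : IsAdmissible σ σ₀) (hx : IsPathSolution σ x l) :
    x.stieltjes.restrict (Ioc 0 T)
      = (l.stieltjes.restrict (Ioc 0 T)).withDensity fun s => ENNReal.ofReal (σ (x.left s)) := by
  refine Measure.ext_of_Iic _ _ fun a => ?_
  have e : Iic a ∩ Ioc 0 T = Ioc 0 (min a T) := by
    ext s
    simp only [mem_inter_iff, mem_Iic, mem_Ioc, le_min_iff]
    tauto
  rw [Measure.restrict_apply measurableSet_Iic, withDensity_apply _ measurableSet_Iic,
    Measure.restrict_restrict measurableSet_Iic, e, Path.stieltjes_Ioc, Path.map_zero, sub_zero,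
    (hx (min a T)).2, ofReal_integral_eq_lintegral_ofReal (hx _).1
      (ae_of_all _ fun s => (h.pos _).le)]

/-- As $\sigma>0$, every jump of $l$ is a jump of $x$, and $dx\ll dl$; so the absence of a
continuous part is inherited. -/
theorem stieltjes_diff_jumps_eq_zero (h : IsAdmissible σ σ₀) (hx : IsPathSolution σ x l)
    (hl : l.stieltjes (Ioc 0 T \ l.jumps) = 0) : x.stieltjes (Ioc 0 T \ x.jumps) = 0 := by
  have hσ : Measurable fun s => ENNReal.ofReal (σ (x.left s)) := (h.measurable_left x).ennreal_ofReal
  have happ : ∀ {A : Set ℝ≥0}, MeasurableSet A → A ⊆ Ioc 0 T →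
      x.stieltjes A = ∫⁻ s in A, ENNReal.ofReal (σ (x.left s)) ∂l.stieltjes := fun {A} hA hAT => by
    have := congrArg (fun μ => μ A) (restrict_stieltjes_eq_withDensity (T := T) h hx)
    beta_reduce at this
    rwa [Measure.restrict_apply hA, withDensity_apply _ hA, Measure.restrict_restrict hA,
      inter_eq_left.2 hAT] at this
  rw [happ (measurableSet_Ioc.diff x.measurableSet_jumps) sdiff_subset]
  have hsub : Ioc 0 T \ x.jumps ⊆ Ioc 0 T \ l.jumps := by
    intro s hs
    refine ⟨hs.1, fun hj => hs.2 ?_⟩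
    have h1 := happ (measurableSet_singleton s) (singleton_subset_iff.2 hs.1)
    rw [lintegral_singleton, Path.stieltjes_singleton, Path.stieltjes_singleton] at h1
    rw [Path.mem_jumps_iff] at hj ⊢
    have h2 : 0 < ENNReal.ofReal (x s - x.left s) := by
      rw [h1]
      exact ENNReal.mul_pos (ENNReal.ofReal_pos.2 (h.pos _)).ne' (ENNReal.ofReal_pos.2 hj).ne'
    exact ENNReal.ofReal_pos.1 h2
  exact setLIntegral_measure_zero _ _ (measure_mono_null hsub hl)

/-- Without a continuous part the sum over jumps is the full integral against $dx=\sigma\,dl$, and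
$(1-1/\sigma)\sigma=\sigma-1$. -/
theorem explicitDensity_eq_exp {α β : ℝ} (hα : 0 < α) (hβ : 0 < β) (h : IsAdmissible σ σ₀)
    (hx : IsPathSolution σ x l) (hl : l.stieltjes (Ioc 0 T \ l.jumps) = 0) :
    explicitDensity α β σ T x
      = Real.exp (-((∫ s in Ioc 0 T, β * (1 - σ (x.left s)) ∂l.stieltjes)
        + ∫ s in Ioc 0 T, α * Real.log (σ (x.left s)) ∂lebesgueTime)) := by
  have hx0 := stieltjes_diff_jumps_eq_zero h hx hl
  rw [explicitDensity_eq_stieltjes hα hβ h, neg_add, ← sub_eq_add_neg]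
  congr 2
  have hae : (Ioc 0 T ∩ x.jumps : Set ℝ≥0) =ᵐ[x.stieltjes] Ioc 0 T := by
    rw [← sdiff_sdiff_right_self]
    exact sdiff_null_ae_eq_self hx0
  rw [setIntegral_congr_set hae, restrict_stieltjes_eq_withDensity h hx,
    integral_withDensity_eq_integral_toReal_smul (h.measurable_left x).ennreal_ofReal
      (ae_of_all _ fun _ => ENNReal.ofReal_lt_top), ← integral_neg]
  refine integral_congr_ae (ae_of_all _ fun s => ?_)
  have := h.pos (x.left s)
  beta_reduce
  rw [ENNReal.toReal_ofReal this.le, smul_eq_mul]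
  field_simp
  ring

theorem tilt_eq_inv_explicitDensity {Ω : Type*} {X L : Ω → Path} {α β : ℝ} (hα : 0 < α)
    (hβ : 0 < β) (h : IsAdmissible σ σ₀) {ω : Ω} (hx : IsPathSolution σ (X ω) (L ω))
    (hl : (L ω).stieltjes (Ioc 0 T \ (L ω).jumps) = 0) :
    tilt α β L T (fun ω s => σ ((X ω).left (min s T))) ω
      = (explicitDensity α β σ T (X ω))⁻¹ := by
  rw [explicitDensity_eq_exp hα hβ h hx hl, Real.exp_neg, inv_inv, tilt]
  congr 2 <;> exact setIntegral_congr_fun measurableSet_Ioc fun s hs => by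
    rw [min_eq_left hs.2]

end

/-! ### The path σ-algebra is generated by the dyadic coordinates -/

/-- The values of the path `x` at the dyadic points of level `k` in `(0, T]`. -/
noncomputable def Path.gridValues (T : ℝ≥0) (k : ℕ) (x : Path) (i : Fin (2 ^ k)) : ℝ :=
  x (grid T k (i + 1))

theorem measurable_gridValues (T : ℝ≥0) (k : ℕ) :
    Measurable[pathFiltration T] (Path.gridValues T k) :=
  (@measurable_pi_iff _ _ _ (pathFiltration T) _ _).2 fun i => measurable_coordinate (grid_le i.2)

/-- The cylinder sets over dyadic grids in `(0, T]`. -/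
def gridCylinders (T : ℝ≥0) : Set (Set Path) :=
  {S | ∃ (k : ℕ) (B : Set (Fin (2 ^ k) → ℝ)), MeasurableSet B ∧ S = Path.gridValues T k ⁻¹' B}

theorem exists_gridValues_refine (T : ℝ≥0) {k n : ℕ} (h : k ≤ n) {B : Set (Fin (2 ^ k) → ℝ)}
    (hB : MeasurableSet B) : ∃ B' : Set (Fin (2 ^ n) → ℝ), MeasurableSet B' ∧
      Path.gridValues T k ⁻¹' B = Path.gridValues T n ⁻¹' B' := by
  have hlt : ∀ i : Fin (2 ^ k), ((i : ℕ) + 1) * 2 ^ (n - k) - 1 < 2 ^ n := fun i => by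
    have h1 : (i : ℕ) + 1 ≤ 2 ^ k := i.2
    have h2 : ((i : ℕ) + 1) * 2 ^ (n - k) ≤ 2 ^ n :=
      calc ((i : ℕ) + 1) * 2 ^ (n - k) ≤ 2 ^ k * 2 ^ (n - k) := Nat.mul_le_mul_right _ h1
        _ = 2 ^ n := by rw [← pow_add, Nat.add_sub_cancel' h]
    have h3 : 0 < 2 ^ n := by positivity
    omega
  let ρ : (Fin (2 ^ n) → ℝ) → Fin (2 ^ k) → ℝ := fun v i => v ⟨(i + 1) * 2 ^ (n - k) - 1, hlt i⟩
  have hρ : Measurable ρ := measurable_pi_lambda _ fun i => measurable_pi_apply _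
  refine ⟨ρ ⁻¹' B, hρ hB, ?_⟩
  have e : Path.gridValues T k = ρ ∘ Path.gridValues T n := by
    funext x i
    have h1 : 0 < (i + 1 : ℕ) * 2 ^ (n - k) := by positivity
    simp only [ρ, Function.comp_apply, Path.gridValues]
    rw [grid_refine T h, Nat.sub_add_cancel h1]
  rw [e, preimage_comp]

theorem isPiSystem_gridCylinders (T : ℝ≥0) : IsPiSystem (gridCylinders T) := by
  rintro _ ⟨k, B, hB, rfl⟩ _ ⟨n, C, hC, rfl⟩ -
  obtain ⟨B', hB', e⟩ := exists_gridValues_refine T (le_max_left k n) hB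
  obtain ⟨C', hC', e'⟩ := exists_gridValues_refine T (le_max_right k n) hC
  exact ⟨max k n, B' ∩ C', hB'.inter hC', by rw [e, e', preimage_inter]⟩

/-- By right-continuity each coordinate in $(0,T]$ is the limit of values at right endpoints of
dyadic cells, which do not exceed $T$. -/
theorem pathFiltration_eq_generateFrom {T : ℝ≥0} (hT : 0 < T) :
    (pathFiltration T : MeasurableSpace Path)
      = MeasurableSpace.generateFrom (gridCylinders T) := by
  refine le_antisymm (iSup₂_le fun s hs => ?_) (MeasurableSpace.generateFrom_le ?_)
  · have hg : ∀ k, Measurable[MeasurableSpace.generateFrom (gridCylinders T)]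
        (Path.gridValues T k) := fun k B hB =>
      MeasurableSpace.measurableSet_generateFrom ⟨k, B, hB, rfl⟩
    suffices h : Measurable[MeasurableSpace.generateFrom (gridCylinders T)] fun x : Path => x s from
      h.comap_le
    -- The time $0$ is not among the grid coordinates, but paths vanish there.
    rcases (zero_le (a := s)).eq_or_lt with rfl | h0
    · simp only [Path.map_zero]
      exact measurable_const
    have hlt : ∀ n, gridIndex T n s < 2 ^ n := fun n => by
      have h1 := (grid_gridIndex_lt hT n h0).1.trans_le hs
      exact (grid_strictMono hT n).lt_iff_lt.1 (h1.trans_eq (grid_last T n).symm)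
    refine @measurable_of_tendsto_metrizable _ _ (MeasurableSpace.generateFrom (gridCylinders T))
      _ _ _ _ (fun n (x : Path) => x (grid T n (gridIndex T n s + 1))) _ (fun n => ?_)
      (tendsto_pi_nhds.2 fun x =>
        (x.1.right_continuous s).tendsto.comp (tendsto_grid_gridIndex_succ hT h0))
    exact (measurable_pi_apply (⟨_, hlt n⟩ : Fin (2 ^ n))).comp (hg n)
  · rintro _ ⟨k, B, hB, rfl⟩
    exact measurable_gridValues T k hB

theorem ext_of_gridValues {T : ℝ≥0} (hT : 0 < T) {μ ν : Measure[pathFiltration T] Path}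
    [IsFiniteMeasure μ] (h : ∀ (k : ℕ) (B : Set (Fin (2 ^ k) → ℝ)), MeasurableSet B →
      μ (Path.gridValues T k ⁻¹' B) = ν (Path.gridValues T k ⁻¹' B)) : μ = ν :=
  @ext_of_generate_finite _ (pathFiltration T) _ _ _ (pathFiltration_eq_generateFrom hT)
    (isPiSystem_gridCylinders T) _ (by rintro _ ⟨k, B, hB, rfl⟩; exact h k B hB)
    (h 0 univ MeasurableSet.univ)

theorem measurable_path_iff {Ω : Type*} {m : MeasurableSpace Ω} {X : Ω → Path} :
    Measurable X ↔ ∀ t : ℝ≥0, Measurable fun ω => X ω t :=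
  measurable_comap_iff.trans measurable_pi_iff

/-! ### Comparison of the two laws on $[0,T]$ -/

section

variable {Ω : Type*} {m : MeasurableSpace Ω} {α β : ℝ} {𝔽 : Filtration ℝ≥0 m} {P : Measure Ω}
  {L X : Ω → Path} {T : ℝ≥0} {σ : ℝ → ℝ} {σ₀ : ℝ}

/-- The increments have the same product law on both spaces; the summation map `S` recovers the grid
values. -/
theorem gamma_map_grid_eq {Ω' : Type*} {m' : MeasurableSpace Ω'} {𝔽' : Filtration ℝ≥0 m'}
    {P' : Measure Ω'} {L' : Ω' → Path} [IsProbabilityMeasure P] [IsProbabilityMeasure P']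
    (hα : 0 < α) (hβ : 0 < β) (hL : IsGammaProcess α β 𝔽 P L) (hL' : IsGammaProcess α β 𝔽' P' L')
    (hT : 0 < T) (k : ℕ) :
    (P.map fun ω (i : Fin (2 ^ k)) => L ω (grid T k (i + 1)))
      = P'.map fun ω (i : Fin (2 ^ k)) => L' ω (grid T k (i + 1)) := by
  let S : (Fin (2 ^ k) → ℝ) → Fin (2 ^ k) → ℝ := fun v i =>
    ∑ l : Fin (2 ^ k), if (l : ℕ) < i + 1 then v l else 0
  have hS : Measurable S := by
    refine measurable_pi_lambda _ fun i => Finset.measurable_sum _ fun l _ => ?_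
    split_ifs
    · exact measurable_pi_apply l
    · exact measurable_const
  have hS' : ∀ x : Path, S (fun i => x (grid T k (i + 1)) - x (grid T k i))
      = fun i : Fin (2 ^ k) => x (grid T k (i + 1)) := fun x => by
    funext i
    simp only [S]
    rw [sum_fin_ite_lt (J := i + 1) i.2 fun l => x (grid T k (l + 1)) - x (grid T k l),
      Finset.sum_range_sub fun l => x (grid T k l), grid_zero, Path.map_zero, sub_zero]
  have h := (map_increments_eq_pi hα hβ hL (grid_strictMono hT k) (2 ^ k)).trans
    (map_increments_eq_pi hα hβ hL' (grid_strictMono hT k) (2 ^ k)).symm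
  have h1 := congrArg (Measure.map S) h
  have hm : Measurable fun ω (i : Fin (2 ^ k)) => L ω (grid T k (i + 1)) - L ω (grid T k i) :=
    measurable_pi_lambda _ fun i => (hL.measurable _).sub (hL.measurable _)
  have hm' : Measurable fun ω (i : Fin (2 ^ k)) => L' ω (grid T k (i + 1)) - L' ω (grid T k i) :=
    measurable_pi_lambda _ fun i => (hL'.measurable _).sub (hL'.measurable _)
  rw [Measure.map_map hS hm, Measure.map_map hS hm'] at h1
  have e : (S ∘ fun ω (i : Fin (2 ^ k)) => L ω (grid T k (i + 1)) - L ω (grid T k i))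
        = fun ω (i : Fin (2 ^ k)) => L ω (grid T k (i + 1)) := funext fun ω => hS' (L ω)
  have e' : (S ∘ fun ω (i : Fin (2 ^ k)) => L' ω (grid T k (i + 1)) - L' ω (grid T k i))
        = fun ω (i : Fin (2 ^ k)) => L' ω (grid T k (i + 1)) := funext fun ω => hS' (L' ω)
  rwa [e, e'] at h1

theorem IsPathSolution.eq_of_one {x l : Path} (h : IsPathSolution (fun _ => 1) x l) (t : ℝ≥0) :
    x t = l t := by
  rw [(h t).2, setIntegral_const, real_stieltjes_Ioc _ (zero_le (a := t)), Path.map_zero, sub_zero,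
    smul_eq_mul, mul_one]

/-- On a grid cylinder, $\mathbb P^1$ gives the law of a gamma process, which is the law of $X$
under the tilted measure. The tilting density is $1/\mathcal Z_T(X)$ almost surely, a function of
the path known at $T$, so it descends to path space. -/
theorem trim_eq_withDensity [IsProbabilityMeasure P] (hα : 0 < α) (hβ : 0 < β)
    (h : IsAdmissible σ σ₀) (hL : IsGammaProcess α β 𝔽 P L)
    (hX : ∀ t : ℝ≥0, Measurable[𝔽 t] fun ω => X ω t)
    (hsol : ∀ᵐ ω ∂P, IsPathSolution σ (X ω) (L ω))
    {Ω' : Type*} {m' : MeasurableSpace Ω'} {𝔽' : Filtration ℝ≥0 m'} {P' : Measure Ω'}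
    {L' X' : Ω' → Path} [IsProbabilityMeasure P'] (hL' : IsGammaProcess α β 𝔽' P' L')
    (hX' : ∀ t : ℝ≥0, Measurable[𝔽' t] fun ω => X' ω t)
    (hsol' : ∀ᵐ ω ∂P', IsPathSolution (fun _ => 1) (X' ω) (L' ω)) (hT : 0 < T) :
    (P'.map X').trim (pathFiltration.le T)
      = ((P.map X).trim (pathFiltration.le T)).withDensity
          fun x => ENNReal.ofReal (explicitDensity α β σ T x)⁻¹ := by
  have hXm : Measurable X := measurable_path_iff.2 fun t => (hX t).mono (𝔽.le t) le_rfl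
  have hXm' : Measurable X' := measurable_path_iff.2 fun t => (hX' t).mono (𝔽'.le t) le_rfl
  have : IsProbabilityMeasure (P'.map X') := Measure.isProbabilityMeasure_map hXm'.aemeasurable
  have : IsFiniteMeasure ((P'.map X').trim (pathFiltration.le T)) := isFiniteMeasure_trim _
  have hE : Measurable[pathFiltration T]
      fun x => ENNReal.ofReal (explicitDensity α β σ T x)⁻¹ :=
    (measurable_explicitDensity hα hβ h T).inv.ennreal_ofReal
  have hE' := hE.mono (pathFiltration.le T) le_rfl
  refine ext_of_gridValues hT fun k B hB => ?_
  have hA : MeasurableSet[pathFiltration T] (Path.gridValues T k ⁻¹' B) :=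
    measurable_gridValues T k hB
  have hA' := pathFiltration.le T _ hA
  have hUm : Measurable fun ω (i : Fin (2 ^ k)) => L ω (grid T k (i + 1)) :=
    measurable_pi_lambda _ fun i => hL.measurable _
  have hUm' : Measurable fun ω (i : Fin (2 ^ k)) => L' ω (grid T k (i + 1)) :=
    measurable_pi_lambda _ fun i => hL'.measurable _
  have hleft : (P'.map X').trim (pathFiltration.le T) (Path.gridValues T k ⁻¹' B)
      = (P'.map fun ω (i : Fin (2 ^ k)) => L' ω (grid T k (i + 1))) B := by
    rw [trim_measurableSet_eq _ hA, Measure.map_apply hXm' hA', Measure.map_apply hUm' hB]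
    refine measure_congr ?_
    filter_upwards [hsol'] with ω hω
    have e : Path.gridValues T k (X' ω) = fun i : Fin (2 ^ k) => L' ω (grid T k (i + 1)) :=
      funext fun i => hω.eq_of_one _
    exact congrArg (· ∈ B) e
  have hright : ((P.map X).trim (pathFiltration.le T)).withDensity
      (fun x => ENNReal.ofReal (explicitDensity α β σ T x)⁻¹) (Path.gridValues T k ⁻¹' B)
      = (P.map fun ω (i : Fin (2 ^ k)) => L ω (grid T k (i + 1))) B := by
    have hVm : Measurable fun ω (i : Fin (2 ^ k)) => X ω (grid T k (i + 1)) :=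
      measurable_pi_lambda _ fun i => measurable_path_iff.1 hXm _
    rw [← withDensity_tilt_map_eq hα hβ h hL hX hsol hT k, Measure.map_apply hVm hB,
      withDensity_apply _ (hVm hB), withDensity_apply _ hA,
      restrict_trim _ _ hA, lintegral_trim _ hE, setLIntegral_map hA' hE' hXm]
    refine lintegral_congr_ae (ae_restrict_of_ae ?_)
    filter_upwards [hsol, ae_stieltjes_diff_jumps hα hβ hL hT] with ω hω hω'
    rw [tilt_eq_inv_explicitDensity hα hβ h hω hω']
  rw [hleft, hright, gamma_map_grid_eq hα hβ hL hL' hT]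

end

/-- A density that is everywhere positive and finite can be inverted, so one identity yields both
absolute continuities and the derivative. -/
theorem equivalent_of_eq_withDensity_inv {E : Type*} {m : MeasurableSpace E} {μ ν : Measure E}
    [IsFiniteMeasure ν] {f : E → ℝ} (hf : Measurable f) (hpos : ∀ x, 0 < f x)
    (h : ν = μ.withDensity fun x => ENNReal.ofReal (f x)⁻¹) :
    μ ≪ ν ∧ ν ≪ μ ∧ μ.rnDeriv ν =ᵐ[ν] fun x => ENNReal.ofReal (f x) := by
  have h1 : μ = ν.withDensity fun x => ENNReal.ofReal (f x) := by
    have := withDensity_inv_same (μ := μ) (f := fun x => ENNReal.ofReal (f x)⁻¹)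
      hf.inv.ennreal_ofReal (ae_of_all _ fun x => (ENNReal.ofReal_pos.2 (inv_pos.2 (hpos x))).ne')
      (ae_of_all _ fun x => ENNReal.ofReal_ne_top)
    rw [← h] at this
    simpa only [ENNReal.ofReal_inv_of_pos (hpos _), inv_inv] using this.symm
  refine ⟨?_, ?_, ?_⟩
  · rw [h1]; exact withDensity_absolutelyContinuous _ _
  · rw [h]; exact withDensity_absolutelyContinuous _ _
  · have := Measure.rnDeriv_withDensity ν hf.ennreal_ofReal
    rwa [← h1] at this

/-! ### Extension of the coefficient to the negative half-line -/

section

variable {α β : ℝ} {σ τ : ℝ → ℝ}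

/-- Left limits of paths are nonnegative, so only the values of the coefficient on $[0,\infty)$
matter. -/
theorem Y_congr (h : ∀ y, 0 ≤ y → σ y = τ y) : Y α β σ = Y α β τ := by
  funext x p
  unfold Y
  rw [h _ (x.left_nonneg _)]

theorem explicitDensity_congr (h : ∀ y, 0 ≤ y → σ y = τ y) :
    explicitDensity α β σ = explicitDensity α β τ := by
  unfold explicitDensity
  rw [Y_congr h]

theorem solvesDensitySDE_congr (h : ∀ y, 0 ≤ y → σ y = τ y) :
    SolvesDensitySDE α β σ = SolvesDensitySDE α β τ := by
  unfold SolvesDensitySDE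
  rw [Y_congr h]

theorem IsPathSolution.congr (h : ∀ y, 0 ≤ y → σ y = τ y) {x l : Path}
    (hx : IsPathSolution σ x l) : IsPathSolution τ x l := by
  have e : (fun s => τ (x.left s)) = fun s => σ (x.left s) :=
    funext fun s => (h _ (x.left_nonneg s)).symm
  intro t
  rw [e]
  exact hx t

end

end GammaSDE

theorem mainTheorem3 (α β : ℝ) (hα : 0 < α) (hβ : 0 < β) (σ : ℝ → ℝ)
    (hσ_meas : Measurable (fun x : Set.Ici (0 : ℝ) => σ x))
    (hσ_bdd : ∀ b : ℝ, BddAbove (σ '' Set.Icc 0 b))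
    (σ₀ : ℝ) (hσ₀ : 0 < σ₀) (hσ_lower : ∀ x : ℝ, 0 ≤ x → σ₀ ≤ σ x)
    (Pσ P1 : Measure GammaSDE.Path)
    (hPσ : GammaSDE.IsSolutionLaw.{u} α β σ Pσ)
    (huniq : ∀ Q : Measure GammaSDE.Path, GammaSDE.IsSolutionLaw.{u} α β σ Q → Q = Pσ)
    (hP1 : GammaSDE.IsSolutionLaw.{u} α β (fun _ => 1) P1) :
    -- both double integrals are almost surely finite
    (∀ᵐ x ∂P1, ∀ T : ℝ≥0,
      IntegrableOn (fun p => Real.log (GammaSDE.Y α β σ x p)) (GammaSDE.strip T)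
        (GammaSDE.jumpMeasure x) ∧
      IntegrableOn (fun p => GammaSDE.Y α β σ x p - 1) (GammaSDE.strip T)
        (GammaSDE.compensator α β)) ∧
    (∀ᵐ x ∂Pσ, ∀ T : ℝ≥0,
      IntegrableOn (fun p => Real.log (GammaSDE.Y α β σ x p)) (GammaSDE.strip T)
        (GammaSDE.jumpMeasure x) ∧
      IntegrableOn (fun p => GammaSDE.Y α β σ x p - 1) (GammaSDE.strip T)
        (GammaSDE.compensator α β)) ∧
    -- the explicit process is adapted and solves the equation for `Z` under `P1`
    (∀ T : ℝ≥0, Measurable[GammaSDE.pathFiltration T] (GammaSDE.explicitDensity α β σ T)) ∧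
    GammaSDE.SolvesDensitySDE α β σ P1 (GammaSDE.explicitDensity α β σ) ∧
    -- every solution is given by the explicit formula
    (∀ Z : ℝ≥0 → GammaSDE.Path → ℝ, GammaSDE.SolvesDensitySDE α β σ P1 Z →
      ∀ᵐ x ∂P1, ∀ T : ℝ≥0, Z T x = GammaSDE.explicitDensity α β σ T x) ∧
    -- the explicit formula gives the likelihood ratio of the laws on `[0,T]`
    (∀ T : ℝ≥0, 0 < T →
      Pσ.trim (GammaSDE.pathFiltration.le T) ≪ P1.trim (GammaSDE.pathFiltration.le T) ∧
      P1.trim (GammaSDE.pathFiltration.le T) ≪ Pσ.trim (GammaSDE.pathFiltration.le T) ∧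
      (Pσ.trim (GammaSDE.pathFiltration.le T)).rnDeriv (P1.trim (GammaSDE.pathFiltration.le T))
        =ᵐ[P1.trim (GammaSDE.pathFiltration.le T)]
          fun x => ENNReal.ofReal (GammaSDE.explicitDensity α β σ T x)) := by
  -- The assumptions on $\sigma$ concern $[0,\infty)$ only; extending it by $\sigma(0)$ to the left
  -- makes them global.
  obtain ⟨τ, hτ, hadm⟩ : ∃ τ : ℝ → ℝ, (∀ y, 0 ≤ y → σ y = τ y) ∧ GammaSDE.IsAdmissible τ σ₀ := by
    refine ⟨fun y => σ (max y 0), fun y hy => by simp only [max_eq_left hy], ?_, fun b => ?_, hσ₀,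
      fun y => hσ_lower _ (le_max_right _ _)⟩
    · exact hσ_meas.comp (f := fun y : ℝ => (⟨max y 0, mem_Ici.2 (le_max_right _ _)⟩ : Ici (0 : ℝ)))
        (Measurable.subtype_mk (by fun_prop))
    · refine (hσ_bdd b).mono ?_
      rintro _ ⟨y, hy, rfl⟩
      exact ⟨y, hy, by simp only [max_eq_left hy.1]⟩
  rw [GammaSDE.Y_congr hτ, GammaSDE.explicitDensity_congr hτ, GammaSDE.solvesDensitySDE_congr hτ]
  refine ⟨ae_of_all _ fun x T => ⟨GammaSDE.integrableOn_log_Y hα hadm x T,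
      GammaSDE.integrableOn_Y_sub_one hα hβ hadm x T⟩,
    ae_of_all _ fun x T => ⟨GammaSDE.integrableOn_log_Y hα hadm x T,
      GammaSDE.integrableOn_Y_sub_one hα hβ hadm x T⟩,
    GammaSDE.measurable_explicitDensity hα hβ hadm,
    GammaSDE.solvesDensitySDE_explicitDensity hα hβ hadm P1,
    fun Z hZ => GammaSDE.eq_explicitDensity_of_solves hα hβ hadm hZ, fun T hT => ?_⟩
  obtain ⟨Ω, m, 𝔽, P, X, L, hsol, rfl⟩ := hPσ
  obtain ⟨Ω', m', 𝔽', P', X', L', hsol', rfl⟩ := hP1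
  have := hsol.isProbabilityMeasure
  have := hsol'.isProbabilityMeasure
  have hX' : Measurable X' :=
    GammaSDE.measurable_path_iff.2 fun t => (hsol'.adapted t).mono (𝔽'.le t) le_rfl
  have : IsProbabilityMeasure (P'.map X') := Measure.isProbabilityMeasure_map hX'.aemeasurable
  have : IsFiniteMeasure ((P'.map X').trim (GammaSDE.pathFiltration.le T)) := isFiniteMeasure_trim _
  refine GammaSDE.equivalent_of_eq_withDensity_inv
    (GammaSDE.measurable_explicitDensity hα hβ hadm T) (fun x => Real.exp_pos _) ?_
  exact GammaSDE.trim_eq_withDensity hα hβ hadm hsol.isGammaProcess hsol.adapted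
    (hsol.sde.mono fun ω hω => GammaSDE.IsPathSolution.congr hτ hω) hsol'.isGammaProcess
    hsol'.adapted hsol'.sde hT
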